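/- Let $p>2$ be a prime, let $R$ be a complete discrete valuation ring of characteristic $p$ (so of equal characteristic $p$; the residue field is arbitrary) with uniformiser $\pi$, and let $X=\operatorname{Spf}A$ be a smooth affine formal $R$-scheme with geometrically connected fibres. For $n\ge 0$ let $\mathcal M_n=\operatorname{Spec}R[X]/(X^p-\pi^{(p-1)n}X)$, the finite flat $R$-group scheme of rank $p$ which is the kernel of the isogeny $X\mapsto X^p-\pi^{(p-1)n}X$ of $\mathbb G_{a,R}$. Let $m=pm'$ with $m'\ge 1$ an integer, put $\tilde m=m'(p(p-1)+1)$, and let $a_1,a_2\in A$ be such that the image $\bar a_1$ of $a_1$ in $A/\pi A$ is not a $p$-th power in $A/\pi A$. Let $Y_K$ be the cover of the generic fibre $X_K$ (the ring $A[1/\pi]$) defined by the equation $$(T_1^p,T_2^p)-(T_1,T_2)=(\pi^{-pm}a_1,\,a_2)$$ between ($p$-typical) Witt vectors of length two, subtraction being that of Witt vectors, and let $Y_{1,K}$ be the cover of $X_K$ defined by its first entry $T_1^p-T_1=\pi^{-pm}a_1$. Let $Y=\operatorname{Spf}B$ and $Y_1=\operatorname{Spf}B_1$ be the normalisations of $X$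 in $Y_K$ and in $Y_{1,K}$ (that is, $B$ and $B_1$ are the integral closures of $A$ in the rings of $Y_K$ and $Y_{1,K}$), with the natural maps $f:Y\to X$, $f_1:Y_1\to X$, $f_2:Y\to Y_1$, so that $f=f_1\circ f_2$. Then: 1. $f$ is finite, and on generic fibres $f$ is an étale $\mathbb Z/p^2\mathbb Z$-torsor while $f_1$ and $f_2$ are étale $\mathbb Z/p\mathbb Z$-torsors. 2. The special fibre of $Y$ is reduced, i.e. $B/\pi B$ is a reduced ring. 3. $f_1$ has the structure of a torsor under $\mathcal M_m$, and $f_2$ has the structure of a torsor under $\mathcal M_{\tilde m}$. 4. $f$ does not have the structure of a torsor under any finite flat $R$-group scheme of rank $p^2$ (commutative or not). -/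

import Mathlib

open scoped TensorProduct

universe u v w

noncomputable section

/-! ### The group schemes `M_n` -/

section GroupScheme

/-- The coordinate ring `R[X]/(X^p - π^((p-1)n) X)` of the group scheme `M_n`, the kernel of the
isogeny `X ↦ X^p - π^((p-1)n) X` of the additive group. -/
def MRing (R : Type u) [CommRing R] (p : ℕ) (π : R) (n : ℕ) : Type u :=
  AdjoinRoot (Polynomial.X ^ p - Polynomial.C (π ^ ((p - 1) * n)) * Polynomial.X : Polynomial R)

namespace MRing

variable (R : Type u) [CommRing R] (p : ℕ) (π : R) (n : ℕ)

instance : CommRing (MRing R p π n) := inferInstanceAs (CommRing (AdjoinRoot _))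

instance : Algebra R (MRing R p π n) := inferInstanceAs (Algebra R (AdjoinRoot _))

/-- The coordinate `X`. -/
def x : MRing R p π n :=
  AdjoinRoot.root (Polynomial.X ^ p - Polynomial.C (π ^ ((p - 1) * n)) * Polynomial.X)

lemma x_pow : x R p π n ^ p = algebraMap R _ (π ^ ((p - 1) * n)) * x R p π n := by
  have h := AdjoinRoot.eval₂_root
    (Polynomial.X ^ p - Polynomial.C (π ^ ((p - 1) * n)) * Polynomial.X : Polynomial R)
  simp only [Polynomial.eval₂_sub, Polynomial.eval₂_mul, Polynomial.eval₂_pow,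
    Polynomial.eval₂_X, Polynomial.eval₂_C] at h
  exact sub_eq_zero.mp h

variable {R p π n} in
/-- An element `s` with `s^p = π^((p-1)n) s` of an `R`-algebra `S` is an `S`-point of `M_n`. -/
def lift {S : Type v} [CommRing S] [Algebra R S] (s : S)
    (hs : s ^ p = algebraMap R S (π ^ ((p - 1) * n)) * s) : MRing R p π n →ₐ[R] S :=
  AdjoinRoot.liftAlgHom _ (Algebra.ofId R S) s (by
    simp only [Polynomial.eval₂_sub, Polynomial.eval₂_mul, Polynomial.eval₂_pow,
      Polynomial.eval₂_X, Polynomial.eval₂_C]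
    exact sub_eq_zero.mpr hs)

variable {R p π n} in
@[simp]
lemma lift_x {S : Type v} [CommRing S] [Algebra R S] (s : S)
    (hs : s ^ p = algebraMap R S (π ^ ((p - 1) * n)) * s) :
    lift s hs (x R p π n) = s :=
  AdjoinRoot.liftAlgHom_root ..

variable {R p π n} in
lemma algHom_ext {S : Type v} [CommRing S] [Algebra R S] {f g : MRing R p π n →ₐ[R] S}
    (h : f (x R p π n) = g (x R p π n)) : f = g :=
  AdjoinRoot.algHom_ext h

variable [Fact p.Prime] [CharP R p]

/-- The comultiplication `X ↦ X ⊗ 1 + 1 ⊗ X`. -/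
def comulHom : MRing R p π n →ₐ[R] MRing R p π n ⊗[R] MRing R p π n :=
  lift (x R p π n ⊗ₜ 1 + 1 ⊗ₜ x R p π n) (by
    have hp : (p : MRing R p π n ⊗[R] MRing R p π n) = 0 := by
      rw [← map_natCast (algebraMap R _), CharP.cast_eq_zero, map_zero]
    obtain ⟨r, hr⟩ := exists_add_pow_prime_eq (Fact.out : p.Prime)
      (x R p π n ⊗ₜ[R] (1 : MRing R p π n)) ((1 : MRing R p π n) ⊗ₜ[R] x R p π n)
    rw [hr, hp]
    simp only [Algebra.TensorProduct.tmul_pow, one_pow, x_pow, ← Algebra.smul_def,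
      TensorProduct.tmul_smul, ← TensorProduct.smul_tmul', zero_mul, add_zero, smul_add])

/-- The counit `X ↦ 0`. -/
def counitHom : MRing R p π n →ₐ[R] R :=
  lift 0 (by simp [(Fact.out : p.Prime).ne_zero])

/-- The antipode `X ↦ -X`. -/
def antipodeHom : MRing R p π n →ₐ[R] MRing R p π n :=
  lift (-x R p π n) (by
    have hp : (p : MRing R p π n) = 0 := by
      rw [← map_natCast (algebraMap R _), CharP.cast_eq_zero, map_zero]
    obtain ⟨r, hr⟩ := exists_add_pow_prime_eq (Fact.out : p.Prime) (x R p π n) (-x R p π n)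
    rw [add_neg_cancel, zero_pow (Fact.out : p.Prime).ne_zero, hp] at hr
    have h2 : (-x R p π n) ^ p = -(x R p π n ^ p) := by linear_combination -hr
    rw [h2, x_pow, mul_neg])

/-- The Hopf algebra structure of `M_n`, inherited from the additive group. -/
instance : Bialgebra R (MRing R p π n) :=
  Bialgebra.ofAlgHom (comulHom R p π n) (counitHom R p π n)
    (algHom_ext (by
      simp [comulHom, TensorProduct.add_tmul, TensorProduct.tmul_add,
        Algebra.TensorProduct.one_def, add_assoc]))
    (algHom_ext (by simp [comulHom, counitHom]))
    (algHom_ext (by simp [comulHom, counitHom]))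

instance : HopfAlgebra R (MRing R p π n) :=
  HopfAlgebra.ofAlgHom (antipodeHom R p π n)
    (algHom_ext (by
      change (Algebra.TensorProduct.lift (antipodeHom R p π n) (AlgHom.id R _)
        fun _ _ => Commute.all _ _) (comulHom R p π n (x R p π n)) =
        Algebra.ofId _ _ (counitHom R p π n (x R p π n))
      simp [comulHom, counitHom, antipodeHom]))
    (algHom_ext (by
      change (Algebra.TensorProduct.lift (AlgHom.id R _) (antipodeHom R p π n)
        fun _ _ => Commute.all _ _) (comulHom R p π n (x R p π n)) =
        Algebra.ofId _ _ (counitHom R p π n (x R p π n))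
      simp [comulHom, counitHom, antipodeHom]))

end MRing

end GroupScheme

/-! ### Torsors -/

section Torsor

variable (R : Type u) [CommRing R] (H : Type w) [CommRing H] [HopfAlgebra R H]
  (A : Type v) [CommRing A] [Algebra R A]
  (B : Type v) [CommRing B] [Algebra R B] [Algebra A B] [IsScalarTower R A B]

/-- For an affine flat `R`-group scheme `G = Spec H` and an affine morphism `f : Y → X` of
(formal) `R`-schemes with `f` given by `A → B`: the structure of a `G`-torsor on `f`. It is
an action `Y × G → Y` over `X`, written as a coaction `B → B ⊗ H`, such that `f` is faithfully flat
and `Y × G → Y ×_X Y`, `(y, g) ↦ (y, yg)`, is an isomorphism. -/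
structure TorsorStructure where
  /-- the action -/
  coact : B →ₐ[A] B ⊗[R] H
  coassoc : (TensorProduct.assoc R B H H).toLinearMap ∘ₗ
      ((coact.restrictScalars R).toLinearMap.rTensor H) ∘ₗ (coact.restrictScalars R).toLinearMap =
    (Coalgebra.comul.lTensor B) ∘ₗ (coact.restrictScalars R).toLinearMap
  counit : (TensorProduct.rid R B).toLinearMap ∘ₗ (Coalgebra.counit.lTensor B) ∘ₗ
      (coact.restrictScalars R).toLinearMap = LinearMap.id
  faithfullyFlat : Module.FaithfullyFlat A B
  bijective : Function.Bijective
    (Algebra.TensorProduct.productLeftAlgHom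
      (Algebra.TensorProduct.includeLeft : B →ₐ[B] B ⊗[R] H) coact : B ⊗[A] B →ₐ[B] B ⊗[R] H)

/-- `B` over `A` is an étale torsor under the constant group `ℤ/N`: the group acts on `B` by
`A`-automorphisms, `A → B` is faithfully flat, and `B ⊗_A B → ∏_{g ∈ ℤ/N} B`,
`b ⊗ b' ↦ (b · g b')_g`, is bijective. -/
def IsCyclicTorsor (N : ℕ) (A : Type v) [CommRing A] (B : Type w) [CommRing B] [Algebra A B] :
    Prop :=
  Module.FaithfullyFlat A B ∧ Algebra.Etale A B ∧
    ∃ ρ : Multiplicative (ZMod N) →* (B ≃ₐ[A] B),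
      Function.Bijective (fun (z : B ⊗[A] B) (g : Multiplicative (ZMod N)) =>
        Algebra.TensorProduct.productMap (AlgHom.id A B) (ρ g : B →ₐ[A] B) z)

end Torsor

/-! ### Formal schemes and their fibres -/

section Formal

/-- `Spf A` is a smooth affine formal scheme over the complete local ring `R`: `A` is complete
for the topology defined by the maximal ideal of `R`, and all the reductions are smooth. -/
structure IsSmoothFormal (R : Type u) [CommRing R] [IsLocalRing R]
    (A : Type v) [CommRing A] [Algebra R A] : Prop where
  complete : IsAdicComplete (IsLocalRing.maximalIdeal R) A
  smooth : ∀ n : ℕ, Algebra.Smooth (R ⧸ IsLocalRing.maximalIdeal R ^ n)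
    ((R ⧸ IsLocalRing.maximalIdeal R ^ n) ⊗[R] A)

variable {R : Type u} [CommRing R] (π : R)

/-- The ring `C[1/π]` of the generic fibre of `Spf C`. -/
abbrev GenericFibre (C : Type v) [CommRing C] [Algebra R C] : Type v :=
  Localization.Away (algebraMap R C π)

/-- The ring `C/πC` of the special fibre of `Spf C`. -/
abbrev SpecialFibre (C : Type v) [CommRing C] [Algebra R C] : Type v :=
  C ⧸ Ideal.span {algebraMap R C π}

/-- The generic fibre of the morphism given by `C → D` is an étale torsor under `ℤ/N`. -/
def IsGenericallyCyclic (N : ℕ) (C : Type v) [CommRing C] [Algebra R C]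
    (D : Type v) [CommRing D] [Algebra C D] : Prop :=
  IsCyclicTorsor N (GenericFibre π C) (GenericFibre π C ⊗[C] D)

end Formal

/-! ### The cover -/

section Cover

variable {R : Type u} [CommRing R] (p : ℕ) [Fact p.Prime] (π : R) (m : ℕ)
  {A : Type v} [CommRing A] [Algebra R A] (a₁ a₂ : A)

/-- The element `π^(-pm) a₁` of `A[1/π]`. -/
def wittEntry : GenericFibre π A :=
  IsLocalization.Away.invSelf (algebraMap R A π) ^ (p * m) * algebraMap A _ a₁

/-- The Witt vector `(T₁^p, T₂^p) - (T₁, T₂)` of length two. -/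
def wittFrobSub (S : Type v) [CommRing S] :
    TruncatedWittVector p 2 (MvPolynomial (Fin 2) S) :=
  TruncatedWittVector.mk p ![MvPolynomial.X 0 ^ p, MvPolynomial.X 1 ^ p] -
    TruncatedWittVector.mk p ![MvPolynomial.X 0, MvPolynomial.X 1]

lemma wittFrobSub_coeff_zero (S : Type v) [CommRing S] :
    (wittFrobSub p S).coeff 0 = MvPolynomial.X 0 ^ p - MvPolynomial.X 0 := by
  have key : ∀ x y : TruncatedWittVector p 2 (MvPolynomial (Fin 2) S),
      (x - y).coeff 0 = x.coeff 0 - y.coeff 0 := by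
    intro x y
    have h : x - y = WittVector.truncateFun 2 (x.out - y.out) := by
      rw [WittVector.truncateFun_sub]
      simp [TruncatedWittVector.truncateFun_out]
    rw [h, WittVector.coeff_truncateFun]
    have := map_sub (WittVector.constantCoeff (p := p)) x.out y.out
    simpa [WittVector.constantCoeff_apply, ← TruncatedWittVector.coeff_out] using this
  simp [wittFrobSub, key]

/-- The equations `(T₁^p, T₂^p) - (T₁, T₂) = (π^(-pm) a₁, a₂)`, entry by entry. -/
def wittIdeal : Ideal (MvPolynomial (Fin 2) (GenericFibre π A)) :=
  Ideal.span {(wittFrobSub p (GenericFibre π A)).coeff 0 - MvPolynomial.C (wittEntry p π m a₁),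
    (wittFrobSub p (GenericFibre π A)).coeff 1 - MvPolynomial.C (algebraMap A _ a₂)}

/-- The algebra over `A[1/π]` given by the Witt vector equation. -/
def YGen : Type v := MvPolynomial (Fin 2) (GenericFibre π A) ⧸ wittIdeal p π m a₁ a₂

instance : CommRing (YGen p π m a₁ a₂) :=
  inferInstanceAs (CommRing (MvPolynomial (Fin 2) (GenericFibre π A) ⧸ wittIdeal p π m a₁ a₂))

instance : Algebra (GenericFibre π A) (YGen p π m a₁ a₂) :=
  inferInstanceAs (Algebra (GenericFibre π A)
    (MvPolynomial (Fin 2) (GenericFibre π A) ⧸ wittIdeal p π m a₁ a₂))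

instance : Algebra A (YGen p π m a₁ a₂) :=
  inferInstanceAs (Algebra A
    (MvPolynomial (Fin 2) (GenericFibre π A) ⧸ wittIdeal p π m a₁ a₂))

instance : IsScalarTower A (GenericFibre π A) (YGen p π m a₁ a₂) :=
  inferInstanceAs (IsScalarTower A (GenericFibre π A)
    (MvPolynomial (Fin 2) (GenericFibre π A) ⧸ wittIdeal p π m a₁ a₂))

/-- The algebra over `A[1/π]` given by the first equation `T₁^p - T₁ = π^(-pm) a₁`. -/
def Y₁Gen : Type v :=
  AdjoinRoot (Polynomial.X ^ p - Polynomial.X - Polynomial.C (wittEntry p π m a₁) :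
    Polynomial (GenericFibre π A))

instance : CommRing (Y₁Gen p π m a₁) := inferInstanceAs (CommRing (AdjoinRoot _))

instance : Algebra (GenericFibre π A) (Y₁Gen p π m a₁) :=
  inferInstanceAs (Algebra (GenericFibre π A) (AdjoinRoot _))

instance : Algebra A (Y₁Gen p π m a₁) := inferInstanceAs (Algebra A (AdjoinRoot _))

instance : IsScalarTower A (GenericFibre π A) (Y₁Gen p π m a₁) :=
  inferInstanceAs (IsScalarTower A (GenericFibre π A) (AdjoinRoot _))

/-- The coordinate `T₁`. -/
def T₁ : YGen p π m a₁ a₂ := Ideal.Quotient.mk (wittIdeal p π m a₁ a₂) (MvPolynomial.X 0)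

lemma T₁_eq : T₁ p π m a₁ a₂ ^ p - T₁ p π m a₁ a₂ -
    algebraMap (GenericFibre π A) (YGen p π m a₁ a₂) (wittEntry p π m a₁) = 0 := by
  have h : (wittFrobSub p (GenericFibre π A)).coeff 0 -
      MvPolynomial.C (wittEntry p π m a₁) ∈ wittIdeal p π m a₁ a₂ :=
    Ideal.subset_span (by simp)
  rw [wittFrobSub_coeff_zero, ← Ideal.Quotient.eq_zero_iff_mem, map_sub, map_sub, map_pow] at h
  exact h

/-- The map `T₁ ↦ T₁`, that is, the second step of the tower `Y_K → Y_{1,K} → X_K`. -/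
def towerGen : Y₁Gen p π m a₁ →ₐ[GenericFibre π A] YGen p π m a₁ a₂ :=
  AdjoinRoot.liftAlgHom _ (Algebra.ofId _ _) (T₁ p π m a₁ a₂) (by
    simp only [Polynomial.eval₂_sub, Polynomial.eval₂_pow, Polynomial.eval₂_X,
      Polynomial.eval₂_C]
    exact T₁_eq p π m a₁ a₂)

/-- The ring of the cover `Y` of `X = Spf A` given generically by the Witt vector equation: the
normalisation of `X` in the generic cover. -/
def YRing : Type v := integralClosure A (YGen p π m a₁ a₂)

instance : CommRing (YRing p π m a₁ a₂) :=
  inferInstanceAs (CommRing (integralClosure A (YGen p π m a₁ a₂)))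

instance : Algebra A (YRing p π m a₁ a₂) :=
  inferInstanceAs (Algebra A (integralClosure A (YGen p π m a₁ a₂)))

/-- The ring of the intermediate cover `Y₁` of `X`: the normalisation of `X` in the cover
`T₁^p - T₁ = π^(-pm) a₁` of its generic fibre. -/
def Y₁Ring : Type v := integralClosure A (Y₁Gen p π m a₁)

instance : CommRing (Y₁Ring p π m a₁) :=
  inferInstanceAs (CommRing (integralClosure A (Y₁Gen p π m a₁)))

instance : Algebra A (Y₁Ring p π m a₁) :=
  inferInstanceAs (Algebra A (integralClosure A (Y₁Gen p π m a₁)))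

/-- The map of normalisations that gives `f₂ : Y → Y₁`. -/
def tower : Y₁Ring p π m a₁ →ₐ[A] YRing p π m a₁ a₂ :=
  AlgHom.mapIntegralClosure ((towerGen p π m a₁ a₂).restrictScalars A)

instance : Algebra (Y₁Ring p π m a₁) (YRing p π m a₁ a₂) := (tower p π m a₁ a₂).toAlgebra

instance : IsScalarTower A (Y₁Ring p π m a₁) (YRing p π m a₁ a₂) :=
  IsScalarTower.of_algebraMap_eq' (tower p π m a₁ a₂).comp_algebraMap.symm

instance : Algebra R (YRing p π m a₁ a₂) :=
  ((algebraMap A (YRing p π m a₁ a₂)).comp (algebraMap R A)).toAlgebra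

instance : IsScalarTower R A (YRing p π m a₁ a₂) := IsScalarTower.of_algebraMap_eq' rfl

instance : Algebra R (Y₁Ring p π m a₁) :=
  ((algebraMap A (Y₁Ring p π m a₁)).comp (algebraMap R A)).toAlgebra

instance : IsScalarTower R A (Y₁Ring p π m a₁) := IsScalarTower.of_algebraMap_eq' rfl

instance : IsScalarTower R (Y₁Ring p π m a₁) (YRing p π m a₁ a₂) :=
  IsScalarTower.of_algebraMap_eq' (by
    rw [IsScalarTower.algebraMap_eq R A (YRing p π m a₁ a₂),
      IsScalarTower.algebraMap_eq R A (Y₁Ring p π m a₁),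
      IsScalarTower.algebraMap_eq A (Y₁Ring p π m a₁) (YRing p π m a₁ a₂), RingHom.comp_assoc])

end Cover

end

noncomputable section

/-! ### Smooth algebras over a field: zero divisors and roots of quotients -/

section SmoothOverField

/-! Normalisation. Put `z₁ = π^m T₁`; the first entry becomes `z₁^p = π^((p-1)m) z₁ + a₁`. With `w =
π^(-pm) a₁` and `Q(x, y) = ((x + y)^p - x^p - y^p)/p`, the second entry reads `T₂^p - T₂ = a₂ - Q(w,
T₁)`. The monomial of `Q` with the largest pole is `w^(p-1) T₁`, of order `pm(p-1) + m = p m̃`, so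
`z₂ = π^m̃ T₂` satisfies `z₂^p = π^((p-1)m̃) z₂ + g` with `g ≡ -a₁^(p-1) z₁` modulo `π`. Each such
equation defines a torsor under the corresponding `M_n`, acting by translation
(`AdjoinsRoot.torsorStructure`).

Modulo `π` the equations are `X^p = ā₁` and `X^p = -ā₁^(p-1) z̄₁`. The special fibre of `X` is a
domain in which a root of a quotient of elements stays in the ring, so `ā₁` is not a `p`-th power in
its fraction field. On the special fibre of `Y₁`, `p`-th powers come from `X`, whereas `z̄₁` does
not. Both reductions are therefore prime polynomials. This makes the rings generated by `z₁` and
`z₂` integrally closed at each stage (`adjoinsRoot_of_isIntegralClosure`), and makes `π` prime in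
`B`, so the special fibre is even integral. The generic Galois group is generated by `σ`, addition
of the Witt vector `(1, 0)`, of order `p²`.

No torsor structure on `f`. Let `G` be a group scheme under which `Y` is a torsor. Sections of `G`
over `Y` correspond to `X`-endomorphisms of `Y` (`TorsorStructure.act_bijective`), that is, to
powers of `σ`. So `N = G(B)` has order `p²` and is commutative, but it need not be `ℤ/p²`: the
correspondence is only a crossed homomorphism. Measure `g ∈ N` by the displacement `u(g) = g·s - s`
of `s = z₁ z₂`. Some `d ∈ A` prime to `π` has `d B ⊆ A[s]`, so `u` is injective and the product of
`p` elements is, up to `d^p`, a polynomial in their displacements. By commutativity it is symmetric;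
hence its restriction to the diagonal has derivative zero, and `d^p u(g^p) = φ(u(g)^p)` for a
polynomial `φ` (`exists_polynomial_eval_pow`).

The element `σ^k` displaces `s` by exactly `π^m'` if `p ∤ k`, and by exactly `π^m̃` if `p` divides
`k` exactly once. Since `φ(0) = 0`, an element with `π^m̃ ∣ u(h)` has `u(h^p)` divisible by `π^(p
m̃)`, so `h^p = 1`. This gives `p` zeros `u(h)^p` of `φ`, whence `π^(m' p²)` divides `φ(u(g)^p)` for
every `g`. As `m' p² > m̃`, all of `N` has exponent `p`. Now `σ` acts on the plane `N` over `𝔽_p` by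
a unipotent `T`, and `1 + T + ⋯ + T^(p-1) = (T - 1)^(p-1) = 0` because `p > 2`. For the section `g`
that corresponds to `σ`, the crossed homomorphism sends this norm of `g` to `σ^p`; so `σ^p = 1`, a
contradiction (`TorsorStructure.isEmpty_of_conductors`). -/

/-- The chain of ideals `(a^n)` stabilises, so `a^n (1 - a y) = 0` for some `y`; then `a (1 - a y)`
is nilpotent, hence zero. Thus `1 - a y` is an idempotent that kills `a`. -/
theorem IsArtinianRing.exists_eq_sq_mul {L : Type*} [CommRing L] [IsArtinianRing L] [IsReduced L]
    (a : L) : ∃ y, a = a ^ 2 * y := by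
  obtain ⟨n, y, hy⟩ := IsArtinian.exists_pow_succ_smul_dvd a (1 : L)
  refine ⟨y, ?_⟩
  have h : (a * (1 - a * y)) ^ (n + 1) = 0 := by
    simp only [smul_eq_mul, mul_one, Nat.succ_eq_add_one, pow_succ] at hy
    have : a ^ n * (1 - a * y) = 0 := by linear_combination -hy
    rw [mul_pow, pow_succ, pow_succ]
    linear_combination a * (1 - a * y) ^ n * this
  have := pow_eq_zero_iff (n.succ_ne_zero) |>.mp h
  linear_combination this

/-- Around each point, a smooth algebra over a field is integrally closed in a reduced Artinian
flat extension. -/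
theorem Algebra.Smooth.exists_away_isIntegrallyClosedIn (k : Type u) [Field k] (A : Type u)
    [CommRing A] [Algebra k A] [Algebra.Smooth k A] (q : Ideal A) [q.IsPrime] :
    ∃ f ∉ q, ∃ (L : Type u) (_ : CommRing L) (_ : Algebra (Localization.Away f) L),
      Function.Injective (algebraMap (Localization.Away f) L) ∧
      Module.Flat (Localization.Away f) L ∧ IsReduced L ∧ IsArtinianRing L ∧
      ∀ x : L, IsIntegral (Localization.Away f) x →
        x ∈ Set.range (algebraMap (Localization.Away f) L) := by
  obtain ⟨f, hf, n, alg, tow, et⟩ :=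
    Algebra.IsSmoothAt.exists_isStandardEtale_mvPolynomial (R := k) (p := q)
  let P := MvPolynomial (Fin n) k
  let F := FractionRing P
  have : Algebra.Etale P (Localization.Away f) := inferInstance
  have flat : Module.Flat P (Localization.Away f) := inferInstance
  -- Near `q` the algebra is étale over a polynomial ring `P`, which is integrally closed in its
  -- fraction field `F`. The formation of integral closures commutes with smooth base change, and an
  -- étale `F`-algebra is reduced and Artinian.
  refine ⟨f, hf, Localization.Away f ⊗[P] F, inferInstance, inferInstance, ?_, inferInstance, ?_, ?_, ?_⟩
  · exact Algebra.TensorProduct.includeLeft_injective (S := Localization.Away f)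
      (IsFractionRing.injective P F)
  · have : Algebra.Etale F (F ⊗[P] Localization.Away f) := inferInstance
    have := Algebra.FormallyUnramified.isReduced_of_field F (F ⊗[P] Localization.Away f)
    exact isReduced_of_injective (Algebra.TensorProduct.comm P (Localization.Away f) F)
      (Algebra.TensorProduct.comm P (Localization.Away f) F).injective
  · have : Algebra.Etale F (F ⊗[P] Localization.Away f) := inferInstance
    have := Algebra.FormallyUnramified.finite_of_free F (F ⊗[P] Localization.Away f)
    have := IsArtinianRing.of_finite F (F ⊗[P] Localization.Away f)
    exact (Algebra.TensorProduct.comm P (Localization.Away f) F).symm.surjective.isArtinianRing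
      (f := (Algebra.TensorProduct.comm P (Localization.Away f) F).symm.toRingHom)
  · intro x hx
    obtain ⟨y, hy⟩ := (TensorProduct.toIntegralClosure_bijective_of_smooth
      (R := P) (S := Localization.Away f) (B := F)).2 ⟨x, hx⟩
    have hy' := congrArg Subtype.val hy
    change _ = x at hy'
    rw [← hy']
    clear hy hy' hx
    induction y with
    | zero => exact ⟨0, by simp⟩
    | add y z h1 h2 =>
      obtain ⟨a, ha⟩ := h1
      obtain ⟨b, hb⟩ := h2
      exact ⟨a + b, by simp [ha, hb]⟩
    | tmul s b =>
      obtain ⟨c, hc⟩ := IsIntegrallyClosed.isIntegral_iff.mp b.2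
      refine ⟨s * algebraMap P _ c, ?_⟩
      change (s * algebraMap P _ c) ⊗ₜ[P] (1 : F) = s ⊗ₜ[P] (b : F)
      rw [← hc, Algebra.algebraMap_eq_smul_one c,
        mul_smul_comm, mul_one, Algebra.algebraMap_eq_smul_one c, ← TensorProduct.smul_tmul]

/-- The idempotent of `L` that kills `a` and fixes `b` is a root of `X² - X`, hence integral, hence
in `S`. -/
theorem exists_mul_eq_zero_mul_eq_self_of_isIntegrallyClosedIn {S L : Type*} [CommRing S]
    [CommRing L] [Algebra S L] (hinj : Function.Injective (algebraMap S L)) [IsReduced L]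
    [IsArtinianRing L] (hint : ∀ x : L, IsIntegral S x → x ∈ Set.range (algebraMap S L))
    {a b : S} (h : a * b = 0) : ∃ c, c * a = 0 ∧ c * b = b := by
  obtain ⟨y, hy⟩ := IsArtinianRing.exists_eq_sq_mul (algebraMap S L a)
  have he : (1 - algebraMap S L a * y) ^ 2 = 1 - algebraMap S L a * y := by
    linear_combination -y * hy
  have hmon : (Polynomial.X ^ 2 - Polynomial.X : Polynomial S).Monic := by
    nontriviality S
    exact Polynomial.monic_X_pow_sub (by rw [Polynomial.degree_X]; norm_num)
  obtain ⟨c, hc⟩ := hint (1 - algebraMap S L a * y) ⟨_, hmon, by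
    rw [Polynomial.eval₂_sub, Polynomial.eval₂_pow, Polynomial.eval₂_X, he, sub_self]⟩
  refine ⟨c, hinj ?_, hinj ?_⟩
  · rw [map_mul, hc, map_zero]; linear_combination hy
  · have hab : algebraMap S L a * algebraMap S L b = 0 := by rw [← map_mul, h, map_zero]
    rw [map_mul, hc]; linear_combination -y * hab

/-- By flatness `c` stays regular in the Artinian ring `L`, so it is a unit there, and `b / c` is a
root of `X^n - a`. -/
theorem dvd_of_pow_eq_mul_pow_of_isIntegrallyClosedIn {S L : Type*} [CommRing S] [CommRing L]
    [Algebra S L] (hinj : Function.Injective (algebraMap S L)) [Module.Flat S L] [IsReduced L]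
    [IsArtinianRing L] (hint : ∀ x : L, IsIntegral S x → x ∈ Set.range (algebraMap S L))
    {a b c : S} (hc : c ∈ nonZeroDivisors S) {n : ℕ} (hn : n ≠ 0) (h : b ^ n = a * c ^ n) :
    c ∣ b := by
  have hc' : algebraMap S L c ∈ nonZeroDivisors L := by
    have := (Module.Flat.isSMulRegular_of_nonZeroDivisors hc : IsSMulRegular L c)
    rw [mem_nonZeroDivisors_iff_right]
    intro x hx
    refine this ?_
    simpa [Algebra.smul_def, mul_comm] using hx
  obtain ⟨u, hu⟩ := IsArtinianRing.isUnit_of_mem_nonZeroDivisors hc'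
  have hu' : (↑u⁻¹ : L) * algebraMap S L c = 1 := by rw [← hu]; exact u.inv_mul
  have key : (↑u⁻¹ * algebraMap S L b) ^ n = algebraMap S L a := by
    rw [mul_pow, ← map_pow, h, map_mul, map_pow, mul_left_comm, ← mul_pow, hu', one_pow, mul_one]
  obtain ⟨x, hx⟩ := hint (↑u⁻¹ * algebraMap S L b)
    ⟨Polynomial.X ^ n - Polynomial.C a, Polynomial.monic_X_pow_sub_C a hn, by
      simp [key]⟩
  refine ⟨x, hinj ?_⟩
  rw [map_mul, hx]
  linear_combination -algebraMap S L b * hu'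

section Global

variable (k : Type u) [Field k] {A : Type u} [CommRing A] [Algebra k A] [Algebra.Smooth k A]

include k in
-- The local statements glue: the elements `r` with `c a = 0` and `c b = r b` for some `c` form an
-- ideal, which lies in no maximal ideal.
theorem Algebra.Smooth.exists_mul_eq_zero_mul_eq_self {a b : A} (h : a * b = 0) :
    ∃ c, c * a = 0 ∧ c * b = b := by
  let J : Ideal A := 
    { carrier := {r | ∃ c, c * a = 0 ∧ c * b = r * b}
      add_mem' := by
        rintro r s ⟨c, h1, h2⟩ ⟨d, h3, h4⟩
        exact ⟨c + d, by linear_combination h1 + h3, by linear_combination h2 + h4⟩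
      zero_mem' := ⟨0, by simp⟩
      smul_mem' := by
        rintro r s ⟨c, h1, h2⟩
        exact ⟨r * c, by linear_combination r * h1, by
          rw [smul_eq_mul]; linear_combination r * h2⟩ }
  suffices hJ : (1 : A) ∈ J by
    obtain ⟨c, h1, h2⟩ := hJ
    exact ⟨c, h1, by rw [h2, one_mul]⟩
  rw [← Ideal.eq_top_iff_one]
  by_contra hJ
  obtain ⟨q, hq, hJq⟩ := Ideal.exists_le_maximal J hJ
  obtain ⟨f, hf, L, _, _, hinj, _, _, _, hint⟩ :=
    Algebra.Smooth.exists_away_isIntegrallyClosedIn k A q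
  obtain ⟨c, hca, hcb⟩ := exists_mul_eq_zero_mul_eq_self_of_isIntegrallyClosedIn hinj hint
    (a := algebraMap A _ a) (b := algebraMap A _ b) (by rw [← map_mul, h, map_zero])
  obtain ⟨⟨c, ⟨_, n, rfl⟩⟩, hc⟩ := IsLocalization.surj (Submonoid.powers f) c
  simp only at hc
  have h1 : algebraMap A (Localization.Away f) (c * a) = algebraMap A _ 0 := by
    rw [map_mul, ← hc, map_zero]; linear_combination algebraMap A _ (f ^ n) * hca
  have h2 : algebraMap A (Localization.Away f) (c * b) = algebraMap A _ (f ^ n * b) := by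
    rw [map_mul, ← hc, map_mul]; linear_combination algebraMap A _ (f ^ n) * hcb
  obtain ⟨⟨_, i, rfl⟩, hi⟩ := (IsLocalization.eq_iff_exists (Submonoid.powers f) _).mp h1
  obtain ⟨⟨_, j, rfl⟩, hj⟩ := (IsLocalization.eq_iff_exists (Submonoid.powers f) _).mp h2
  simp only at hi hj
  have : f ^ (i + j + n) ∈ J := ⟨f ^ (i + j) * c, by rw [pow_add]; linear_combination f ^ j * hi, by
    simp only [pow_add]; linear_combination f ^ i * hj⟩
  exact hf (hq.isPrime.mem_of_pow_mem _ (hJq this))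

include k in
-- By the preceding lemma the annihilator of `a` is an idempotent ideal. It is finitely generated,
-- hence generated by an idempotent, and connectedness leaves only `0` and the whole ring.
theorem Algebra.Smooth.isDomain [ConnectedSpace (PrimeSpectrum A)] : IsDomain A := by
  have : Nontrivial A := PrimeSpectrum.nonempty_iff_nontrivial.mp inferInstance
  have : IsNoetherianRing A := Algebra.FiniteType.isNoetherianRing k A
  have : NoZeroDivisors A := by
    constructor
    intro a b hab
    let I : Ideal A := LinearMap.ker (LinearMap.toSpanSingleton A A a)
    have hI : ∀ x, x ∈ I ↔ x * a = 0 := fun x => by simp [I]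
    have hid : IsIdempotentElem I := by
      refine le_antisymm Ideal.mul_le_left fun x hx => ?_
      obtain ⟨c, h1, h2⟩ := Algebra.Smooth.exists_mul_eq_zero_mul_eq_self k (a := a) (b := x)
        (by rw [mul_comm]; exact (hI x).mp hx)
      rw [← h2]
      exact Ideal.mul_mem_mul ((hI c).mpr h1) hx
    obtain ⟨e, he, hIe⟩ := (Ideal.isIdempotentElem_iff_of_fg I (IsNoetherian.noetherian I)).mp hid
    have hcl : IsClopen (PrimeSpectrum.zeroLocus {e}) :=
      PrimeSpectrum.isClopen_iff_zeroLocus.mpr ⟨e, he, rfl⟩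
    rcases isClopen_iff.mp hcl with h | h
    · left
      rw [← PrimeSpectrum.zeroLocus_span, PrimeSpectrum.zeroLocus_empty_iff_eq_top,
        ← Ideal.submodule_span_eq, ← hIe] at h
      simpa using (hI 1).mp (h ▸ Submodule.mem_top)
    · right
      have : e ∈ nilradical A := by
        rw [PrimeSpectrum.zeroLocus_eq_univ_iff] at h
        exact h rfl
      have he0 : e = 0 := by
        obtain ⟨n, hn⟩ := this
        rcases n with _ | n
        · simpa using congrArg (e * ·) hn
        · rwa [he.pow_succ_eq] at hn
      have : b ∈ I := (hI b).mpr (by rw [mul_comm]; exact hab)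
      rw [hIe, he0] at this
      simpa using this
  exact NoZeroDivisors.to_isDomain A

include k in
-- The ideal `(c) : b` lies in no maximal ideal. This is the only consequence of normality that is
-- needed: an element that is not an `n`-th power in the ring is not one in the fraction field
-- either.
theorem Algebra.Smooth.dvd_of_pow_eq_mul_pow [IsDomain A] {a b c : A} (hc : c ≠ 0) {n : ℕ}
    (hn : n ≠ 0) (h : b ^ n = a * c ^ n) : c ∣ b := by
  let J : Ideal A := Submodule.colon (Ideal.span {c}) {b}
  have hJ' : ∀ x, x ∈ J ↔ c ∣ x * b := fun x => by
    simp [J, Submodule.mem_colon_singleton, Ideal.mem_span_singleton]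
  suffices hJ : (1 : A) ∈ J by simpa [hJ'] using hJ
  rw [← Ideal.eq_top_iff_one]
  by_contra hJ
  obtain ⟨q, hq, hJq⟩ := Ideal.exists_le_maximal J hJ
  obtain ⟨f, hf, L, _, _, hinj, _, _, _, hint⟩ :=
    Algebra.Smooth.exists_away_isIntegrallyClosedIn k A q
  have hf0 : f ≠ 0 := fun h => hf (h ▸ q.zero_mem)
  have hle : Submonoid.powers f ≤ nonZeroDivisors A := powers_le_nonZeroDivisors_of_noZeroDivisors hf0
  have inj := IsLocalization.injective (M := Submonoid.powers f) (Localization.Away f) hle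
  have : IsDomain (Localization.Away f) :=
    IsLocalization.isDomain_of_le_nonZeroDivisors (M := Submonoid.powers f) _ hle
  obtain ⟨d, hd⟩ := dvd_of_pow_eq_mul_pow_of_isIntegrallyClosedIn hinj hint
    (a := algebraMap A _ a) (b := algebraMap A _ b) (c := algebraMap A _ c)
    (mem_nonZeroDivisors_of_ne_zero (by rwa [Ne, map_eq_zero_iff _ inj])) hn
    (by rw [← map_pow, h, map_mul, map_pow])
  obtain ⟨⟨d, ⟨_, n, rfl⟩⟩, hd'⟩ := IsLocalization.surj (Submonoid.powers f) d
  simp only at hd'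
  have : f ^ n ∈ J := (hJ' _).mpr ⟨d, inj (by
    rw [map_mul, map_mul, ← hd']; linear_combination algebraMap A _ (f ^ n) * hd)⟩
  exact hf (hq.isPrime.mem_of_pow_mem _ (hJq this))

end Global

end SmoothOverField

/-! ### The special fibre of the formal scheme, and regularity of the uniformiser -/

section SmoothFormal

open IsLocalRing

theorem AlgebraicGeometry.GeometricallyConnected.connectedSpace_tensorProduct
    {R A k : Type u} [CommRing R] [CommRing A] [Algebra R A] [Field k] [Algebra R k]
    (h : AlgebraicGeometry.GeometricallyConnected
      (AlgebraicGeometry.Spec.map (CommRingCat.ofHom (algebraMap R A)))) :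
    ConnectedSpace (PrimeSpectrum (k ⊗[R] A)) :=
  h.geometrically_connectedSpace
    (AlgebraicGeometry.Spec.map (CommRingCat.ofHom (algebraMap R k)))
    (AlgebraicGeometry.Spec.map (CommRingCat.ofHom
      (Algebra.TensorProduct.includeRight (R := R) (A := k) (B := A)).toRingHom))
    (AlgebraicGeometry.Spec.map (CommRingCat.ofHom
      (algebraMap k (k ⊗[R] A))))
    (AlgebraicGeometry.isPullback_SpecMap_of_isPushout _ _ _ _
      (CommRingCat.isPushout_tensorProduct R k A)).flip

variable {R : Type u} [CommRing R] {A : Type u} [CommRing A] [Algebra R A]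

lemma span_algebraMap_eq_map_maximalIdeal [IsLocalRing R] {π : R}
    (hπ : maximalIdeal R = Ideal.span {π}) :
    (maximalIdeal R).map (algebraMap R A) = Ideal.span {algebraMap R A π} := by
  rw [hπ, Ideal.map_span, Set.image_singleton]

/-- The special fibre as a base change. -/
def specialFibreEquiv [IsLocalRing R] {π : R} (hπ : maximalIdeal R = Ideal.span {π}) :
    SpecialFibre π A ≃+* (R ⧸ maximalIdeal R ^ 1) ⊗[R] A :=
  (Ideal.quotEquivOfEq (by
    rw [pow_one, span_algebraMap_eq_map_maximalIdeal hπ] :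
      Ideal.span {algebraMap R A π} = (maximalIdeal R ^ 1).map (algebraMap R A))).trans
  (Algebra.TensorProduct.quotIdealMapEquivQuotTensor A (maximalIdeal R ^ 1)).toRingEquiv

namespace IsSmoothFormal

variable [IsLocalRing R] {π : R} (hA : IsSmoothFormal R A)
include hA

theorem isDomain_specialFibre (hπ : maximalIdeal R = Ideal.span {π})
    (hconn : AlgebraicGeometry.GeometricallyConnected
      (AlgebraicGeometry.Spec.map (CommRingCat.ofHom (algebraMap R A)))) :
    IsDomain (SpecialFibre π A) := by
  have hmax : (maximalIdeal R ^ 1).IsMaximal := by rw [pow_one]; infer_instance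
  let := Ideal.Quotient.field (maximalIdeal R ^ 1)
  have := hA.smooth 1
  have := hconn.connectedSpace_tensorProduct (k := R ⧸ maximalIdeal R ^ 1)
  have := Algebra.Smooth.isDomain (R ⧸ maximalIdeal R ^ 1)
    (A := (R ⧸ maximalIdeal R ^ 1) ⊗[R] A)
  exact (specialFibreEquiv hπ).toMulEquiv.isDomain _

theorem dvd_of_pow_eq_mul_pow (hπ : maximalIdeal R = Ideal.span {π})
    [IsDomain (SpecialFibre π A)] {a b c : SpecialFibre π A} (hc : c ≠ 0) {n : ℕ}
    (hn : n ≠ 0) (h : b ^ n = a * c ^ n) : c ∣ b := by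
  have hmax : (maximalIdeal R ^ 1).IsMaximal := by rw [pow_one]; infer_instance
  let := Ideal.Quotient.field (maximalIdeal R ^ 1)
  have := hA.smooth 1
  have e := specialFibreEquiv (A := A) hπ
  have : IsDomain ((R ⧸ maximalIdeal R ^ 1) ⊗[R] A) := e.symm.toMulEquiv.isDomain _
  have := Algebra.Smooth.dvd_of_pow_eq_mul_pow (R ⧸ maximalIdeal R ^ 1)
    (a := e a) (b := e b) (c := e c) (by simpa using hc) hn (by rw [← map_pow, h, map_mul, map_pow])
  exact (map_dvd_iff e).mp this

theorem eq_zero_of_forall_pow_dvd (hπ : maximalIdeal R = Ideal.span {π}) {a : A}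
    (ha : ∀ n : ℕ, algebraMap R A π ^ n ∣ a) : a = 0 := by
  have := hA.complete
  refine IsHausdorff.haus (I := maximalIdeal R) inferInstance a fun n => ?_
  obtain ⟨b, hb⟩ := ha n
  rw [SModEq.zero, hb, ← map_pow, ← Algebra.smul_def]
  exact Submodule.smul_mem_smul (Ideal.pow_mem_pow (hπ ▸ Ideal.mem_span_singleton_self π) n)
    Submodule.mem_top

/-- Modulo `π^(n+1)` the algebra is flat, so the relation `π a = 0` is trivial there: `a` is a
combination of elements with coefficients killed by `π`, that is, coefficients in `(π^n)`. Hence `a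
∈ π^n A` for every `n`, and separatedness gives `a = 0`. -/
theorem isSMulRegular [IsDomain R] (hπ : maximalIdeal R = Ideal.span {π}) (hπ0 : π ≠ 0) {a : A}
    (ha : algebraMap R A π * a = 0) : a = 0 := by
  refine hA.eq_zero_of_forall_pow_dvd hπ fun n => ?_
  let I := maximalIdeal R ^ (n + 1)
  have hI : I = Ideal.span {π ^ (n + 1)} := by rw [← Ideal.span_singleton_pow, ← hπ]
  have := hA.smooth (n + 1)
  have hflat : Module.Flat (R ⧸ I) ((R ⧸ I) ⊗[R] A) := inferInstance
  obtain ⟨κ, r, y, hxy, hr⟩ := Module.Flat.isTrivialRelation_of_sum_smul_eq_zero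
    (R := R ⧸ I) (M := (R ⧸ I) ⊗[R] A) (ι := Unit) (f := fun _ => Ideal.Quotient.mk I π)
    (x := fun _ => 1 ⊗ₜ a) (by
      simp only [Finset.univ_unique, Finset.sum_singleton]
      rw [TensorProduct.smul_tmul', smul_eq_mul, mul_one, ← mul_one (Ideal.Quotient.mk I π)]
      change ((π • (1 : R ⧸ I)) ⊗ₜ[R] a) = _
      rw [TensorProduct.smul_tmul, Algebra.smul_def, ha, TensorProduct.tmul_zero])
  have hr' : ∀ j, ∃ s : R, r () j = Ideal.Quotient.mk I (π ^ n * s) := by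
    intro j
    obtain ⟨t, ht⟩ := Ideal.Quotient.mk_surjective (r () j)
    have h1 := hr j
    simp only [Finset.univ_unique, Finset.sum_singleton] at h1
    change Ideal.Quotient.mk I π * r () j = 0 at h1
    rw [← ht, ← map_mul, Ideal.Quotient.eq_zero_iff_mem, hI, Ideal.mem_span_singleton, pow_succ',
      mul_dvd_mul_iff_left hπ0] at h1
    obtain ⟨s, rfl⟩ := h1
    exact ⟨s, ht.symm⟩
  choose s hs using hr'
  have hx := hxy ()
  simp only [hs] at hx
  let e := (Algebra.TensorProduct.quotIdealMapEquivQuotTensor A I).toRingEquiv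
  have he : ∀ b : A, e (Ideal.Quotient.mk _ b) = 1 ⊗ₜ b := fun b => rfl
  have hes : ∀ (t : R) z, e (Ideal.Quotient.mk _ (algebraMap R A t) * z) = Ideal.Quotient.mk I t • e z := by
    intro t z
    have h1 : (1 : R ⧸ I) ⊗ₜ[R] algebraMap R A t = Ideal.Quotient.mk I t ⊗ₜ[R] (1 : A) := by
      rw [Algebra.algebraMap_eq_smul_one, ← TensorProduct.smul_tmul,
        ← Algebra.algebraMap_eq_smul_one, Ideal.Quotient.algebraMap_eq]
    rw [map_mul, he, h1]
    exact (Algebra.smul_def (Ideal.Quotient.mk I t) (e z)).symm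
  have h2 : ∃ b, Ideal.Quotient.mk (I.map (algebraMap R A)) a =
      Ideal.Quotient.mk _ (algebraMap R A (π ^ n) * b) := by
    choose z hz using fun j => Ideal.Quotient.mk_surjective (e.symm (y j))
    refine ⟨∑ j, algebraMap R A (s j) * z j, e.injective ?_⟩
    rw [he, hx, Finset.mul_sum, map_sum, map_sum]
    refine Finset.sum_congr rfl fun j _ => ?_
    rw [← mul_assoc, ← map_mul (algebraMap R A), map_mul (Ideal.Quotient.mk (I.map _)), hes, hz,
      RingEquiv.apply_symm_apply]
  obtain ⟨b, hb⟩ := h2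
  rw [Ideal.Quotient.eq, hI, Ideal.map_span, Set.image_singleton, Ideal.mem_span_singleton] at hb
  obtain ⟨c, hc⟩ := hb
  refine ⟨b + algebraMap R A π * c, ?_⟩
  rw [map_pow, map_pow] at hc
  linear_combination hc

end IsSmoothFormal

end SmoothFormal

/-! ### Extensions generated by one element, and integral closure in Artin–Schreier extensions -/

section AdjoinsRoot

open Polynomial

/-- The `C`-algebra `D` is generated by `z`, and the ideal of relations of `z` is generated
by `f`. -/
structure AdjoinsRoot {C D : Type*} [CommRing C] [CommRing D] [Algebra C D] (f : C[X]) (z : D) :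
    Prop where
  surjective : Function.Surjective (aeval z : C[X] →ₐ[C] D)
  aeval_eq_zero_iff : ∀ q : C[X], aeval z q = 0 ↔ f ∣ q

theorem AdjoinRoot.adjoinsRoot {C : Type*} [CommRing C] (f : C[X]) :
    AdjoinsRoot f (AdjoinRoot.root f) where
  surjective q := by
    obtain ⟨q, rfl⟩ := AdjoinRoot.mk_surjective q
    exact ⟨q, AdjoinRoot.aeval_eq q⟩
  aeval_eq_zero_iff q := by rw [AdjoinRoot.aeval_eq, AdjoinRoot.mk_eq_zero]

namespace AdjoinsRoot

variable {C D : Type*} [CommRing C] [CommRing D] [Algebra C D] {f : C[X]} {z : D}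

theorem aeval_self (h : AdjoinsRoot f z) : aeval z f = 0 := (h.aeval_eq_zero_iff f).mpr dvd_rfl

/-- The data that Mathlib uses for the same situation. -/
def isAdjoinRootMonic (h : AdjoinsRoot f z) (hf : f.Monic) : IsAdjoinRootMonic D f where
  map := aeval z
  map_surjective := h.surjective
  ker_map := by ext; simp [Ideal.mem_span_singleton, h.aeval_eq_zero_iff]
  monic := hf

@[simp]
theorem isAdjoinRootMonic_root (h : AdjoinsRoot f z) (hf : f.Monic) :
    (h.isAdjoinRootMonic hf).root = z := by
  simp [isAdjoinRootMonic, IsAdjoinRoot.root]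

/-- The algebra map that sends `z` to a given root of `f`. -/
def lift {S : Type*} [CommRing S] [Algebra C S] (h : AdjoinsRoot f z) (hf : f.Monic) (s : S)
    (hs : aeval s f = 0) : D →ₐ[C] S :=
  (h.isAdjoinRootMonic hf).liftHom s hs

@[simp]
theorem lift_root {S : Type*} [CommRing S] [Algebra C S] (h : AdjoinsRoot f z) (hf : f.Monic)
    (s : S) (hs : aeval s f = 0) : h.lift hf s hs z = s := by
  have := IsAdjoinRoot.liftHom_root (h.isAdjoinRootMonic hf).toIsAdjoinRoot hs
  rwa [h.isAdjoinRootMonic_root hf] at this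

theorem algHom_ext {S : Type*} [Semiring S] [Algebra C S] (h : AdjoinsRoot f z)
    {φ ψ : D →ₐ[C] S} (hz : φ z = ψ z) : φ = ψ := by
  ext d
  obtain ⟨q, rfl⟩ := h.surjective d
  rw [← aeval_algHom_apply, ← aeval_algHom_apply, hz]

/-- The powers `1, z, …` form a basis. -/
def basis (h : AdjoinsRoot f z) (hf : f.Monic) : Module.Basis (Fin f.natDegree) C D :=
  (h.isAdjoinRootMonic hf).basis

theorem finite (h : AdjoinsRoot f z) (hf : f.Monic) : Module.Finite C D :=
  Module.Finite.of_basis (h.basis hf)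

/-- Reduction identifies `D / ϖ` with `(C / ϖ)[X] / (f̄)`. -/
theorem dvd_aeval_iff (h : AdjoinsRoot f z) (ϖ : C) (q : C[X]) :
    algebraMap C D ϖ ∣ aeval z q ↔
      f.map (Ideal.Quotient.mk (Ideal.span {ϖ})) ∣ q.map (Ideal.Quotient.mk (Ideal.span {ϖ})) := by
  have hker : ∀ r : C[X], r.map (Ideal.Quotient.mk (Ideal.span {ϖ})) = 0 →
      ∃ r', r = Polynomial.C ϖ * r' := by
    intro r hr
    refine (C_dvd_iff_dvd_coeff _ _).mpr fun i => ?_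
    rw [← Ideal.mem_span_singleton, ← Ideal.Quotient.eq_zero_iff_mem, ← coeff_map, hr, coeff_zero]
  have hϖ : (Polynomial.C ϖ : C[X]).map (Ideal.Quotient.mk (Ideal.span {ϖ})) = 0 := by
    rw [map_C, Ideal.Quotient.eq_zero_iff_mem.mpr (Ideal.mem_span_singleton_self _), C_0]
  constructor
  · rintro ⟨d, hd⟩
    obtain ⟨r, rfl⟩ := h.surjective d
    have : aeval z (q - Polynomial.C ϖ * r) = 0 := by rw [map_sub, map_mul, aeval_C, hd, sub_self]
    obtain ⟨t, ht⟩ := (h.aeval_eq_zero_iff _).mp this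
    refine ⟨t.map (Ideal.Quotient.mk _), ?_⟩
    have := congrArg (Polynomial.map (Ideal.Quotient.mk (Ideal.span {ϖ}))) ht
    rwa [Polynomial.map_sub, Polynomial.map_mul, hϖ, zero_mul, sub_zero, Polynomial.map_mul] at this
  · rintro ⟨t, ht⟩
    obtain ⟨t, rfl⟩ := map_surjective _ Ideal.Quotient.mk_surjective t
    obtain ⟨r, hr⟩ := hker (q - f * t) (by
      rw [Polynomial.map_sub, Polynomial.map_mul, ht, sub_self])
    refine ⟨aeval z r, ?_⟩
    have := congrArg (aeval z) hr
    simpa [h.aeval_self] using this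

theorem prime_algebraMap (h : AdjoinsRoot f z) {ϖ : C}
    (hf : Prime (f.map (Ideal.Quotient.mk (Ideal.span {ϖ})))) (h0 : algebraMap C D ϖ ≠ 0) :
    Prime (algebraMap C D ϖ) := by
  refine ⟨h0, fun hu => ?_, fun a b hab => ?_⟩
  · have := (h.dvd_aeval_iff ϖ 1).mp (by simpa using hu.dvd)
    rw [Polynomial.map_one] at this
    exact hf.not_isUnit (isUnit_of_dvd_one this)
  · obtain ⟨a, rfl⟩ := h.surjective a
    obtain ⟨b, rfl⟩ := h.surjective b
    rw [← map_mul, h.dvd_aeval_iff, Polynomial.map_mul] at hab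
    rw [h.dvd_aeval_iff, h.dvd_aeval_iff]
    exact hf.dvd_or_dvd hab

end AdjoinsRoot

/-- The polynomial `X^p - c X - g`. -/
def asPoly {C : Type*} [CommRing C] (p : ℕ) (c g : C) : C[X] := X ^ p - (Polynomial.C c * X + Polynomial.C g)

section asPoly

variable {C : Type*} [CommRing C] {p : ℕ}

theorem asPoly_monic (hp : 1 < p) (c g : C) : (asPoly p c g).Monic := by
  nontriviality C
  refine monic_X_pow_sub ?_
  exact degree_linear_le.trans_lt (by exact_mod_cast hp)

theorem natDegree_asPoly [Nontrivial C] (hp : 1 < p) (c g : C) : (asPoly p c g).natDegree = p := by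
  rw [asPoly, natDegree_sub_eq_left_of_natDegree_lt, natDegree_X_pow]
  rw [natDegree_X_pow]
  exact natDegree_linear_le.trans_lt hp

theorem map_asPoly {S : Type*} [CommRing S] (φ : C →+* S) (c g : C) :
    (asPoly p c g).map φ = asPoly p (φ c) (φ g) := by
  simp [asPoly]

theorem aeval_asPoly {S : Type*} [CommRing S] [Algebra C S] (c g : C) (s : S) :
    aeval s (asPoly p c g) = s ^ p - (algebraMap C S c * s + algebraMap C S g) := by
  simp [asPoly]

theorem AdjoinsRoot.root_pow {D : Type*} [CommRing D] [Algebra C D] {c g : C} {z : D}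
    (h : AdjoinsRoot (asPoly p c g) z) :
    z ^ p = algebraMap C D c * z + algebraMap C D g := by
  have := h.aeval_self
  rw [aeval_asPoly] at this
  exact sub_eq_zero.mp this

end asPoly

section IntegralClosure

variable {C S D E : Type*} [CommRing C] [CommRing S] [CommRing D] [CommRing E] [Algebra C S]
  [Algebra S D] [Algebra C D] [IsScalarTower C S D] [Algebra C E] [Algebra E D]
  [IsScalarTower C E D] {p n : ℕ} (hp : 1 < p) {ϖ g : C} {w : S} {T : D}

theorem exists_pow_mul_eq_aeval [IsLocalization.Away ϖ S]
    (hT : Function.Surjective (aeval T : S[X] →ₐ[S] D)) (d : D) :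
    ∃ (k : ℕ) (q : C[X]),
      algebraMap C D ϖ ^ k * d = aeval (algebraMap C D ϖ ^ n * T) q := by
  obtain ⟨q, rfl⟩ := hT d
  induction q using Polynomial.induction_on' with
  | add q r hq hr =>
    obtain ⟨k, q', hq⟩ := hq
    obtain ⟨l, r', hr⟩ := hr
    refine ⟨k + l, Polynomial.C (ϖ ^ l) * q' + Polynomial.C (ϖ ^ k) * r', ?_⟩
    simp only [map_add, map_mul, aeval_C, ← hq, ← hr, map_pow]
    ring
  | monomial i s =>
    obtain ⟨⟨c, ⟨_, a, rfl⟩⟩, hc⟩ := IsLocalization.surj (Submonoid.powers ϖ) s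
    have hc' : algebraMap S D s * algebraMap C D ϖ ^ a = algebraMap C D c := by
      rw [IsScalarTower.algebraMap_apply C S D c, ← hc, map_mul,
        IsScalarTower.algebraMap_apply C S D ϖ]
      simp
    refine ⟨a + n * i, Polynomial.C c * X ^ i, ?_⟩
    simp only [aeval_monomial, map_mul, map_pow, aeval_C, aeval_X, ← hc']
    ring

include hp in
-- The equation is that of `T` multiplied by `ϖ^(p n)`. There are no further relations: a remainder
-- of degree less than `p` becomes, under `X ↦ ϖ^n X`, a polynomial of degree less than `p` that
-- kills `T`, so it vanishes, and `ϖ` is invertible in `S`.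
theorem asPoly_dvd_of_aeval_eq_zero [IsLocalization.Away ϖ S] (hϖ : ϖ ∈ nonZeroDivisors C)
    (hT : AdjoinsRoot (asPoly p 1 w) T)
    (hw : algebraMap C S g = algebraMap C S ϖ ^ (p * n) * w) (q : C[X]) :
    aeval (algebraMap C D ϖ ^ n * T) q = 0 ↔ asPoly p (ϖ ^ ((p - 1) * n)) g ∣ q := by
  rcases subsingleton_or_nontrivial C with _ | _
  · have := Module.subsingleton C D
    simp [Subsingleton.elim q 0, Subsingleton.elim _ (0 : D)]
  have hroot : aeval (algebraMap C D ϖ ^ n * T) (asPoly p (ϖ ^ ((p - 1) * n)) g) = 0 := by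
    have h := hT.root_pow
    rw [aeval_asPoly, IsScalarTower.algebraMap_apply C S D g, hw, mul_pow, h]
    simp only [map_mul, map_pow, map_one, ← IsScalarTower.algebraMap_apply C S D]
    obtain ⟨k, rfl⟩ : ∃ k, p = k + 1 := ⟨p - 1, by omega⟩
    simp only [Nat.add_sub_cancel]
    ring
  have hinj : Function.Injective (algebraMap C S) :=
    IsLocalization.injective (M := Submonoid.powers ϖ) S (Submonoid.powers_le.mpr hϖ)
  have : Nontrivial S := hinj.nontrivial
  constructor
  · intro hq
    have hmon := asPoly_monic hp (ϖ ^ ((p - 1) * n)) g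
    rw [← modByMonic_eq_zero_iff_dvd hmon]
    set r := q %ₘ asPoly p (ϖ ^ ((p - 1) * n)) g with hr
    have hr0 : aeval (algebraMap C D ϖ ^ n * T) r = 0 := by
      have := modByMonic_add_div q (asPoly p (ϖ ^ ((p - 1) * n)) g)
      rw [← hr] at this
      rw [← this, map_add, map_mul, hroot, zero_mul, add_zero] at hq
      exact hq
    have hrd : r.natDegree < p := by
      have := natDegree_modByMonic_lt q hmon (by
        intro h1
        have := natDegree_asPoly hp (ϖ ^ ((p - 1) * n)) g
        rw [h1, natDegree_one] at this
        omega)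
      rwa [natDegree_asPoly hp] at this
    let r' : S[X] := (r.map (algebraMap C S)).comp (Polynomial.C (algebraMap C S ϖ ^ n) * X)
    have hr' : aeval T r' = 0 := by
      rw [aeval_comp, map_mul, aeval_C, aeval_X, map_pow, aeval_map_algebraMap,
        ← IsScalarTower.algebraMap_apply]
      exact hr0
    have hr'd : r'.natDegree < p := by
      refine lt_of_le_of_lt natDegree_comp_le ?_
      have h1 := natDegree_map_le (f := algebraMap C S) (p := r)
      have h2 := (natDegree_C_mul_le (algebraMap C S ϖ ^ n) X).trans natDegree_X_le
      calc _ ≤ (r.map (algebraMap C S)).natDegree * 1 := Nat.mul_le_mul_left _ h2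
        _ < p := by omega
    have hr'0 : r' = 0 := by
      by_contra h0
      exact (asPoly_monic hp 1 w).not_dvd_of_natDegree_lt h0 (by rwa [natDegree_asPoly hp])
        ((hT.aeval_eq_zero_iff _).mp hr')
    ext i
    have := congrArg (coeff · i) hr'0
    simp only [r', comp_C_mul_X_coeff, coeff_map, coeff_zero] at this
    have hu : IsUnit ((algebraMap C S ϖ ^ n) ^ i) :=
      ((IsLocalization.Away.algebraMap_isUnit ϖ).pow n).pow i
    rw [hu.mul_left_eq_zero] at this
    rw [coeff_zero]
    exact (map_eq_zero_iff _ hinj).mp this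
  · rintro ⟨r, rfl⟩
    rw [map_mul, hroot, zero_mul]

/-- Integral elements of an Artin–Schreier extension of `C[1/ϖ]` are polynomials in the rescaled
root, if the reduction modulo `ϖ` of the equation of the latter defines a reduced ring. -/
theorem exists_eq_aeval_of_isIntegral [IsLocalization.Away ϖ S] {f : C[X]}
    {z : D} (hz : ∀ q : C[X], aeval z q = 0 ↔ f ∣ q)
    (hrad : IsRadical (f.map (Ideal.Quotient.mk (Ideal.span {ϖ})))) {d : D}
    (hd : IsIntegral C d) (k : ℕ) (q : C[X]) (hq : algebraMap C D ϖ ^ k * d = aeval z q) :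
    ∃ q : C[X], d = aeval z q := by
  have hu : IsUnit (algebraMap C D ϖ) := by
    rw [IsScalarTower.algebraMap_apply C S D]
    exact (IsLocalization.Away.algebraMap_isUnit ϖ).map _
  induction k generalizing q with
  | zero => exact ⟨q, by simpa using hq⟩
  | succ k ih =>
    obtain ⟨P, hP, hPd⟩ := hd
    -- Scaling the integral equation of `d` by `ϖ^(k+1)` gives a monic equation for `q(z)` that
    -- reduces to `X^N` modulo `ϖ`. So `f̄` divides `q̄^N`, hence `q̄`; thus `q = f t + ϖ r`, and
    -- the denominator drops by one factor `ϖ`.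
    have h1 : aeval z ((P.scaleRoots (ϖ ^ (k + 1))).comp q) = 0 := by
      rw [aeval_comp, ← hq, ← map_pow]
      exact scaleRoots_aeval_eq_zero hPd
    have h2 : f.map (Ideal.Quotient.mk (Ideal.span {ϖ})) ∣
        q.map (Ideal.Quotient.mk (Ideal.span {ϖ})) ^ P.natDegree := by
      obtain ⟨t, ht⟩ := (hz _).mp h1
      refine ⟨t.map (Ideal.Quotient.mk _), ?_⟩
      rw [← Polynomial.map_mul, ← ht, map_comp]
      nontriviality (C ⧸ Ideal.span {ϖ})
      have h0 : Ideal.Quotient.mk (Ideal.span {ϖ}) (ϖ ^ (k + 1)) = 0 :=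
        Ideal.Quotient.eq_zero_iff_mem.mpr
          (Ideal.mem_span_singleton.mpr (dvd_pow_self _ k.succ_ne_zero))
      rw [map_scaleRoots _ _ _ (by simp [hP.leadingCoeff]), h0, scaleRoots_zero,
        (hP.map _).leadingCoeff, one_smul, X_pow_comp, hP.natDegree_map]
    obtain ⟨t, ht⟩ := hrad _ _ h2
    obtain ⟨t, rfl⟩ := map_surjective _ Ideal.Quotient.mk_surjective t
    have h3 : Polynomial.C ϖ ∣ q - f * t := by
      refine (C_dvd_iff_dvd_coeff _ _).mpr fun i => ?_
      rw [← Ideal.mem_span_singleton, ← Ideal.Quotient.eq_zero_iff_mem, ← coeff_map,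
        Polynomial.map_sub, Polynomial.map_mul, ht, sub_self, coeff_zero]
    obtain ⟨r, hr⟩ := h3
    refine ih r (hu.mul_left_cancel ?_)
    have := congrArg (aeval z) hr
    rw [map_sub, map_mul, (hz f).mpr dvd_rfl, zero_mul, sub_zero, ← hq, map_mul, aeval_C] at this
    rw [← this]
    ring

include hp in
/-- The normalisation of `C` in an Artin–Schreier extension of `C[1/ϖ]`. -/
theorem adjoinsRoot_of_isIntegralClosure [IsIntegralClosure E C D] [IsLocalization.Away ϖ S]
    (hϖ : ϖ ∈ nonZeroDivisors C) (hT : AdjoinsRoot (asPoly p 1 w) T)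
    (hw : algebraMap C S g = algebraMap C S ϖ ^ (p * n) * w)
    (hrad : IsRadical ((asPoly p (ϖ ^ ((p - 1) * n)) g).map
      (Ideal.Quotient.mk (Ideal.span {ϖ})))) :
    ∃ z : E, algebraMap E D z = algebraMap C D ϖ ^ n * T ∧
      AdjoinsRoot (asPoly p (ϖ ^ ((p - 1) * n)) g) z := by
  have hz := asPoly_dvd_of_aeval_eq_zero (n := n) hp hϖ hT hw
  have hmon := asPoly_monic hp (ϖ ^ ((p - 1) * n)) g
  have hint : IsIntegral C (algebraMap C D ϖ ^ n * T) := ⟨_, hmon, (hz _).mpr dvd_rfl⟩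
  have hinj : Function.Injective (algebraMap E D) := IsIntegralClosure.algebraMap_injective E C D
  obtain ⟨z, hzz⟩ := IsIntegralClosure.isIntegral_iff (A := E).mp hint
  refine ⟨z, hzz, fun e => ?_, fun q => ?_⟩
  · have he : IsIntegral C (algebraMap E D e) := IsIntegralClosure.isIntegral_iff (A := E).mpr ⟨e, rfl⟩
    obtain ⟨k, q, hq⟩ := exists_pow_mul_eq_aeval (ϖ := ϖ) (n := n) hT.surjective (algebraMap E D e)
    obtain ⟨q, hq⟩ := exists_eq_aeval_of_isIntegral (S := S) hz hrad he k q hq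
    refine ⟨q, hinj ?_⟩
    rw [hq, ← hzz, aeval_algebraMap_apply]
  · rw [← hz, ← hzz, aeval_algebraMap_apply, map_eq_zero_iff _ hinj]

theorem isLocalization_away_of_isIntegralClosure [IsIntegralClosure E C D] [IsLocalization.Away ϖ S]
    (hT : AdjoinsRoot (asPoly p 1 w) T) {z : E}
    (hz : algebraMap E D z = algebraMap C D ϖ ^ n * T) :
    IsLocalization.Away (algebraMap C E ϖ) D := by
  have hinj : Function.Injective (algebraMap E D) := IsIntegralClosure.algebraMap_injective E C D
  have hu : IsUnit (algebraMap E D (algebraMap C E ϖ)) := by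
    rw [← IsScalarTower.algebraMap_apply, IsScalarTower.algebraMap_apply C S D]
    exact (IsLocalization.Away.algebraMap_isUnit ϖ).map _
  refine IsLocalization.Away.mk _ hu (fun d => ?_) fun a b hab => ⟨0, by rw [hinj hab]⟩
  obtain ⟨k, q, hq⟩ := exists_pow_mul_eq_aeval (ϖ := ϖ) (n := n) hT.surjective d
  refine ⟨k, aeval z q, ?_⟩
  rw [← aeval_algebraMap_apply, hz, ← hq, ← IsScalarTower.algebraMap_apply]
  ring

end IntegralClosure

end AdjoinsRoot

/-! ### Artin–Schreier equations with parameter as torsors under `M_n` -/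

section ASTorsor

open Polynomial

theorem add_pow_of_natCast_eq_zero {S : Type*} [CommRing S] {p : ℕ} (hp : p.Prime)
    (h : (p : S) = 0) (a b : S) : (a + b) ^ p = a ^ p + b ^ p := by
  obtain ⟨r, hr⟩ := exists_add_pow_prime_eq hp a b
  rw [hr, h]; ring

theorem sub_pow_of_natCast_eq_zero {S : Type*} [CommRing S] {p : ℕ} (hp : p.Prime)
    (h : (p : S) = 0) (a b : S) : (a - b) ^ p = a ^ p - b ^ p := by
  have := add_pow_of_natCast_eq_zero hp h (a - b) b
  rw [sub_add_cancel] at this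
  rw [this, add_sub_cancel_right]

theorem natCast_eq_zero_of_algebra (R : Type*) {S : Type*} [CommRing R] [CommRing S] [Algebra R S]
    (p : ℕ) [CharP R p] : (p : S) = 0 := by
  rw [← map_natCast (algebraMap R S), CharP.cast_eq_zero, map_zero]

variable {R : Type u} [CommRing R] {p : ℕ} [Fact p.Prime] [CharP R p] {π : R} {n : ℕ}
  {A B : Type v} [CommRing A] [CommRing B] [Algebra R A] [Algebra R B] [Algebra A B]
  [IsScalarTower R A B] {g : A} {z : B}

theorem MRing.comul_x : Coalgebra.comul (R := R) (MRing.x R p π n) =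
    MRing.x R p π n ⊗ₜ 1 + 1 ⊗ₜ MRing.x R p π n := by
  change (MRing.comulHom R p π n).toLinearMap (MRing.x R p π n) = _
  rw [AlgHom.toLinearMap_apply, MRing.comulHom, MRing.lift_x]

theorem MRing.counit_x : Coalgebra.counit (R := R) (MRing.x R p π n) = 0 := by
  change (MRing.counitHom R p π n).toLinearMap (MRing.x R p π n) = _
  rw [AlgHom.toLinearMap_apply, MRing.counitHom, MRing.lift_x]

namespace AdjoinsRoot

variable (h : AdjoinsRoot (asPoly p (algebraMap R A (π ^ ((p - 1) * n))) g) z)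

/-- The translation action of `M_n`. -/
def coact : B →ₐ[A] B ⊗[R] MRing R p π n :=
  h.lift (asPoly_monic (Fact.out : p.Prime).one_lt _ _) (z ⊗ₜ 1 + 1 ⊗ₜ MRing.x R p π n) (by
    rw [aeval_asPoly, add_pow_of_natCast_eq_zero Fact.out (natCast_eq_zero_of_algebra R p)]
    have hz := h.root_pow
    simp only [Algebra.TensorProduct.tmul_pow, one_pow, MRing.x_pow, hz, ← Algebra.smul_def,
      TensorProduct.tmul_smul, algebraMap_smul]
    rw [TensorProduct.add_tmul, smul_add, ← TensorProduct.smul_tmul',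
      Algebra.TensorProduct.algebraMap_apply]
    ring)

@[simp]
theorem coact_root : h.coact z = z ⊗ₜ 1 + 1 ⊗ₜ MRing.x R p π n :=
  h.lift_root ..

theorem coact_coassoc : ((Algebra.TensorProduct.assoc R R A B (MRing R p π n)
      (MRing R p π n)).toAlgHom.comp
      (Algebra.TensorProduct.map h.coact (AlgHom.id R (MRing R p π n)))).comp h.coact =
    (Algebra.TensorProduct.map (AlgHom.id A B) (Bialgebra.comulAlgHom R (MRing R p π n))).comp
      h.coact := by
  apply h.algHom_ext
  simp [MRing.comul_x, TensorProduct.add_tmul, TensorProduct.tmul_add, Algebra.TensorProduct.one_def,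
    add_assoc]

theorem coact_counit : ((Algebra.TensorProduct.rid R A B).toAlgHom.comp
      (Algebra.TensorProduct.map (AlgHom.id A B) (Bialgebra.counitAlgHom R (MRing R p π n)))).comp
      h.coact = AlgHom.id A B := by
  apply h.algHom_ext
  simp [MRing.counit_x]

/-- The inverse sends `x` to `1 ⊗ z - z ⊗ 1`, the difference of two points. Frobenius is additive
and the constant term `g` cancels, so this difference satisfies the equation of `M_n`. -/
theorem coact_bijective : Function.Bijective
    (Algebra.TensorProduct.productLeftAlgHom
      (Algebra.TensorProduct.includeLeft : B →ₐ[B] B ⊗[R] MRing R p π n) h.coact :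
        B ⊗[A] B →ₐ[B] B ⊗[R] MRing R p π n) := by
  have hx : ((1 : B) ⊗ₜ[A] z - z ⊗ₜ[A] (1 : B)) ^ p =
      algebraMap R (B ⊗[A] B) (π ^ ((p - 1) * n)) * ((1 : B) ⊗ₜ[A] z - z ⊗ₜ[A] (1 : B)) := by
    have hz := h.root_pow
    rw [sub_pow_of_natCast_eq_zero Fact.out (natCast_eq_zero_of_algebra R p)]
    simp only [Algebra.TensorProduct.tmul_pow, one_pow, hz, ← Algebra.smul_def, smul_sub,
      TensorProduct.add_tmul, TensorProduct.tmul_add, TensorProduct.tmul_smul, algebraMap_smul,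
      TensorProduct.smul_tmul']
    rw [Algebra.algebraMap_eq_smul_one, ← TensorProduct.smul_tmul]
    ring
  let ψ : B ⊗[R] MRing R p π n →ₐ[B] B ⊗[A] B :=
    Algebra.TensorProduct.lift (Algebra.ofId B _) (MRing.lift _ hx) fun _ _ => Commute.all _ _
  have h1 : ψ.comp (Algebra.TensorProduct.productLeftAlgHom
      (Algebra.TensorProduct.includeLeft : B →ₐ[B] B ⊗[R] MRing R p π n) h.coact) =
      AlgHom.id B _ := by
    apply Algebra.TensorProduct.ext (by ext)
    apply h.algHom_ext
    simp [ψ, Algebra.ofId_apply, ← Algebra.TensorProduct.one_def]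
  have h2 : (Algebra.TensorProduct.productLeftAlgHom
      (Algebra.TensorProduct.includeLeft : B →ₐ[B] B ⊗[R] MRing R p π n) h.coact).comp ψ =
      AlgHom.id B _ := by
    apply Algebra.TensorProduct.ext (by ext)
    apply MRing.algHom_ext
    simp [ψ, ← Algebra.TensorProduct.one_def]
  exact Function.bijective_iff_has_inverse.mpr ⟨ψ, AlgHom.congr_fun h1, AlgHom.congr_fun h2⟩

theorem faithfullyFlat {A B : Type*} [CommRing A] [CommRing B] [Algebra A B] {f : A[X]} {z : B}
    (h : AdjoinsRoot f z) (hf : f.Monic) (hd : f.natDegree ≠ 0) : Module.FaithfullyFlat A B := by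
  have : Nonempty (Fin f.natDegree) := ⟨⟨0, Nat.pos_of_ne_zero hd⟩⟩
  exact Module.FaithfullyFlat.of_linearEquiv _ _ (h.basis hf).repr

/-- An extension `z ^ p = π ^ ((p - 1) n) z + g` is a torsor under `M_n`. -/
def torsorStructure : TorsorStructure R (MRing R p π n) A B where
  coact := h.coact
  coassoc := LinearMap.ext fun b => AlgHom.congr_fun h.coact_coassoc b
  counit := LinearMap.ext fun b => AlgHom.congr_fun h.coact_counit b
  faithfullyFlat := by
    have hp : p.Prime := Fact.out
    rcases subsingleton_or_nontrivial A with _ | _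
    · have := Module.subsingleton A B
      exact Module.FaithfullyFlat.of_linearEquiv A A
        { toFun := fun _ => 0, map_add' := by simp, map_smul' := by simp, invFun := fun _ => 0,
          left_inv := fun _ => Subsingleton.elim _ _, right_inv := fun _ => Subsingleton.elim _ _ }
    · exact h.faithfullyFlat (asPoly_monic hp.one_lt _ _)
        (by rw [natDegree_asPoly hp.one_lt]; exact hp.ne_zero)
  bijective := h.coact_bijective

end AdjoinsRoot

end ASTorsor

/-! ### A Galois criterion for cyclic étale torsors -/

section CyclicTorsor

open Polynomial

/-- The homomorphism from `ℤ/N` given by an element of exponent `N`. -/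
def cyclicHom {G : Type*} [Group G] (N : ℕ) [NeZero N] (σ : G) (h : σ ^ N = 1) :
    Multiplicative (ZMod N) →* G where
  toFun g := σ ^ g.toAdd.val
  map_one' := by simp
  map_mul' a b := by
    rw [toAdd_mul, ZMod.val_add, ← pow_add, pow_eq_pow_mod (_ + _) h]

/-- Surjectivity is an explicit form of Dedekind's independence of characters: for each `g`, the
product over `h ≠ g` of the elements `1 ⊗ y - ρ_h(y) ⊗ 1`, divided by the units `ρ_g(y) - ρ_h(y)`,
maps to the indicator function of `g`. Both sides are free over `D` of the same rank, so
surjectivity implies injectivity. -/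
theorem Algebra.TensorProduct.bijective_of_isUnit_sub {G A D ι : Type*} [Group G] [Finite G]
    [CommRing A] [CommRing D] [Algebra A D] [Finite ι] (b : Module.Basis ι A D)
    (hcard : Nat.card ι = Nat.card G) (ρ : G →* (D ≃ₐ[A] D))
    (hunit : ∀ g : G, g ≠ 1 → ∃ y, IsUnit (ρ g y - y)) :
    Function.Bijective (fun (z : D ⊗[A] D) (g : G) =>
      Algebra.TensorProduct.productMap (AlgHom.id A D) (ρ g : D →ₐ[A] D) z) := by
  classical
  have := Fintype.ofFinite G
  have := Fintype.ofFinite ι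
  let Φ : D ⊗[A] D →ₐ[D] (G → D) := AlgHom.pi fun g =>
    Algebra.TensorProduct.lift (AlgHom.id D D) (ρ g : D →ₐ[A] D) fun _ _ => Commute.all _ _
  have hΦ : ⇑Φ = (fun (z : D ⊗[A] D) (g : G) =>
      Algebra.TensorProduct.productMap (AlgHom.id A D) (ρ g : D →ₐ[A] D) z) := by
    funext z g
    induction z with
    | zero => simp
    | add x y hx hy => simp only [map_add, Pi.add_apply, hx, hy]
    | tmul x y => rfl
  have hΦt : ∀ x y g, Φ (x ⊗ₜ y) g = x * ρ g y := fun x y g => rfl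
  rw [← hΦ]
  have hunit' : ∀ g h : G, g ≠ h → ∃ y, IsUnit (ρ g y - ρ h y) := by
    intro g h hgh
    obtain ⟨y, hy⟩ := hunit (h⁻¹ * g) (by rwa [Ne, inv_mul_eq_one, eq_comm])
    refine ⟨y, ?_⟩
    have := hy.map (ρ h)
    rwa [map_sub, ← AlgEquiv.mul_apply, ← map_mul, mul_inv_cancel_left] at this
  have hsurj : Function.Surjective Φ := by
    suffices hs : ∀ g, ∃ e, Φ e = Pi.single g 1 by
      choose e he using hs
      intro f
      refine ⟨∑ g, f g • e g, ?_⟩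
      rw [map_sum]
      simp only [map_smul, he]
      funext h
      simp [Finset.sum_apply, Pi.single_apply]
    intro g
    choose! y hy using hunit' g
    refine ⟨∏ h ∈ Finset.univ.erase g, (↑(if hh : g ≠ h then (hy h hh).unit⁻¹ else 1 : Dˣ) : D) •
      ((1 : D) ⊗ₜ[A] y h - ρ h (y h) ⊗ₜ 1), ?_⟩
    rw [map_prod]
    funext k
    rw [Finset.prod_apply]
    simp only [map_smul, map_sub, Pi.smul_apply, Pi.sub_apply, hΦt, one_mul, map_one, mul_one,
      smul_eq_mul]
    by_cases hk : k = g
    · subst hk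
      rw [Pi.single_eq_same]
      refine Finset.prod_eq_one fun h hh => ?_
      have hne : k ≠ h := (Finset.ne_of_mem_erase hh).symm
      rw [dif_pos hne]
      exact (hy h hne).val_inv_mul
    · rw [Pi.single_eq_of_ne hk]
      exact Finset.prod_eq_zero (Finset.mem_erase.mpr ⟨hk, Finset.mem_univ k⟩) (by simp)
  refine ⟨?_, hsurj⟩
  have e0 : ι ≃ G := Fintype.equivOfCardEq (by
    rwa [← Nat.card_eq_fintype_card, ← Nat.card_eq_fintype_card])
  let e : (G → D) ≃ₗ[D] D ⊗[A] D :=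
    (Pi.basisFun D G).equiv (Algebra.TensorProduct.basis D b) e0.symm
  have : Module.Finite D (D ⊗[A] D) := Module.Finite.of_basis (Algebra.TensorProduct.basis D b)
  have hinj := OrzechProperty.injective_of_surjective_endomorphism
    (e.toLinearMap.comp Φ.toLinearMap) (e.surjective.comp hsurj)
  exact Function.Injective.of_comp (f := e) hinj

/-- A criterion for cyclic torsors. -/
theorem isCyclicTorsor_of_isUnit_sub {N : ℕ} [NeZero N] {A : Type v} {D' : Type w} {D ι : Type*}
    [CommRing A] [CommRing D] [Algebra A D] [CommRing D'] [Algebra A D'] [Finite ι]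
    (e : D ≃ₐ[A] D') (b : Module.Basis ι A D) (hcard : Nat.card ι = N) [Algebra.Etale A D]
    (σ : D ≃ₐ[A] D) (hσ : σ ^ N = 1)
    (hunit : ∀ k, 0 < k → k < N → ∃ y, IsUnit ((σ ^ k) y - y)) :
    IsCyclicTorsor N A D' := by
  have : Nonempty ι := by
    by_contra h
    rw [not_nonempty_iff] at h
    exact NeZero.ne N (hcard ▸ Nat.card_of_isEmpty)
  have hσ' : (e.autCongr σ) ^ N = 1 := by rw [← map_pow, hσ, map_one]
  refine ⟨Module.FaithfullyFlat.of_linearEquiv _ _ (e.symm.toLinearEquiv.trans b.repr),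
    Algebra.Etale.of_equiv e, cyclicHom N (e.autCongr σ) hσ', ?_⟩
  refine Algebra.TensorProduct.bijective_of_isUnit_sub (b.map e.toLinearEquiv)
    (by rw [hcard, Nat.card_congr Multiplicative.toAdd, Nat.card_zmod]) _ fun g hg => ?_
  have hk : 0 < g.toAdd.val := by
    rw [Nat.pos_iff_ne_zero, Ne, ZMod.val_eq_zero]
    exact hg
  obtain ⟨y, hy⟩ := hunit _ hk (ZMod.val_lt _)
  refine ⟨e y, ?_⟩
  have h1 : cyclicHom N (e.autCongr σ) hσ' g = e.autCongr (σ ^ g.toAdd.val) := by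
    rw [map_pow]; rfl
  rw [h1]
  simpa using hy.map e

theorem AdjoinsRoot.mk' {C D : Type*} [CommRing C] [CommRing D] [Algebra C D] {f : C[X]} {z : D}
    (hs : Function.Surjective (aeval z : C[X] →ₐ[C] D)) (hf : aeval z f = 0)
    (ψ : D →ₐ[C] AdjoinRoot f) (hψ : ψ z = AdjoinRoot.root f) : AdjoinsRoot f z where
  surjective := hs
  aeval_eq_zero_iff q := by
    refine ⟨fun h => ?_, ?_⟩
    · rw [← AdjoinRoot.mk_eq_zero, ← AdjoinRoot.aeval_eq, ← hψ, aeval_algHom_apply, h, map_zero]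
    · rintro ⟨r, rfl⟩
      rw [map_mul, hf, zero_mul]

theorem AdjoinsRoot.baseChange {C D : Type*} (S : Type*) [CommRing C] [CommRing D] [CommRing S]
    [Algebra C D] [Algebra C S] {f : C[X]} {z : D} (h : AdjoinsRoot f z) (hf : f.Monic) :
    AdjoinsRoot (f.map (algebraMap C S)) ((1 : S) ⊗ₜ[C] z) := by
  have haev : ∀ q : C[X], aeval ((1 : S) ⊗ₜ[C] z) q = (1 : S) ⊗ₜ[C] aeval z q := fun q =>
    aeval_algHom_apply (Algebra.TensorProduct.includeRight (R := C) (A := S)) z q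
  refine .mk' (fun d => ?_) ?_ (Algebra.TensorProduct.lift (Algebra.ofId _ _)
    (h.lift hf (AdjoinRoot.root (f.map (algebraMap C S))) ?_) fun _ _ => Commute.all _ _) ?_
  · induction d with
    | zero => exact ⟨0, map_zero _⟩
    | add x y hx hy =>
      obtain ⟨q, rfl⟩ := hx
      obtain ⟨r, rfl⟩ := hy
      exact ⟨q + r, map_add _ _ _⟩
    | tmul s d =>
      obtain ⟨q, rfl⟩ := h.surjective d
      refine ⟨Polynomial.C s * q.map (algebraMap C S), ?_⟩
      rw [map_mul, aeval_C, aeval_map_algebraMap, haev, Algebra.TensorProduct.algebraMap_apply,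
        Algebra.TensorProduct.tmul_mul_tmul]
      simp
  · rw [aeval_map_algebraMap, haev, h.aeval_self, TensorProduct.tmul_zero]
  · rw [← aeval_map_algebraMap S, AdjoinRoot.aeval_eq, AdjoinRoot.mk_self]
  · simp

/-- Once `π` is inverted, `T = π^(-n) z` recovers the standard Artin–Schreier equation; here `u`
plays the role of `π^n`. -/
theorem AdjoinsRoot.rescale {S D : Type*} [CommRing S] [CommRing D] [Algebra S D] {p : ℕ}
    (hp : 1 < p) {g : S} {z : D} {u v : S} (huv : u * v = 1)
    (h : AdjoinsRoot (asPoly p (u ^ (p - 1)) g) z) :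
    AdjoinsRoot (asPoly p 1 (v ^ p * g)) (algebraMap S D v * z) := by
  obtain ⟨k, rfl⟩ : ∃ k, p = k + 1 := ⟨p - 1, by omega⟩
  have huv' : algebraMap S D u * algebraMap S D v = 1 := by rw [← map_mul, huv, map_one]
  have hvu : ∀ n, algebraMap S D v ^ n * algebraMap S D u ^ n = 1 := fun n => by
    rw [← mul_pow, mul_comm, huv', one_pow]
  refine .mk' (fun d => ?_) ?_ (h.lift (asPoly_monic hp _ _)
    (algebraMap S _ u * AdjoinRoot.root _) ?_) ?_
  · obtain ⟨q, rfl⟩ := h.surjective d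
    refine ⟨q.comp (Polynomial.C u * X), ?_⟩
    rw [aeval_comp, map_mul, aeval_C, aeval_X, ← mul_assoc, huv', one_mul]
  · have := h.root_pow
    rw [aeval_asPoly, mul_pow, this]
    simp only [map_mul, map_pow, map_one, Nat.add_sub_cancel]
    linear_combination (algebraMap S D v * z) * hvu k
  · have := (AdjoinRoot.adjoinsRoot (asPoly (k + 1) 1 (v ^ (k + 1) * g))).root_pow
    set r := AdjoinRoot.root (asPoly (k + 1) 1 (v ^ (k + 1) * g))
    set B := AdjoinRoot (asPoly (k + 1) 1 (v ^ (k + 1) * g))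
    have hu : algebraMap S B u ^ (k + 1) * algebraMap S B v ^ (k + 1) = 1 := by
      rw [← map_pow, ← map_pow, ← map_mul, ← mul_pow, huv, one_pow, map_one]
    rw [aeval_asPoly, mul_pow, this]
    simp only [map_mul, map_pow, map_one, Nat.add_sub_cancel]
    linear_combination algebraMap S B g * hu
  · rw [map_mul, AlgHom.commutes, h.lift_root, ← mul_assoc, ← map_mul, mul_comm v, huv, map_one,
      one_mul]

section ArtinSchreier

variable {S D : Type*} [CommRing S] [CommRing D] [Algebra S D] {p : ℕ} [Fact p.Prime]
  {w : S} {T : D} (hp : (p : S) = 0) (h : AdjoinsRoot (asPoly p 1 w) T)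

include hp h in
-- The derivative of `X^p - X - w` is `-1`.
theorem AdjoinsRoot.etale : Algebra.Etale S D := by
  have hpp : p.Prime := Fact.out
  have hmon := asPoly_monic hpp.one_lt 1 w
  let P : StandardEtalePair S :=
    { f := asPoly p 1 w
      monic_f := hmon
      g := 1
      cond := ⟨-1, 0, 0, by
        simp [asPoly, derivative_X_pow, hp]⟩ }
  have hm : P.HasMap T := ⟨h.aeval_self, by simp [P]⟩
  let ψ : D →ₐ[S] P.Ring := h.lift hmon P.X P.hasMap_X.1
  have h1 : (P.lift T hm).comp ψ = AlgHom.id S D := h.algHom_ext (by simp [ψ])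
  have h2 : ψ.comp (P.lift T hm) = AlgHom.id S _ := P.hom_ext (by simp [ψ])
  have : Algebra.IsStandardEtale S D := ⟨⟨
    { P with
      x := T
      hasMap := hm
      lift_bijective := Function.bijective_iff_has_inverse.mpr
        ⟨ψ, AlgHom.congr_fun h2, AlgHom.congr_fun h1⟩ }⟩⟩
  infer_instance

theorem isUnit_natCast_of_natCast_eq_zero {D : Type*} [CommRing D] (hp : (p : D) = 0) {k : ℕ}
    (hk : 0 < k) (hkp : k < p) : IsUnit (k : D) := by
  have hc : IsCoprime (k : ℤ) (p : ℤ) :=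
    Nat.isCoprime_iff_coprime.mpr (Nat.coprime_of_lt_prime hk.ne' hkp (Fact.out : p.Prime)).symm
  obtain ⟨a, b, hab⟩ := hc
  have := congrArg (Int.cast : ℤ → D) hab
  push_cast at this
  rw [hp, mul_zero, add_zero, mul_comm] at this
  exact IsUnit.of_mul_eq_one _ this

include hp in
theorem aeval_add_asPoly_one {S' : Type*} [CommRing S'] [Algebra S S'] {t c : S'}
    (ht : aeval t (asPoly p 1 w) = 0) (hc : c ^ p = c) : aeval (t + c) (asPoly p 1 w) = 0 := by
  have hp' : (p : S') = 0 := by rw [← map_natCast (algebraMap S S'), hp, map_zero]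
  rw [aeval_asPoly] at ht ⊢
  rw [add_pow_of_natCast_eq_zero Fact.out hp', hc]
  simp only [map_one, one_mul] at ht ⊢
  linear_combination ht

theorem neg_one_pow_of_natCast_eq_zero (hp : (p : D) = 0) : (-1 : D) ^ p = -1 := by
  have := sub_pow_of_natCast_eq_zero (p := p) Fact.out hp 0 1
  simpa [(Fact.out : p.Prime).ne_zero] using this

/-- The translation of the root by `1`. -/
def AdjoinsRoot.translation : D ≃ₐ[S] D :=
  AlgEquiv.ofAlgHom
    (h.lift (asPoly_monic (Fact.out : p.Prime).one_lt _ _) (T + 1)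
      (aeval_add_asPoly_one hp h.aeval_self (one_pow p)))
    (h.lift (asPoly_monic (Fact.out : p.Prime).one_lt _ _) (T + -1)
      (aeval_add_asPoly_one hp h.aeval_self (neg_one_pow_of_natCast_eq_zero
        (by rw [← map_natCast (algebraMap S D), hp, map_zero]))))
    (h.algHom_ext (by simp)) (h.algHom_ext (by simp))

theorem AdjoinsRoot.translation_pow (k : ℕ) : (h.translation hp ^ k) T = T + k := by
  have h1 : h.translation hp T = T + 1 := h.lift_root _ _ (aeval_add_asPoly_one hp h.aeval_self (one_pow p))
  induction k with
  | zero => simp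
  | succ k ih =>
    rw [pow_succ', AlgEquiv.mul_apply, ih, map_add, map_natCast, h1]
    push_cast; ring

end ArtinSchreier

theorem AdjoinsRoot.isCyclicTorsor {S : Type v} {D : Type w} [CommRing S] [CommRing D]
    [Algebra S D] {p : ℕ} [Fact p.Prime] {w : S} {T : D} (hp : (p : S) = 0)
    (h : AdjoinsRoot (asPoly p 1 w) T) [Nontrivial S] : IsCyclicTorsor p S D := by
  have hpp : p.Prime := Fact.out
  have : NeZero p := ⟨hpp.ne_zero⟩
  have hp' : (p : D) = 0 := by rw [← map_natCast (algebraMap S D), hp, map_zero]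
  have := h.etale hp
  refine isCyclicTorsor_of_isUnit_sub AlgEquiv.refl (h.basis (asPoly_monic hpp.one_lt 1 w))
    (by rw [Nat.card_fin, natDegree_asPoly hpp.one_lt]) (h.translation hp) ?_ fun k hk hkp => ⟨T, ?_⟩
  · have : ((h.translation hp ^ p : D ≃ₐ[S] D) : D →ₐ[S] D) = AlgHom.id S D :=
      h.algHom_ext (by
        rw [AlgEquiv.coe_toAlgHom, h.translation_pow, hp', add_zero, AlgHom.id_apply])
    ext d
    exact AlgHom.congr_fun this d
  · rw [h.translation_pow, add_sub_cancel_left]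
    exact isUnit_natCast_of_natCast_eq_zero hp' hk hkp

/-- The generic fibre of `z ^ p = ϖ ^ ((p - 1) n) z + g` is a `ℤ/p`-torsor. -/
theorem AdjoinsRoot.isGenericallyCyclic {R : Type u} {C D : Type v} [CommRing R] [CommRing C]
    [CommRing D] [Algebra R C] [Algebra C D] {p n : ℕ} [Fact p.Prime] [CharP R p] {π : R} {g : C}
    {z : D} (h : AdjoinsRoot (asPoly p (algebraMap R C (π ^ ((p - 1) * n))) g) z)
    [Nontrivial (GenericFibre π C)] : IsGenericallyCyclic π p C D := by
  have hpp : p.Prime := Fact.out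
  have h1 := h.baseChange (GenericFibre π C) (asPoly_monic hpp.one_lt _ _)
  have huv : (algebraMap C (GenericFibre π C) (algebraMap R C π)) ^ n *
      (IsLocalization.Away.invSelf (algebraMap R C π)) ^ n = 1 := by
    rw [← mul_pow, IsLocalization.Away.mul_invSelf, one_pow]
  rw [map_asPoly, mul_comm (p - 1), pow_mul, map_pow, map_pow, map_pow, map_pow] at h1
  exact (h1.rescale hpp.one_lt huv).isCyclicTorsor (natCast_eq_zero_of_algebra R p)

end CyclicTorsor

/-! ### The carry polynomial of Witt vectors of length two -/

section WittQ

/-- The polynomial `((x + y) ^ p - x ^ p - y ^ p) / p`. -/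
def wittQ (p : ℕ) {S : Type*} [CommRing S] (x y : S) : S :=
  ∑ k ∈ Finset.Ioo 0 p, ((p.choose k / p : ℕ) : S) * x ^ k * y ^ (p - k)

theorem map_wittQ (p : ℕ) {S S' F : Type*} [CommRing S] [CommRing S'] [FunLike F S S']
    [RingHomClass F S S'] (φ : F) (x y : S) : φ (wittQ p x y) = wittQ p (φ x) (φ y) := by
  simp [wittQ]

variable {p : ℕ} [Fact p.Prime]

theorem natCast_mul_wittQ {S : Type*} [CommRing S] (x y : S) :
    (p : S) * wittQ p x y = (x + y) ^ p - x ^ p - y ^ p := by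
  have hp : p.Prime := Fact.out
  have h1 : (x + y) ^ p = y ^ p + x ^ p + ∑ k ∈ Finset.Ioo 0 p, x ^ k * y ^ (p - k) * p.choose k := by
    rw [add_pow, Finset.sum_range_succ, Finset.sum_range_eq_add_Ico _ hp.pos]
    have : Finset.Ico 1 p = Finset.Ioo 0 p := by ext; simp; omega
    rw [this]
    simp
    ring
  rw [h1, wittQ, Finset.mul_sum]
  have h2 : ∀ k ∈ Finset.Ioo 0 p, (p : S) * (((p.choose k / p : ℕ) : S) * x ^ k * y ^ (p - k)) =
      x ^ k * y ^ (p - k) * p.choose k := by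
    intro k hk
    obtain ⟨hk0, hkp⟩ := Finset.mem_Ioo.mp hk
    have h3 : (p : S) * ((p.choose k / p : ℕ) : S) = p.choose k := by
      rw [← Nat.cast_mul, Nat.mul_div_cancel' (hp.dvd_choose_self hk0.ne' hkp)]
    rw [← h3]; ring
  rw [Finset.sum_congr rfl h2]
  ring

theorem natCast_mul_left_cancel_mvPolynomial {σ : Type*} {a b : MvPolynomial σ ℤ}
    (h : (p : MvPolynomial σ ℤ) * a = p * b) : a = b :=
  mul_left_cancel₀ (Nat.cast_ne_zero.mpr (Fact.out : p.Prime).ne_zero) h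

/-- Over `ℤ` the identity may be multiplied by `p`, and `p Q` is the coboundary of `x ↦ x^p`. -/
theorem wittQ_cocycle {S : Type*} [CommRing S] (x y z : S) :
    wittQ p x y + wittQ p (x + y) z = wittQ p y z + wittQ p x (y + z) := by
  have key : (wittQ p (.X 0) (.X 1) + wittQ p (.X 0 + .X 1) (.X 2) : MvPolynomial (Fin 3) ℤ) =
      wittQ p (.X 1) (.X 2) + wittQ p (.X 0) (.X 1 + .X 2) := by
    apply natCast_mul_left_cancel_mvPolynomial (p := p)
    simp only [mul_add, natCast_mul_wittQ]
    ring
  simpa [map_wittQ] using congrArg (MvPolynomial.aeval ![x, y, z]) key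

/-- Times `p`, the sum telescopes over `ℤ` to `(x + p)^p - x^p - p`, and `p²` divides `(x + p)^p -
x^p`. In terms of Witt vectors: `p · (1, 0) = (0, 1)` in characteristic `p`. -/
theorem sum_wittQ_add_one {S : Type*} [CommRing S] (hp : (p : S) = 0) (x : S) :
    ∑ j ∈ Finset.range p, wittQ p (x + j) 1 = -1 := by
  have key : ∃ r : MvPolynomial Unit ℤ,
      ∑ j ∈ Finset.range p, wittQ p (MvPolynomial.X () + (j : MvPolynomial Unit ℤ)) 1 =
        -1 + (p : MvPolynomial Unit ℤ) * r := by
    have h1 : (p : MvPolynomial Unit ℤ) ^ 2 ∣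
        (MvPolynomial.X () + (p : MvPolynomial Unit ℤ)) ^ p - MvPolynomial.X () ^ p := by
      have := dvd_sub_pow_of_dvd_sub (p := p) (R := MvPolynomial Unit ℤ)
        (a := MvPolynomial.X () + (p : MvPolynomial Unit ℤ)) (b := MvPolynomial.X ()) (by simp) 1
      simpa using this
    obtain ⟨r, hr⟩ := h1
    refine ⟨r, natCast_mul_left_cancel_mvPolynomial (p := p) ?_⟩
    rw [Finset.mul_sum]
    simp only [natCast_mul_wittQ]
    have h2 : ∀ j : ℕ, (MvPolynomial.X () + (j : MvPolynomial Unit ℤ) + 1) ^ p -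
        (MvPolynomial.X () + (j : MvPolynomial Unit ℤ)) ^ p - 1 ^ p =
        (MvPolynomial.X () + ((j + 1 : ℕ) : MvPolynomial Unit ℤ)) ^ p -
        (MvPolynomial.X () + (j : MvPolynomial Unit ℤ)) ^ p - 1 := fun j => by
      push_cast; rw [one_pow, add_assoc]
    simp only [h2]
    rw [Finset.sum_sub_distrib, Finset.sum_range_sub
      (fun j : ℕ => (MvPolynomial.X () + (j : MvPolynomial Unit ℤ)) ^ p)]
    simp only [Finset.sum_const, Finset.card_range, nsmul_eq_mul, mul_one, Nat.cast_zero, add_zero]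
    linear_combination hr
  obtain ⟨r, hr⟩ := key
  have := congrArg (MvPolynomial.aeval (fun _ : Unit => x)) hr
  simpa [map_wittQ, hp] using this

/-- The Frobenius of a ring in which `p = 0`. -/
def powHom (p : ℕ) [Fact p.Prime] {S : Type*} [CommRing S] (hp : (p : S) = 0) : S →+* S where
  toFun x := x ^ p
  map_one' := one_pow p
  map_mul' x y := mul_pow x y p
  map_zero' := zero_pow (Fact.out : p.Prime).ne_zero
  map_add' x y := add_pow_of_natCast_eq_zero Fact.out hp x y

theorem wittQ_pow {S : Type*} [CommRing S] (hp : (p : S) = 0) (x y : S) :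
    wittQ p x y ^ p = wittQ p (x ^ p) (y ^ p) :=
  map_wittQ p (powHom p hp) x y

/-- The second ghost component of a difference, with `p` cancelled over `ℤ`. -/
theorem wittSub_one : WittVector.wittSub p 1 = MvPolynomial.X (0, 1) - MvPolynomial.X (1, 1) +
    wittQ p (MvPolynomial.X (0, 0) - MvPolynomial.X (1, 0)) (MvPolynomial.X (1, 0)) := by
  apply natCast_mul_left_cancel_mvPolynomial (p := p)
  have h0 := WittVector.wittSub_zero (p := p)
  have h := wittStructureInt_prop p (MvPolynomial.X 0 - MvPolynomial.X 1 : MvPolynomial (Fin 2) ℤ) 1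
  rw [wittPolynomial_one] at h
  simp only [map_add, map_mul, map_pow, map_sub, MvPolynomial.bind₁_X_right, MvPolynomial.rename_X,
    MvPolynomial.bind₁_C_right, MvPolynomial.rename_C] at h
  change MvPolynomial.C (p : ℤ) * WittVector.wittSub p 1 + WittVector.wittSub p 0 ^ p = _ at h
  rw [h0] at h
  simp only [map_natCast] at h
  rw [mul_add, natCast_mul_wittQ, sub_add_cancel]
  linear_combination h

theorem TruncatedWittVector.sub_coeff_one {S : Type*} [CommRing S] (x y : TruncatedWittVector p 2 S) :
    (x - y).coeff 1 = x.coeff 1 - y.coeff 1 + wittQ p (x.coeff 0 - y.coeff 0) (y.coeff 0) := by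
  have h : x - y = WittVector.truncateFun 2 (x.out - y.out) := by
    rw [WittVector.truncateFun_sub]
    simp [TruncatedWittVector.truncateFun_out]
  rw [h, WittVector.coeff_truncateFun]
  have h2 := WittVector.sub_coeff x.out y.out 1
  rw [WittVector.peval, wittSub_one] at h2
  simp only [map_add, map_sub, map_wittQ, MvPolynomial.aeval_X] at h2
  simpa [Function.uncurry, ← TruncatedWittVector.coeff_out] using h2

theorem wittFrobSub_coeff_one (S : Type v) [CommRing S] :
    (wittFrobSub p S).coeff 1 = MvPolynomial.X 1 ^ p - MvPolynomial.X 1 +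
      wittQ p (MvPolynomial.X 0 ^ p - MvPolynomial.X 0) (MvPolynomial.X 0) := by
  rw [wittFrobSub, TruncatedWittVector.sub_coeff_one]
  simp

end WittQ

/-! ### The generic cover as a tower of two Artin–Schreier extensions -/

section CoverStructure

open Polynomial

variable {R : Type u} [CommRing R] (p : ℕ) [Fact p.Prime] (π : R) (m : ℕ)
  {A : Type v} [CommRing A] [Algebra R A] (a₁ a₂ : A)

instance : Algebra (Y₁Gen p π m a₁) (YGen p π m a₁ a₂) := (towerGen p π m a₁ a₂).toAlgebra

instance : IsScalarTower (GenericFibre π A) (Y₁Gen p π m a₁) (YGen p π m a₁ a₂) :=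
  IsScalarTower.of_algebraMap_eq' (towerGen p π m a₁ a₂).comp_algebraMap.symm

instance : IsScalarTower A (Y₁Gen p π m a₁) (YGen p π m a₁ a₂) :=
  IsScalarTower.of_algebraMap_eq' (by
    rw [IsScalarTower.algebraMap_eq A (GenericFibre π A) (YGen p π m a₁ a₂),
      IsScalarTower.algebraMap_eq A (GenericFibre π A) (Y₁Gen p π m a₁),
      IsScalarTower.algebraMap_eq (GenericFibre π A) (Y₁Gen p π m a₁) (YGen p π m a₁ a₂),
      RingHom.comp_assoc])

instance : Algebra (Y₁Ring p π m a₁) (Y₁Gen p π m a₁) :=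
  inferInstanceAs (Algebra (integralClosure A (Y₁Gen p π m a₁)) (Y₁Gen p π m a₁))

instance : IsScalarTower A (Y₁Ring p π m a₁) (Y₁Gen p π m a₁) :=
  inferInstanceAs (IsScalarTower A (integralClosure A (Y₁Gen p π m a₁)) (Y₁Gen p π m a₁))

instance : IsIntegralClosure (Y₁Ring p π m a₁) A (Y₁Gen p π m a₁) :=
  inferInstanceAs (IsIntegralClosure (integralClosure A (Y₁Gen p π m a₁)) A (Y₁Gen p π m a₁))

instance : Algebra (YRing p π m a₁ a₂) (YGen p π m a₁ a₂) :=
  inferInstanceAs (Algebra (integralClosure A (YGen p π m a₁ a₂)) (YGen p π m a₁ a₂))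

instance : IsScalarTower A (YRing p π m a₁ a₂) (YGen p π m a₁ a₂) :=
  inferInstanceAs (IsScalarTower A (integralClosure A (YGen p π m a₁ a₂)) (YGen p π m a₁ a₂))

instance : IsIntegralClosure (YRing p π m a₁ a₂) A (YGen p π m a₁ a₂) :=
  inferInstanceAs (IsIntegralClosure (integralClosure A (YGen p π m a₁ a₂)) A (YGen p π m a₁ a₂))

instance : Algebra (Y₁Ring p π m a₁) (YGen p π m a₁ a₂) :=
  ((algebraMap (YRing p π m a₁ a₂) (YGen p π m a₁ a₂)).comp
    (algebraMap (Y₁Ring p π m a₁) (YRing p π m a₁ a₂))).toAlgebra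

instance : IsScalarTower (Y₁Ring p π m a₁) (YRing p π m a₁ a₂) (YGen p π m a₁ a₂) :=
  IsScalarTower.of_algebraMap_eq' rfl

instance : IsScalarTower (Y₁Ring p π m a₁) (Y₁Gen p π m a₁) (YGen p π m a₁ a₂) :=
  IsScalarTower.of_algebraMap_eq' rfl

instance : IsScalarTower A (Y₁Ring p π m a₁) (YGen p π m a₁ a₂) :=
  IsScalarTower.of_algebraMap_eq' (by
    rw [IsScalarTower.algebraMap_eq A (YRing p π m a₁ a₂) (YGen p π m a₁ a₂),
      IsScalarTower.algebraMap_eq A (Y₁Ring p π m a₁) (YRing p π m a₁ a₂),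
      IsScalarTower.algebraMap_eq (Y₁Ring p π m a₁) (YRing p π m a₁ a₂) (YGen p π m a₁ a₂),
      RingHom.comp_assoc])

/-- By transitivity of integrality `Y` is also the normalisation of `Y₁`, so the one-step
computation of a normalisation applies to the second layer. -/
instance : IsIntegralClosure (YRing p π m a₁ a₂) (Y₁Ring p π m a₁) (YGen p π m a₁ a₂) where
  algebraMap_injective := IsIntegralClosure.algebraMap_injective _ A _
  isIntegral_iff {x} := by
    have : Algebra.IsIntegral A (Y₁Ring p π m a₁) :=
      IsIntegralClosure.isIntegral_algebra A (Y₁Gen p π m a₁)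
    rw [← IsIntegralClosure.isIntegral_iff (R := A) (A := YRing p π m a₁ a₂)]
    exact ⟨fun h => isIntegral_trans (R := A) x h, fun h => h.tower_top⟩

/-- The coordinate `T₁` of the intermediate cover. -/
def rootY₁ : Y₁Gen p π m a₁ := AdjoinRoot.root _

/-- The coordinate `T₂`. -/
def T₂ : YGen p π m a₁ a₂ := Ideal.Quotient.mk (wittIdeal p π m a₁ a₂) (MvPolynomial.X 1)

omit [Fact p.Prime] in
theorem adjoinsRoot_rootY₁ :
    AdjoinsRoot (asPoly p 1 (wittEntry p π m a₁)) (rootY₁ p π m a₁) := by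
  have h : asPoly p 1 (wittEntry p π m a₁) = X ^ p - X - Polynomial.C (wittEntry p π m a₁) := by
    rw [asPoly, map_one]; ring
  rw [h]
  exact AdjoinRoot.adjoinsRoot _

theorem algebraMap_rootY₁ :
    algebraMap (Y₁Gen p π m a₁) (YGen p π m a₁ a₂) (rootY₁ p π m a₁) = T₁ p π m a₁ a₂ :=
  AdjoinRoot.liftAlgHom_root ..

/-- The right-hand side of the equation `T₂ ^ p - T₂ = a₂ - Q(π ^ (-pm) a₁, T₁)`. -/
def secondEntry : Y₁Gen p π m a₁ :=
  algebraMap A _ a₂ - wittQ p (algebraMap _ _ (wittEntry p π m a₁)) (rootY₁ p π m a₁)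

theorem T₂_pow_sub : T₂ p π m a₁ a₂ ^ p - T₂ p π m a₁ a₂ +
    wittQ p (algebraMap _ _ (wittEntry p π m a₁)) (T₁ p π m a₁ a₂) = algebraMap A _ a₂ := by
  have h : (wittFrobSub p (GenericFibre π A)).coeff 1 -
      MvPolynomial.C (algebraMap A _ a₂) ∈ wittIdeal p π m a₁ a₂ :=
    Ideal.subset_span (by simp)
  rw [wittFrobSub_coeff_one, ← Ideal.Quotient.eq_zero_iff_mem, map_sub, map_add, map_wittQ,
    map_sub, map_sub, map_pow, map_pow] at h
  have h1 := sub_eq_zero.mp (T₁_eq p π m a₁ a₂)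
  change T₂ p π m a₁ a₂ ^ p - T₂ p π m a₁ a₂ +
    wittQ p (T₁ p π m a₁ a₂ ^ p - T₁ p π m a₁ a₂) (T₁ p π m a₁ a₂) - algebraMap A _ a₂ = 0 at h
  rw [h1] at h
  exact sub_eq_zero.mp h

/-- Maps from the ring of the cover. -/
def YGen.lift {S : Type*} [CommRing S] [Algebra (GenericFibre π A) S] (t₁ t₂ : S)
    (h₁ : t₁ ^ p - t₁ = algebraMap (GenericFibre π A) S (wittEntry p π m a₁))
    (h₂ : t₂ ^ p - t₂ + wittQ p (t₁ ^ p - t₁) t₁ =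
      algebraMap (GenericFibre π A) S (algebraMap A _ a₂)) :
    YGen p π m a₁ a₂ →ₐ[GenericFibre π A] S :=
  Ideal.Quotient.liftₐ (wittIdeal p π m a₁ a₂) (MvPolynomial.aeval ![t₁, t₂]) (by
    intro x hx
    rw [← RingHom.mem_ker]
    revert x
    change wittIdeal p π m a₁ a₂ ≤ _
    rw [wittIdeal, Ideal.span_le]
    rintro x (rfl | rfl)
    · simp [wittFrobSub_coeff_zero, h₁, RingHom.mem_ker]
    · simp [wittFrobSub_coeff_one, map_wittQ, h₂, RingHom.mem_ker])

theorem YGen.lift_T₁ {S : Type*} [CommRing S] [Algebra (GenericFibre π A) S] (t₁ t₂ : S) (h₁ h₂) :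
    YGen.lift p π m a₁ a₂ t₁ t₂ h₁ h₂ (T₁ p π m a₁ a₂) = t₁ := by
  change MvPolynomial.aeval ![t₁, t₂] (MvPolynomial.X 0) = t₁
  simp

theorem YGen.lift_T₂ {S : Type*} [CommRing S] [Algebra (GenericFibre π A) S] (t₁ t₂ : S) (h₁ h₂) :
    YGen.lift p π m a₁ a₂ t₁ t₂ h₁ h₂ (T₂ p π m a₁ a₂) = t₂ := by
  change MvPolynomial.aeval ![t₁, t₂] (MvPolynomial.X 1) = t₂
  simp

variable {p π m a₁ a₂} in
theorem YGen.algHom_ext {S : Type*} [CommRing S] [Algebra (GenericFibre π A) S]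
    {φ ψ : YGen p π m a₁ a₂ →ₐ[GenericFibre π A] S}
    (h₁ : φ (T₁ p π m a₁ a₂) = ψ (T₁ p π m a₁ a₂))
    (h₂ : φ (T₂ p π m a₁ a₂) = ψ (T₂ p π m a₁ a₂)) : φ = ψ := by
  refine Ideal.Quotient.algHom_ext _ (MvPolynomial.algHom_ext fun i => ?_)
  fin_cases i
  · exact h₁
  · exact h₂

/-- Once `T₁^p - T₁` has been replaced by `w`, the second Witt entry is an Artin–Schreier equation
for `T₂` over the first layer. The absence of other relations follows from the universal property of
the Witt equations, which gives a map to the abstract extension. -/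
theorem adjoinsRoot_T₂ :
    AdjoinsRoot (asPoly p 1 (secondEntry p π m a₁ a₂)) (T₂ p π m a₁ a₂) := by
  have hr := (AdjoinRoot.adjoinsRoot (asPoly p 1 (secondEntry p π m a₁ a₂))).root_pow
  have h1 := (adjoinsRoot_rootY₁ p π m a₁).root_pow
  rw [map_one, one_mul] at h1
  let ψ : YGen p π m a₁ a₂ →ₐ[GenericFibre π A]
      AdjoinRoot (asPoly p 1 (secondEntry p π m a₁ a₂)) :=
    YGen.lift p π m a₁ a₂ (algebraMap _ _ (rootY₁ p π m a₁))
      (AdjoinRoot.root _)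
      (by rw [← map_pow, h1, map_add, add_sub_cancel_left, ← IsScalarTower.algebraMap_apply])
      (by
        have hs : algebraMap _ (AdjoinRoot (asPoly p 1 (secondEntry p π m a₁ a₂)))
            (secondEntry p π m a₁ a₂) = algebraMap _ _ (algebraMap A (Y₁Gen p π m a₁) a₂) -
              algebraMap _ _ (wittQ p (algebraMap _ _ (wittEntry p π m a₁)) (rootY₁ p π m a₁)) :=
          map_sub _ _ _
        rw [← map_pow, ← map_sub, ← map_wittQ, h1, add_sub_cancel_left, hr, hs, map_one, one_mul,
          IsScalarTower.algebraMap_apply A (GenericFibre π A) (Y₁Gen p π m a₁),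
          ← IsScalarTower.algebraMap_apply (GenericFibre π A)]
        ring)
  have hψ : (ψ.comp (towerGen p π m a₁ a₂)) =
      IsScalarTower.toAlgHom (GenericFibre π A) (Y₁Gen p π m a₁)
        (AdjoinRoot (asPoly p 1 (secondEntry p π m a₁ a₂))) := by
    apply (adjoinsRoot_rootY₁ p π m a₁).algHom_ext
    rw [AlgHom.comp_apply]
    have : towerGen p π m a₁ a₂ (rootY₁ p π m a₁) = T₁ p π m a₁ a₂ := algebraMap_rootY₁ ..
    rw [this, YGen.lift_T₁]
    rfl
  let ψ' : YGen p π m a₁ a₂ →ₐ[Y₁Gen p π m a₁]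
      AdjoinRoot (asPoly p 1 (secondEntry p π m a₁ a₂)) :=
    { ψ with commutes' := fun y => AlgHom.congr_fun hψ y }
  have hψ₂ : ψ (T₂ p π m a₁ a₂) = AdjoinRoot.root _ := by rw [YGen.lift_T₂]
  refine .mk' (fun d => ?_) ?_ ψ' hψ₂
  · obtain ⟨q, rfl⟩ := Ideal.Quotient.mk_surjective d
    induction q using MvPolynomial.induction_on with
    | C s =>
      refine ⟨Polynomial.C (algebraMap _ _ s), ?_⟩
      rw [aeval_C, ← IsScalarTower.algebraMap_apply]
      rfl
    | add q r hq hr =>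
      obtain ⟨q', hq⟩ := hq
      obtain ⟨r', hr⟩ := hr
      exact ⟨q' + r', by rw [map_add, map_add, hq, hr]; rfl⟩
    | mul_X q i hq =>
      obtain ⟨q', hq⟩ := hq
      fin_cases i
      · refine ⟨q' * Polynomial.C (rootY₁ p π m a₁), ?_⟩
        rw [map_mul, map_mul, hq, aeval_C, algebraMap_rootY₁]
        rfl
      · refine ⟨q' * X, ?_⟩
        rw [map_mul, map_mul, hq, aeval_X]
        rfl
  · have h := T₂_pow_sub p π m a₁ a₂
    rw [aeval_asPoly, secondEntry, map_sub, map_wittQ, algebraMap_rootY₁,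
      ← IsScalarTower.algebraMap_apply, ← IsScalarTower.algebraMap_apply, map_one, one_mul]
    linear_combination h

omit [Fact p.Prime] in
theorem mul_wittEntry : algebraMap A (GenericFibre π A) a₁ =
    algebraMap A (GenericFibre π A) (algebraMap R A π) ^ (p * m) * wittEntry p π m a₁ := by
  rw [wittEntry, ← mul_assoc, ← mul_pow, IsLocalization.Away.mul_invSelf, one_pow, one_mul]

end CoverStructure

/-! ### Reductions of the two equations modulo the uniformiser -/

section SpecialFibres

open Polynomial

/-- The hypothesis says that `a` has no `p`-th root in the fraction field, so `X^p - a` is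
irreducible there; divisibility by a monic polynomial can be tested over the fraction field. -/
theorem prime_asPoly_zero {p : ℕ} [Fact p.Prime] {C : Type*} [CommRing C] [IsDomain C] {a : C}
    (ha : ∀ b c : C, c ≠ 0 → b ^ p ≠ a * c ^ p) : Prime (asPoly p 0 a) := by
  have hp : p.Prime := Fact.out
  have hm : (asPoly p 0 a).Monic := asPoly_monic hp.one_lt 0 a
  have hinj := FaithfulSMul.algebraMap_injective C (FractionRing C)
  have hirr : Prime ((asPoly p 0 a).map (algebraMap C (FractionRing C))) := by
    rw [map_asPoly, map_zero, asPoly, map_zero, zero_mul, zero_add]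
    refine (X_pow_sub_C_irreducible_of_prime hp fun b hb => ?_).prime
    obtain ⟨x, y, hy, rfl⟩ := IsFractionRing.div_surjective (A := C) b
    refine ha x y (nonZeroDivisors.ne_zero hy) (hinj ?_)
    have hy' : algebraMap C (FractionRing C) y ≠ 0 := by
      rw [map_ne_zero_iff _ hinj]; exact nonZeroDivisors.ne_zero hy
    rw [div_pow, div_eq_iff (pow_ne_zero _ hy')] at hb
    rw [map_pow, hb, map_mul, map_pow]
  refine ⟨hm.ne_zero, fun hu => hirr.not_isUnit (hu.map (mapRingHom _)), fun f g hfg => ?_⟩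
  simp only [← map_dvd_map (algebraMap C (FractionRing C)) hinj hm] at hfg ⊢
  rw [Polynomial.map_mul] at hfg
  exact hirr.dvd_or_dvd hfg

theorem dvd_iff_mk_eq_zero {C : Type*} [CommRing C] {ϖ x : C} :
    ϖ ∣ x ↔ Ideal.Quotient.mk (Ideal.span {ϖ}) x = 0 := by
  rw [Ideal.Quotient.eq_zero_iff_mem, Ideal.mem_span_singleton]

theorem isDomain_quotient_span_of_prime {C : Type*} [CommRing C] {ϖ : C} (h : Prime ϖ) :
    IsDomain (C ⧸ Ideal.span {ϖ}) :=
  have := (Ideal.span_singleton_prime h.ne_zero).mpr h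
  Ideal.Quotient.isDomain _

variable {p : ℕ} [Fact p.Prime] {C D : Type*} [CommRing C] [CommRing D] [Algebra C D] {ϖ c g : C}
  {z : D}

/-- Frobenius is additive and `z^p ≡ g` modulo `ϖ`: the special fibre of the extension is purely
inseparable of exponent one. -/
theorem AdjoinsRoot.exists_dvd_pow_sub (h : AdjoinsRoot (asPoly p c g) z) (hc : ϖ ∣ c)
    (hp : (p : D) = 0) (d : D) : ∃ α : C, algebraMap C D ϖ ∣ d ^ p - algebraMap C D α := by
  obtain ⟨c, rfl⟩ := hc
  obtain ⟨q, rfl⟩ := h.surjective d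
  induction q using Polynomial.induction_on with
  | C a => exact ⟨a ^ p, by simp⟩
  | add q r hq hr =>
    obtain ⟨α, hα⟩ := hq
    obtain ⟨β, hβ⟩ := hr
    refine ⟨α + β, ?_⟩
    rw [map_add, add_pow_of_natCast_eq_zero Fact.out hp, map_add, add_sub_add_comm]
    exact dvd_add hα hβ
  | monomial n a hn =>
    obtain ⟨α, y, hα⟩ := hn
    refine ⟨α * g, algebraMap C D c * z * (aeval z (Polynomial.C a * X ^ n)) ^ p +
      y * algebraMap C D g, ?_⟩
    have hz := h.root_pow
    have hs : aeval z (Polynomial.C a * X ^ (n + 1)) = aeval z (Polynomial.C a * X ^ n) * z := by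
      rw [pow_succ, ← mul_assoc, map_mul _ _ X, aeval_X]
    rw [hs, mul_pow, hz, map_mul (algebraMap C D) ϖ, map_mul (algebraMap C D) α]
    linear_combination (algebraMap C D g) * hα

/-- The `p`-th powers of `b` and `d` come from the base modulo `ϖ`, so a relation `b^p = g' d^p`
would be a linear relation for `z̄` with leading coefficient `ḡ^(p-1) d̄^p`. But `z̄` has degree `p
> 1`, and neither `ḡ` nor `d̄` is zero. -/
theorem AdjoinsRoot.pow_ne_mul_pow (h : AdjoinsRoot (asPoly p c g) z) (hc : ϖ ∣ c)
    (hp : (p : D) = 0) [IsDomain (C ⧸ Ideal.span {ϖ})]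
    [IsDomain (D ⧸ Ideal.span {algebraMap C D ϖ})] (hp2 : 2 ≤ p) (hg : ¬ ϖ ∣ g) {g' : D}
    (hg' : algebraMap C D ϖ ∣ g' + algebraMap C D g ^ (p - 1) * z)
    (b d : D ⧸ Ideal.span {algebraMap C D ϖ}) (hd : d ≠ 0) :
    b ^ p ≠ Ideal.Quotient.mk _ g' * d ^ p := by
  obtain ⟨b, rfl⟩ := Ideal.Quotient.mk_surjective b
  obtain ⟨d, rfl⟩ := Ideal.Quotient.mk_surjective d
  intro hbd
  obtain ⟨α, hα⟩ := h.exists_dvd_pow_sub hc hp b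
  obtain ⟨β, hβ⟩ := h.exists_dvd_pow_sub hc hp d
  rw [dvd_iff_mk_eq_zero, map_sub, sub_eq_zero] at hα hβ
  rw [dvd_iff_mk_eq_zero, map_add, add_eq_zero_iff_eq_neg] at hg'
  rw [← map_pow, ← map_pow, hα, hg', hβ, ← sub_eq_zero, ← map_neg, ← map_mul, ← map_sub,
    ← dvd_iff_mk_eq_zero] at hbd
  have h2 : algebraMap C D ϖ ∣
      aeval z (Polynomial.C (g ^ (p - 1) * β) * X + Polynomial.C α : C[X]) := by
    convert hbd using 1
    simp
    ring
  rw [h.dvd_aeval_iff] at h2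
  rw [map_asPoly, Polynomial.map_add, Polynomial.map_mul, Polynomial.map_C, Polynomial.map_C,
    Polynomial.map_X] at h2
  have h3 := eq_zero_of_dvd_of_natDegree_lt h2
    (by rw [natDegree_asPoly hp2]; exact natDegree_linear_le.trans_lt hp2)
  have h4 := congrArg (fun q => coeff q 1) h3
  rw [coeff_add, coeff_C_mul, coeff_X_one, coeff_C_succ, mul_one, add_zero, coeff_zero,
    map_mul, map_pow, mul_eq_zero] at h4
  rcases h4 with h4 | h4
  · exact hg (dvd_iff_mk_eq_zero.mpr (eq_zero_of_pow_eq_zero h4))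
  · apply hd
    have : Ideal.Quotient.mk (Ideal.span {algebraMap C D ϖ}) (d ^ p) = 0 := by
      rw [hβ, ← dvd_iff_mk_eq_zero]
      exact map_dvd _ (dvd_iff_mk_eq_zero.mpr h4)
    rw [map_pow] at this
    exact eq_zero_of_pow_eq_zero this

end SpecialFibres

/-! ### Pole order and leading term of the second Witt entry -/

section ScaledQ

variable (p : ℕ) {S : Type*} [CommRing S]

/-- The polynomial `wittQ` after the substitution `a = ϖ ^ (p * m) * w`, `z = ϖ ^ m * t`, with
denominators cleared. -/
def scaledWittQ (ϖ : S) (m : ℕ) (a z : S) : S :=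
  ∑ k ∈ Finset.Ioo 0 p, ((p.choose k / p : ℕ) : S) * ϖ ^ (m * (p - 1) * (p - 1 - k)) *
    a ^ k * z ^ (p - k)

theorem map_scaledWittQ {S' F : Type*} [CommRing S'] [FunLike F S S']
    [RingHomClass F S S'] (φ : F) (ϖ : S) (m : ℕ) (a z : S) :
    φ (scaledWittQ p ϖ m a z) = scaledWittQ p (φ ϖ) m (φ a) (φ z) := by
  simp [scaledWittQ]

/-- The monomial `w^k t^(p-k)` absorbs `pmk + m(p-k)` factors `ϖ`; the remaining `m(p-1)(p-1-k)`
stay as its coefficient. -/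
theorem scaledWittQ_mul (ϖ : S) (m : ℕ) (w t : S) :
    scaledWittQ p ϖ m (ϖ ^ (p * m) * w) (ϖ ^ m * t) =
      ϖ ^ (m * (p * (p - 1) + 1)) * wittQ p w t := by
  rw [scaledWittQ, wittQ, Finset.mul_sum]
  refine Finset.sum_congr rfl fun k hk => ?_
  obtain ⟨hk0, hkp⟩ := Finset.mem_Ioo.mp hk
  have he : m * (p * (p - 1) + 1) = m * (p - 1) * (p - 1 - k) + p * m * k + m * (p - k) := by
    obtain ⟨j, rfl⟩ : ∃ j, p = k + 1 + j := ⟨p - k - 1, by omega⟩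
    have h1 : k + 1 + j - 1 = k + j := by omega
    have h2 : k + j - k = j := by omega
    have h3 : k + 1 + j - k = j + 1 := by omega
    rw [h1, h2, h3]
    ring
  rw [he, pow_add, pow_add, mul_pow, mul_pow, ← pow_mul, ← pow_mul]
  ring

/-- Only the term `k = p - 1` keeps no factor `ϖ`, and its coefficient is `p.choose (p - 1) / p =
1`. -/
theorem dvd_scaledWittQ_sub [Fact p.Prime] (ϖ : S) {m : ℕ} (hm : 0 < m) (a z : S) :
    ϖ ∣ scaledWittQ p ϖ m a z - a ^ (p - 1) * z := by
  have hp : p.Prime := Fact.out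
  have hp1 : 0 < p - 1 := Nat.sub_pos_of_lt hp.one_lt
  rw [scaledWittQ, ← Finset.add_sum_erase _ _ (Finset.mem_Ioo.mpr ⟨hp1, Nat.sub_lt hp.pos one_pos⟩)]
  have h1 : p.choose (p - 1) / p = 1 := by
    rw [Nat.choose_symm hp.one_le, Nat.choose_one_right, Nat.div_self hp.pos]
  rw [h1, Nat.sub_self, mul_zero, pow_zero, Nat.sub_sub_self hp.one_le]
  have h2 : ((1 : ℕ) : S) * 1 * a ^ (p - 1) * z ^ 1 = a ^ (p - 1) * z := by simp
  rw [h2, add_sub_cancel_left]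
  refine Finset.dvd_sum fun k hk => ?_
  rw [Finset.mem_erase, Finset.mem_Ioo] at hk
  refine Dvd.dvd.mul_right (Dvd.dvd.mul_right (Dvd.dvd.mul_left (dvd_pow_self ϖ ?_) _) _) _
  have : p - 1 - k ≠ 0 := by omega
  positivity

end ScaledQ

/-! ### Equations for the normalised covers -/

section Normalisation

open Polynomial

theorem AdjoinsRoot.algebraMap_injective {C D : Type*} [CommRing C] [CommRing D] [Algebra C D]
    {f : C[X]} {z : D} (h : AdjoinsRoot f z) (hf : f.Monic) (hd : 0 < f.natDegree) :
    Function.Injective (algebraMap C D) := by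
  refine (injective_iff_map_eq_zero _).mpr fun c hc => ?_
  rw [← aeval_C z, h.aeval_eq_zero_iff] at hc
  by_contra h0
  exact hf.not_dvd_of_natDegree_lt (C_ne_zero.mpr h0) (by rwa [natDegree_C]) hc

theorem mk_eq_asPoly_zero {C : Type*} [CommRing C] (p : ℕ) {ϖ c g : C} (hc : ϖ ∣ c) :
    (asPoly p c g).map (Ideal.Quotient.mk (Ideal.span {ϖ})) =
      asPoly p 0 (Ideal.Quotient.mk (Ideal.span {ϖ}) g) := by
  rw [map_asPoly, dvd_iff_mk_eq_zero.mp hc]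

variable {R : Type u} [CommRing R] (p : ℕ) [Fact p.Prime] (π : R) (m : ℕ)
  {A : Type v} [CommRing A] [Algebra R A] (a₁ a₂ : A)

/-- The right-hand side of the equation of the second layer of the normalised tower. -/
def secondRhs (z₁ : Y₁Ring p π m a₁) : Y₁Ring p π m a₁ :=
  algebraMap A _ (algebraMap R A π ^ (m * (p * (p - 1) + 1)) * a₂) -
    scaledWittQ p (algebraMap A _ (algebraMap R A π)) m (algebraMap A _ a₁) z₁

variable {p π m a₁}

omit [Fact p.Prime] in
theorem algebraMap_secondRhs {z₁ : Y₁Ring p π m a₁} (hz : algebraMap _ (Y₁Gen p π m a₁) z₁ =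
    algebraMap A _ (algebraMap R A π) ^ m * rootY₁ p π m a₁) :
    algebraMap _ (Y₁Gen p π m a₁) (secondRhs p π m a₁ a₂ z₁) =
      algebraMap _ _ (algebraMap A (Y₁Ring p π m a₁) (algebraMap R A π)) ^
        (m * (p * (p - 1) + 1)) * secondEntry p π m a₁ a₂ := by
  have ha := congrArg (algebraMap _ (Y₁Gen p π m a₁)) (mul_wittEntry p π m a₁)
  rw [map_mul, map_pow, ← IsScalarTower.algebraMap_apply, ← IsScalarTower.algebraMap_apply] at ha
  rw [secondRhs, map_sub, map_scaledWittQ, hz]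
  simp only [← IsScalarTower.algebraMap_apply A (Y₁Ring p π m a₁) (Y₁Gen p π m a₁)]
  rw [ha, scaledWittQ_mul, secondEntry, map_mul, map_pow]
  ring

theorem dvd_secondRhs_add (hm : 0 < m) (z₁ : Y₁Ring p π m a₁) :
    algebraMap A (Y₁Ring p π m a₁) (algebraMap R A π) ∣
      secondRhs p π m a₁ a₂ z₁ + algebraMap A _ a₁ ^ (p - 1) * z₁ := by
  have h1 := dvd_scaledWittQ_sub p (algebraMap A (Y₁Ring p π m a₁) (algebraMap R A π)) hm
    (algebraMap A _ a₁) z₁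
  have h2 : algebraMap A (Y₁Ring p π m a₁) (algebraMap R A π) ∣
      algebraMap A _ (algebraMap R A π ^ (m * (p * (p - 1) + 1)) * a₂) :=
    map_dvd _ (Dvd.dvd.mul_right (dvd_pow_self _ (by positivity)) _)
  convert dvd_sub h2 h1 using 1
  rw [secondRhs]
  ring

variable (p π m a₁) in
/-- The normalised covers `Y → Y₁ → X`, by equations. -/
structure CoverEquations (mt : ℕ) (z₁ : Y₁Ring p π m a₁) (z₂ : YRing p π m a₁ a₂) : Prop where
  algebraMap_z₁ : algebraMap _ (Y₁Gen p π m a₁) z₁ =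
    algebraMap A _ (algebraMap R A π) ^ m * rootY₁ p π m a₁
  algebraMap_z₂ : algebraMap _ (YGen p π m a₁ a₂) z₂ =
    algebraMap A _ (algebraMap R A π) ^ mt * T₂ p π m a₁ a₂
  adjoinsRoot_z₁ : AdjoinsRoot (asPoly p (algebraMap R A (π ^ ((p - 1) * m))) a₁) z₁
  adjoinsRoot_z₂ : AdjoinsRoot (asPoly p (algebraMap R (Y₁Ring p π m a₁) (π ^ ((p - 1) * mt)))
    (secondRhs p π m a₁ a₂ z₁)) z₂
  prime₁ : Prime (algebraMap A (Y₁Ring p π m a₁) (algebraMap R A π))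
  prime₂ : Prime (algebraMap A (YRing p π m a₁ a₂) (algebraMap R A π))
  isLocalization₁ : IsLocalization.Away (algebraMap A (Y₁Ring p π m a₁) (algebraMap R A π))
    (Y₁Gen p π m a₁)
  isLocalization₂ : IsLocalization.Away (algebraMap A (YRing p π m a₁ a₂) (algebraMap R A π))
    (YGen p π m a₁ a₂)

/-- The computation of the normalisation is applied twice, with reductions `X^p - ā₁` and `X^p +
ā₁^(p-1) z̄₁`. The pole order `m(p(p-1)+1)` of the second entry has to be a multiple `p mt` for `T₂`
to be rescaled by an integral power of `π`; this is where `p ∣ m` is needed. -/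
theorem exists_coverEquations [CharP R p] [IsDomain (SpecialFibre π A)]
    (hreg : algebraMap R A π ∈ nonZeroDivisors A)
    (ha₁ : ∀ b c : SpecialFibre π A, c ≠ 0 → b ^ p ≠ Ideal.Quotient.mk _ a₁ * c ^ p)
    {mt : ℕ} (hm : 0 < m) (hmt : m * (p * (p - 1) + 1) = p * mt) :
    ∃ z₁ z₂, CoverEquations p π m a₁ a₂ mt z₁ z₂ := by
  have hp : p.Prime := Fact.out
  have hp1 : 0 < p - 1 := Nat.sub_pos_of_lt hp.one_lt
  have hmt0 : 0 < mt := by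
    rcases Nat.eq_zero_or_pos mt with rfl | h
    · have : 0 < m * (p * (p - 1) + 1) := by positivity
      omega
    · exact h
  have hc : algebraMap R A π ∣ algebraMap R A π ^ ((p - 1) * m) := dvd_pow_self _ (by positivity)
  have hA0 : algebraMap R A π ≠ 0 := by
    intro h0
    rw [h0] at hreg
    have := (mem_nonZeroDivisors_iff.mp hreg).1 1 (by simp)
    have : Subsingleton A := subsingleton_of_zero_eq_one this.symm
    exact one_ne_zero (α := SpecialFibre π A) (Subsingleton.elim _ _)
  obtain ⟨z₁, hz₁, h₁⟩ := adjoinsRoot_of_isIntegralClosure (E := Y₁Ring p π m a₁) (n := m)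
    hp.one_lt hreg (adjoinsRoot_rootY₁ p π m a₁) (mul_wittEntry p π m a₁)
    (by rw [mk_eq_asPoly_zero p hc]; exact (prime_asPoly_zero ha₁).isRadical)
  have hmon₁ := asPoly_monic hp.one_lt (algebraMap R A π ^ ((p - 1) * m)) a₁
  have hreg₁ : algebraMap A (Y₁Ring p π m a₁) (algebraMap R A π) ∈ nonZeroDivisors _ := by
    have hinj : Function.Injective (algebraMap (Y₁Ring p π m a₁) (Y₁Gen p π m a₁)) :=
      IsIntegralClosure.algebraMap_injective _ A _
    have hu : IsUnit (algebraMap A (Y₁Gen p π m a₁) (algebraMap R A π)) := by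
      rw [IsScalarTower.algebraMap_apply A (GenericFibre π A)]
      exact (IsLocalization.Away.algebraMap_isUnit _).map _
    refine mem_nonZeroDivisors_iff_right.mpr fun x hx => hinj ?_
    have h2 := congrArg (algebraMap (Y₁Ring p π m a₁) (Y₁Gen p π m a₁)) hx
    rw [map_mul, ← IsScalarTower.algebraMap_apply, map_zero] at h2
    rw [map_zero]
    exact hu.mul_left_eq_zero.mp h2
  have : Nontrivial A := ⟨_, _, hA0⟩
  have hinj₁ := h₁.algebraMap_injective hmon₁ (by rw [natDegree_asPoly hp.one_lt]; exact hp.pos)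
  have : Nontrivial (Y₁Ring p π m a₁) := hinj₁.nontrivial
  have hprime₁ : Prime (algebraMap A (Y₁Ring p π m a₁) (algebraMap R A π)) :=
    h₁.prime_algebraMap (by rw [mk_eq_asPoly_zero p hc]; exact prime_asPoly_zero ha₁)
      (nonZeroDivisors.ne_zero hreg₁)
  have hloc := isLocalization_away_of_isIntegralClosure (adjoinsRoot_rootY₁ p π m a₁) hz₁
  have := isDomain_quotient_span_of_prime hprime₁
  have hpC : (p : Y₁Ring p π m a₁) = 0 := natCast_eq_zero_of_algebra R p
  have hna : ¬ algebraMap R A π ∣ a₁ := by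
    intro h
    rw [dvd_iff_mk_eq_zero] at h
    exact ha₁ 0 1 one_ne_zero (by rw [h, zero_mul, zero_pow hp.ne_zero])
  -- The second right-hand side is `-a₁^(p-1) z₁` modulo `π`, which is not a `p`-th power even in
  -- fractions.
  have hg₂ := h₁.pow_ne_mul_pow hc hpC hp.two_le hna (dvd_secondRhs_add a₂ hm z₁)
  have hc₂ : algebraMap A (Y₁Ring p π m a₁) (algebraMap R A π) ∣
      algebraMap A (Y₁Ring p π m a₁) (algebraMap R A π) ^ ((p - 1) * mt) :=
    dvd_pow_self _ (by positivity)
  have hpr := prime_asPoly_zero hg₂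
  have hw := algebraMap_secondRhs a₂ hz₁
  rw [hmt] at hw
  obtain ⟨z₂, hz₂, h₂⟩ := adjoinsRoot_of_isIntegralClosure (E := YRing p π m a₁ a₂) (n := mt)
    hp.one_lt hreg₁ (adjoinsRoot_T₂ p π m a₁ a₂) hw
    (by rw [mk_eq_asPoly_zero p hc₂]; exact hpr.isRadical)
  have hloc₂ := isLocalization_away_of_isIntegralClosure (adjoinsRoot_T₂ p π m a₁ a₂) hz₂
  rw [← IsScalarTower.algebraMap_apply] at hz₂ hloc₂
  refine ⟨z₁, z₂, hz₁, hz₂, ?_, ?_, hprime₁, ?_, hloc, hloc₂⟩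
  · rwa [map_pow]
  · rwa [IsScalarTower.algebraMap_apply R A, map_pow, map_pow]
  · rw [IsScalarTower.algebraMap_apply A (Y₁Ring p π m a₁)]
    refine h₂.prime_algebraMap (by rwa [mk_eq_asPoly_zero p hc₂]) ?_
    have hinj₂ := h₂.algebraMap_injective (asPoly_monic hp.one_lt _ _)
      (by rw [natDegree_asPoly hp.one_lt]; exact hp.pos)
    exact (map_ne_zero_iff _ hinj₂).mpr (nonZeroDivisors.ne_zero hreg₁)

end Normalisation

/-! ### The `p`-power map of a commutative group in a polynomial coordinate -/

section PowerMap

theorem MvPolynomial.derivative_aeval_X {σ B : Type*} [Fintype σ] [CommRing B]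
    (P : MvPolynomial σ B) :
    Polynomial.derivative (MvPolynomial.aeval (fun _ : σ => (Polynomial.X : Polynomial B)) P) =
      ∑ i, MvPolynomial.aeval (fun _ : σ => (Polynomial.X : Polynomial B)) (pderiv i P) := by
  classical
  induction P using MvPolynomial.induction_on with
  | C a => simp
  | add P Q hP hQ => simp [hP, hQ, Finset.sum_add_distrib]
  | mul_X P i hP =>
    simp [hP, Pi.single_apply, Finset.sum_add_distrib, Finset.mul_sum, apply_ite, mul_comm]

/-- A function on a finite commutative group that separates points, and in terms of which
multiplication is polynomial up to a constant, has a `p`-power map that is polynomial in the `p`-th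
power of the function. -/
theorem exists_polynomial_eval_pow {p : ℕ} [Fact p.Prime] {B N : Type*} [CommRing B] [IsDomain B]
    [CharP B p] [CommGroup N] [Fintype N] {u : N → B} (hu : Function.Injective u) {D : B}
    {M : ℕ} (hM : M ≤ Fintype.card N) (β : (Fin p → Fin M) → B)
    (hβ : ∀ g : Fin p → N, D * u (∏ i, g i) = ∑ k, β k * ∏ i, u (g i) ^ (k i : ℕ)) :
    ∃ φ : Polynomial B, ∀ g, D * u (g ^ p) = φ.eval (u g ^ p) := by
  classical
  have hp : p.Prime := Fact.out
  let P : MvPolynomial (Fin p) B := ∑ k, MvPolynomial.C (β k) * ∏ i, MvPolynomial.X i ^ (k i : ℕ)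
  have hP : ∀ g : Fin p → N, MvPolynomial.eval (fun i => u (g i)) P = D * u (∏ i, g i) := by
    intro g; rw [hβ]; simp [P]
  have hMpos : 0 < M ∨ P = 0 := by
    rcases Nat.eq_zero_or_pos M with rfl | h
    · right
      have : IsEmpty (Fin p → Fin 0) := ⟨fun k => (k ⟨0, hp.pos⟩).elim0⟩
      simp [P]
    · exact .inl h
  have hdeg : ∀ i, P.degreeOf i < Fintype.card N := by
    intro i
    rcases hMpos with h | h
    · refine lt_of_lt_of_le ?_ hM
      have h1 : P.degreeOf i ≤ M - 1 := by
        refine (MvPolynomial.degreeOf_sum_le _ _ _).trans (Finset.sup_le fun k _ => ?_)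
        refine (MvPolynomial.degreeOf_C_mul_le _ _ _).trans ?_
        refine (MvPolynomial.degreeOf_prod_le _ _ _).trans ?_
        rw [Finset.sum_eq_single i]
        · refine (MvPolynomial.degreeOf_pow_le _ _ _).trans ?_
          rw [MvPolynomial.degreeOf_X, if_pos rfl]
          have := (k i).2
          omega
        · intro j _ hj
          rw [← Nat.le_zero]
          refine (MvPolynomial.degreeOf_pow_le _ _ _).trans ?_
          rw [MvPolynomial.degreeOf_X, if_neg hj.symm, mul_zero]
        · simp
      omega
    · rw [h, MvPolynomial.degreeOf_zero]; exact Fintype.card_pos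
  -- By commutativity `P` and its permutations agree on the grid `u(N)^p`. Their degree in each
  -- variable is less than the size of `u(N)`, so they are equal.
  have hsymm : ∀ e : Equiv.Perm (Fin p), MvPolynomial.rename e P = P := by
    intro e
    rw [← sub_eq_zero]
    refine MvPolynomial.eq_zero_of_eval_zero_at_prod_finset _ (fun _ => Finset.univ.image u)
      (fun i => ?_) fun x hx => ?_
    · rw [Finset.card_image_of_injective _ hu, Finset.card_univ]
      refine (MvPolynomial.degreeOf_sub_le _ _ _).trans_lt (max_lt ?_ (hdeg i))
      obtain ⟨j, rfl⟩ := e.surjective i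
      rw [MvPolynomial.degreeOf_rename_of_injective e.injective]
      exact hdeg j
    · simp only [Finset.mem_image, Finset.mem_univ, true_and] at hx
      choose g hg using hx
      obtain rfl : (fun i => u (g i)) = x := funext hg
      rw [map_sub, MvPolynomial.eval_rename, hP]
      change MvPolynomial.eval (fun i => u ((g ∘ e) i)) P - _ = 0
      rw [hP, sub_eq_zero]
      congr 2
      exact Equiv.prod_comp e g
  let G := MvPolynomial.aeval (fun _ : Fin p => (Polynomial.X : Polynomial B)) P
  -- The derivative along the diagonal is the sum of the `p` partial derivatives, which coincide
  -- there by symmetry; so it is `p` times one of them. Hence `G` is a polynomial in `X^p`.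
  have hG : Polynomial.derivative G = 0 := by
    have i₀ : Fin p := ⟨0, hp.pos⟩
    have h : ∀ i, MvPolynomial.aeval (fun _ : Fin p => (Polynomial.X : Polynomial B))
        (MvPolynomial.pderiv i P) = MvPolynomial.aeval
          (fun _ : Fin p => (Polynomial.X : Polynomial B)) (MvPolynomial.pderiv i₀ P) := by
      intro i
      let e := Equiv.swap i₀ i
      have he : e i₀ = i := Equiv.swap_apply_left _ _
      conv_lhs => rw [← hsymm e, ← he, MvPolynomial.pderiv_rename e.injective,
        MvPolynomial.aeval_rename]
      rfl
    rw [MvPolynomial.derivative_aeval_X, Finset.sum_congr rfl fun i _ => h i]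
    simp
  refine ⟨Polynomial.contract p G, fun g => ?_⟩
  have h1 : G.eval (u g) = D * u (g ^ p) := by
    have := hP fun _ => g
    rw [Finset.prod_const, Finset.card_univ, Fintype.card_fin] at this
    have h2 : (Polynomial.aeval (u g)).comp
        (MvPolynomial.aeval (fun _ : Fin p => (Polynomial.X : Polynomial B))) =
          (MvPolynomial.aeval fun _ => u g : MvPolynomial (Fin p) B →ₐ[B] B) :=
      MvPolynomial.algHom_ext (by simp)
    rw [← this, ← MvPolynomial.coe_aeval_eq_eval, ← Polynomial.coe_aeval_eq_eval]
    exact AlgHom.congr_fun h2 P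
  rw [← h1, ← Polynomial.expand_eval, Polynomial.expand_contract p hG hp.ne_zero]

end PowerMap

/-! ### Iterated comultiplication in a polynomial coordinate -/

section Convolution

open WithConv Coalgebra

variable {R H B : Type*} [CommRing R] [CommRing H] [HopfAlgebra R H] [CommRing B] [Algebra R B]

/-- Comultiplication splits off one factor at a time, each at the cost of one denominator `d`; the
degree in each variable stays below `M`, as the coordinate of each factor is used only once. -/
theorem exists_coeff_convProd {d : B} {M : ℕ} {u : WithConv (H →ₐ[R] B) → B}
    (hq : ∀ x : H, ∃ q : Fin M → B, ∀ g : WithConv (H →ₐ[R] B),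
      d * g x = ∑ k, q k * u g ^ (k : ℕ)) (n : ℕ) (x : H) :
    ∃ β : (Fin n → Fin M) → B, ∀ g : Fin n → WithConv (H →ₐ[R] B),
      d ^ n * (List.ofFn g).prod x = ∑ k, β k * ∏ i, u (g i) ^ (k i : ℕ) := by
  induction n generalizing x with
  | zero => exact ⟨fun _ => algebraMap R B (counit x), fun g => by simp [AlgHom.convOne_apply]⟩
  | succ n ih =>
    have key : ∀ t : H ⊗[R] H, ∃ β : (Fin (n + 1) → Fin M) → B,
        ∀ g : Fin (n + 1) → WithConv (H →ₐ[R] B), d ^ (n + 1) *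
          Algebra.TensorProduct.productMap (g 0).ofConv
            (List.ofFn fun i : Fin n => g i.succ).prod.ofConv t =
          ∑ k, β k * ∏ i, u (g i) ^ (k i : ℕ) := by
      intro t
      induction t with
      | zero => exact ⟨0, by simp⟩
      | add t t' ht ht' =>
        obtain ⟨β, hβ⟩ := ht
        obtain ⟨β', hβ'⟩ := ht'
        exact ⟨β + β', fun g => by
          simp only [map_add, mul_add, hβ, hβ', Pi.add_apply, add_mul, Finset.sum_add_distrib]⟩
      | tmul y z =>
        obtain ⟨q, hq⟩ := hq y
        obtain ⟨β, hβ⟩ := ih z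
        refine ⟨fun k => q (k 0) * β fun i => k i.succ, fun g => ?_⟩
        rw [← (Fin.consEquiv fun _ => Fin M).sum_comp, Fintype.sum_prod_type]
        simp only [Fin.consEquiv_apply, Fin.cons_zero, Fin.cons_succ, Fin.prod_univ_succ]
        have h1 := hq (g 0)
        have h2 := hβ fun i => g i.succ
        rw [Algebra.TensorProduct.productMap_apply_tmul]
        calc _ = (d * g 0 y) * (d ^ n * (List.ofFn fun i : Fin n => g i.succ).prod z) := by
              ring
          _ = _ := by
            rw [h1, h2, Finset.sum_mul_sum]
            exact Finset.sum_congr rfl fun i _ => Finset.sum_congr rfl fun j _ => by ring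
    obtain ⟨β, hβ⟩ := key (comul x)
    refine ⟨β, fun g => ?_⟩
    rw [← hβ, List.ofFn_succ, List.prod_cons, AlgHom.convMul_apply]
    rfl

end Convolution

/-! ### Norms of unipotent automorphisms of a plane -/

section UnipotentSum

/-- Over `𝔽_p` one has `1 + X + ⋯ + X^(p-1) = (X - 1)^(p-1)`. Here `T - 1` is nilpotent on a plane,
so its square vanishes, and `p - 1 ≥ 2`. -/
theorem sum_pow_eq_zero_of_finrank_eq_two {p : ℕ} [Fact p.Prime] (hp : 2 < p) {V : Type*}
    [AddCommGroup V] [Module (ZMod p) V] (hV : Module.finrank (ZMod p) V = 2)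
    {T : Module.End (ZMod p) V} {n : ℕ} (hT : T ^ p ^ n = 1) :
    ∑ i ∈ Finset.range p, T ^ i = 0 := by
  have hfin : FiniteDimensional (ZMod p) V := Module.finite_of_finrank_eq_succ hV
  have hpoly : ∑ i ∈ Finset.range p, (Polynomial.X : Polynomial (ZMod p)) ^ i =
      (Polynomial.X - 1) ^ (p - 1) := by
    have h0 : (Polynomial.X - 1 : Polynomial (ZMod p)) ≠ 0 := Polynomial.X_sub_C_ne_zero 1
    refine mul_right_cancel₀ h0 ?_
    rw [geom_sum_mul, ← pow_succ, Nat.sub_add_cancel (Fact.out : p.Prime).one_le, sub_pow_char,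
      one_pow]
  have hnil : (T - 1) ^ p ^ n = 0 := by
    have h : (Polynomial.X - 1 : Polynomial (ZMod p)) ^ p ^ n = Polynomial.X ^ p ^ n - 1 := by
      rw [sub_pow_char_pow, one_pow]
    simpa [hT] using congrArg (Polynomial.aeval T) h
  have h2 : (T - 1) ^ 2 = 0 := by
    rw [← LinearMap.ker_eq_top, ← hV,
      ← Module.End.ker_pow_eq_ker_pow_finrank_of_le (m := 2 + p ^ n) (by omega), pow_add, hnil,
      mul_zero, LinearMap.ker_zero]
  have h3 := congrArg (Polynomial.aeval T) hpoly
  rw [map_sum, map_pow] at h3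
  simp only [map_pow, Polynomial.aeval_X, map_sub, map_one] at h3
  rw [h3, show p - 1 = 2 + (p - 3) by omega, pow_add, h2, zero_mul]

theorem prod_iterate_eq_one {p : ℕ} [Fact p.Prime] (hp : 2 < p) {N : Type*} [CommGroup N]
    (hcard : Nat.card N = p ^ 2) (hexp : ∀ g : N, g ^ p = 1) {T : Monoid.End N} {n : ℕ}
    (hT : T ^ p ^ n = 1) (g : N) : ∏ i ∈ Finset.range p, (T ^ i) g = 1 := by
  let := AddCommGroup.zmodModule (n := p) (G := Additive N) hexp
  let T' : Module.End (ZMod p) (Additive N) := (MonoidHom.toAdditive T).toZModLinearMap p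
  have hpow : ∀ (i : ℕ) (x : N), (T' ^ i) (Additive.ofMul x) = Additive.ofMul ((T ^ i) x) := by
    intro i x
    induction i with
    | zero => rfl
    | succ i ih => rw [pow_succ', pow_succ', Module.End.mul_apply, ih]; rfl
  have hV : Module.finrank (ZMod p) (Additive N) = 2 := by
    have : Finite N := Nat.finite_of_card_ne_zero (by
      rw [hcard]; exact pow_ne_zero _ (Fact.out : p.Prime).ne_zero)
    have : Module.Finite (ZMod p) (Additive N) := Module.Finite.of_finite
    have h := Module.natCard_eq_pow_finrank (K := ZMod p) (V := Additive N)
    rw [Nat.card_zmod, Nat.card_congr Additive.toMul, hcard] at h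
    exact (Nat.pow_right_injective (Fact.out : p.Prime).two_le h).symm
  have h := sum_pow_eq_zero_of_finrank_eq_two hp hV (T := T') (n := n) (by
    ext x
    exact (hpow _ _).trans (by rw [hT]; rfl))
  have h2 := LinearMap.congr_fun h (Additive.ofMul g)
  rw [LinearMap.sum_apply, Finset.sum_congr rfl fun i _ => hpow i g] at h2
  exact h2

end UnipotentSum

/-! ### Sections of the group scheme as endomorphisms of the torsor -/

namespace TorsorStructure

open WithConv Coalgebra Algebra.TensorProduct

variable {R : Type u} [CommRing R] {H : Type w} [CommRing H] [HopfAlgebra R H]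
  {A : Type v} [CommRing A] [Algebra R A]
  {B : Type v} [CommRing B] [Algebra R B] [Algebra A B] [IsScalarTower R A B]

/-- Evaluation of functions on `Y × G` at a section of `G` over `Y`. -/
def evalHom (B : Type v) [CommRing B] [Algebra R B] (g : WithConv (H →ₐ[R] B)) :
    B ⊗[R] H →ₐ[B] B :=
  productLeftAlgHom (AlgHom.id B B) g.ofConv

@[simp]
theorem evalHom_tmul (g : WithConv (H →ₐ[R] B)) (b : B) (x : H) :
    evalHom B g (b ⊗ₜ x) = b * g x := by
  rw [evalHom, productLeftAlgHom, lift_tmul, AlgHom.id_apply]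

variable (t : TorsorStructure R H A B)

/-- The endomorphism of the torsor `Y` given by a section of `G` over `Y`. -/
def act (g : WithConv (H →ₐ[R] B)) : B →ₐ[A] B :=
  ((evalHom B g).restrictScalars A).comp t.coact

theorem act_apply (g : WithConv (H →ₐ[R] B)) (b : B) : t.act g b = evalHom B g (t.coact b) := rfl

theorem act_one : t.act 1 = AlgHom.id A B := by
  ext b
  have h := LinearMap.congr_fun t.counit b
  have key : ∀ y : B ⊗[R] H, evalHom B 1 y =
      TensorProduct.rid R B (LinearMap.lTensor B Coalgebra.counit y) := by
    intro y
    induction y with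
    | zero => simp
    | add y y' hy hy' => rw [map_add, hy, hy', map_add, map_add]
    | tmul b x => simp [AlgHom.convOne_apply, Algebra.smul_def, mul_comm]
  rw [act_apply, key]
  exact h

/-- The automorphism of the group of sections of `G` over `Y` induced by an endomorphism of `Y`. -/
def postcomp (φ : B →ₐ[A] B) : Monoid.End (WithConv (H →ₐ[R] B)) where
  toFun g := toConv ((φ.restrictScalars R).comp g.ofConv)
  map_one' := by
    apply WithConv.ext
    ext x
    simp [AlgHom.convOne_def]
  map_mul' g h := congrArg toConv (AlgHom.comp_convMul_distrib (φ.restrictScalars R) g h)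

/-- A section of `G` over `Y` depends on the point of `Y`, so composition moves the second section
by the first endomorphism. Thus `act` is a crossed homomorphism, not a homomorphism. -/
theorem act_mul_postcomp (g h : WithConv (H →ₐ[R] B)) :
    t.act (g * postcomp (t.act g) h) = (t.act g).comp (t.act h) := by
  ext b
  let E : B ⊗[R] (H ⊗[R] H) →ₐ[R] B :=
    productMap (AlgHom.id R B) (productMap g.ofConv (postcomp (t.act g) h).ofConv)
  have h1 : ∀ y : B ⊗[R] H, evalHom B (g * postcomp (t.act g) h) y =
      E (LinearMap.lTensor B Coalgebra.comul y) := by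
    intro y
    induction y with
    | zero => simp
    | add y y' hy hy' => rw [map_add, hy, hy', map_add, map_add]
    | tmul b x =>
      rw [evalHom_tmul, AlgHom.convMul_apply, LinearMap.lTensor_tmul, productMap_apply_tmul]
      rfl
  have h2 : ∀ (x : H) (y : B ⊗[R] H), E (TensorProduct.assoc R B H H (y ⊗ₜ x)) =
      evalHom B g y * t.act g (h x) := by
    intro x y
    induction y with
    | zero => simp
    | add y y' hy hy' => rw [TensorProduct.add_tmul, map_add, map_add, hy, hy', map_add, add_mul]
    | tmul b z =>
      rw [TensorProduct.assoc_tmul, productMap_apply_tmul, productMap_apply_tmul, evalHom_tmul,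
        mul_assoc]
      rfl
  have h3 : ∀ y : B ⊗[R] H, E (TensorProduct.assoc R B H H
      (LinearMap.rTensor H (t.coact.restrictScalars R).toLinearMap y)) =
        t.act g (evalHom B h y) := by
    intro y
    induction y with
    | zero => simp
    | add y y' hy hy' => rw [map_add, map_add, map_add, hy, hy', map_add, map_add]
    | tmul b x =>
      rw [LinearMap.rTensor_tmul, evalHom_tmul, map_mul]
      exact h2 x (t.coact b)
  rw [act_apply, h1, AlgHom.comp_apply, act_apply t h, ← h3]
  exact congrArg E (LinearMap.congr_fun t.coassoc b).symm

/-- The isomorphism `Y × G ≅ Y ×_X Y`. -/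
def translationEquiv : B ⊗[A] B ≃ₐ[B] B ⊗[R] H := AlgEquiv.ofBijective _ t.bijective

theorem evalHom_translationEquiv (g : WithConv (H →ₐ[R] B)) (y : B ⊗[A] B) :
    evalHom B g (t.translationEquiv y) = productLeftAlgHom (AlgHom.id B B) (t.act g) y := by
  induction y with
  | zero => simp
  | add y y' hy hy' => rw [map_add, map_add, hy, hy', map_add]
  | tmul b b' =>
    change evalHom B g ((b ⊗ₜ[R] (1 : H)) * t.coact b') = b * t.act g b'
    rw [map_mul, evalHom_tmul, map_one, mul_one, act_apply]

/-- Sections of `Y × G → Y` are, by the torsor isomorphism, sections of `Y ×_X Y → Y`, that is,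
`X`-endomorphisms of `Y`. -/
theorem act_bijective : Function.Bijective t.act := by
  refine ⟨fun g h hgh => ?_, fun φ => ?_⟩
  · apply WithConv.ext
    ext x
    obtain ⟨y, hy⟩ := t.translationEquiv.surjective (1 ⊗ₜ x)
    have hg := t.evalHom_translationEquiv g y
    have hh := t.evalHom_translationEquiv h y
    rw [hy, evalHom_tmul, one_mul] at hg hh
    rw [hg, hh, hgh]
  · let ψ : B ⊗[R] H →ₐ[B] B :=
      (productLeftAlgHom (AlgHom.id B B) φ).comp t.translationEquiv.symm.toAlgHom
    let g : WithConv (H →ₐ[R] B) := toConv ((ψ.restrictScalars R).comp includeRight)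
    have hg : evalHom B g = ψ := by
      refine Algebra.TensorProduct.ext_iff.mpr ⟨?_, ?_⟩
      · ext
      · ext x
        exact (evalHom_tmul g 1 x).trans (one_mul _)
    refine ⟨g, ?_⟩
    ext b
    have h1 : t.coact b = t.translationEquiv (1 ⊗ₜ b) := by
      change t.coact b = (1 : B ⊗[R] H) * t.coact b
      rw [one_mul]
    rw [act_apply, h1, hg]
    change productLeftAlgHom (AlgHom.id B B) φ (t.translationEquiv.symm _) = _
    rw [AlgEquiv.symm_apply_apply]
    exact (productMap_apply_tmul (R := A) (AlgHom.id A B) φ 1 b).trans (one_mul _)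

end TorsorStructure

/-- Reduce modulo the monic polynomial `∏ (X - u g)`, which vanishes at all the points. -/
theorem exists_fin_sum_eq_eval {N B : Type*} [Fintype N] [CommRing B] [Nontrivial B] (u : N → B)
    (q : Polynomial B) : ∃ c : Fin (Fintype.card N) → B, ∀ g,
      q.eval (u g) = ∑ k, c k * u g ^ (k : ℕ) := by
  let Ψ : Polynomial B := ∏ g, (Polynomial.X - Polynomial.C (u g))
  have hΨ : Ψ.Monic := Polynomial.monic_prod_of_monic _ _ fun g _ => Polynomial.monic_X_sub_C _
  have hdeg : Ψ.natDegree = Fintype.card N := by simp [Ψ]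
  refine ⟨fun k => (q %ₘ Ψ).coeff k, fun g => ?_⟩
  rw [Fin.sum_univ_eq_sum_range (fun k => (q %ₘ Ψ).coeff k * u g ^ k)]
  have h0 : Ψ.eval (u g) = 0 := by
    rw [Polynomial.eval_prod]
    exact Finset.prod_eq_zero (Finset.mem_univ g) (by simp)
  have h1 : q.eval (u g) = (q %ₘ Ψ).eval (u g) := by
    conv_lhs => rw [← Polynomial.modByMonic_add_div q Ψ]
    rw [Polynomial.eval_add, Polynomial.eval_mul, h0, zero_mul, add_zero]
  rw [h1]
  refine Polynomial.eval_eq_sum_range' ?_ _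
  have : 0 < Fintype.card N := Fintype.card_pos_iff.mpr ⟨g⟩
  rw [← hdeg]
  exact Polynomial.natDegree_modByMonic_lt _ hΨ fun h => by
    rw [h, Polynomial.natDegree_one] at hdeg
    omega

/-- A polynomial that vanishes at the points `u h ^ p` takes values at points `u g ^ p` close to
those that are highly divisible. -/
theorem pow_dvd_eval_of_eval_eq_zero {p : ℕ} [Fact p.Prime] {B N : Type*} [CommRing B] [IsDomain B]
    [CharP B p] {u : N → B} (hu : Function.Injective u) {φ : Polynomial B} (S : Finset N)
    (hS : ∀ h ∈ S, φ.eval (u h ^ p) = 0) {ϖ : B} {m : ℕ} {g : N}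
    (hg : ∀ h ∈ S, ϖ ^ m ∣ u g - u h) : ϖ ^ (m * p * S.card) ∣ φ.eval (u g ^ p) := by
  classical
  rcases eq_or_ne φ 0 with rfl | hφ
  · simp
  have hinj : Function.Injective fun h => u h ^ p := (frobenius_inj B p).comp hu
  -- Distinct `h` give distinct roots `u(h)^p`, so the product of the linear factors divides `φ`;
  -- each factor at `u(g)^p` is `(u(g) - u(h))^p`.
  have h1 : (((S.image fun h => u h ^ p).val.map fun a => Polynomial.X - Polynomial.C a).prod) ∣
      φ := by
    rw [Multiset.prod_X_sub_C_dvd_iff_le_roots hφ, Multiset.le_iff_subset (Finset.nodup _)]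
    intro a ha
    obtain ⟨h, hh, rfl⟩ := Finset.mem_image.mp (Finset.mem_val.mp ha)
    exact (Polynomial.mem_roots hφ).mpr (hS h hh)
  change (∏ a ∈ S.image fun h => u h ^ p, (Polynomial.X - Polynomial.C a)) ∣ φ at h1
  rw [Finset.prod_image hinj.injOn] at h1
  refine dvd_trans ?_ (Polynomial.eval_dvd h1 (x := u g ^ p))
  rw [Polynomial.eval_prod, pow_mul, ← Finset.prod_const]
  refine Finset.prod_dvd_prod_of_dvd _ _ fun h hh => ?_
  rw [Polynomial.eval_sub, Polynomial.eval_X, Polynomial.eval_C, ← sub_pow_char, pow_mul]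
  exact pow_dvd_pow_of_dvd (hg h hh) p

/-! ### Displacement as a coordinate on the group of sections -/

namespace TorsorStructure

open WithConv Coalgebra Algebra.TensorProduct

variable {R : Type u} [CommRing R] {H : Type w} [CommRing H] [HopfAlgebra R H]
  {A : Type v} [CommRing A] [Algebra R A]
  {B : Type v} [CommRing B] [Algebra R B] [Algebra A B] [IsScalarTower R A B]
  (t : TorsorStructure R H A B)

/-- The displacement of a function under a section of the group. -/
def diff (s : B) (g : WithConv (H →ₐ[R] B)) : B := t.act g s - s

variable {s : B} {d : A}

theorem diff_injective [IsDomain B] (hd : algebraMap A B d ≠ 0)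
    (hs : ∀ b, ∃ Q : Polynomial A, algebraMap A B d * b = Polynomial.aeval s Q) :
    Function.Injective (t.diff s) := by
  intro g h hgh
  refine t.act_bijective.1 ?_
  ext b
  obtain ⟨Q, hQ⟩ := hs b
  have key : ∀ φ : B →ₐ[A] B, algebraMap A B d * φ b = Polynomial.aeval (φ s) Q := by
    intro φ
    rw [← φ.commutes d, ← map_mul, hQ, Polynomial.aeval_algHom_apply]
  refine mul_left_cancel₀ hd ?_
  rw [key, key, sub_left_inj.mp hgh]

/-- Transported through the torsor isomorphism, the function `x` on `G` is a sum of tensors `b ⊗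
b'`, whose value at `g` is `b · g(b')`. If `d b' = Q(s)`, then `d g(b') = Q(s + u(g))`. -/
theorem exists_polynomial_eval_diff
    (hs : ∀ b, ∃ Q : Polynomial A, algebraMap A B d * b = Polynomial.aeval s Q) (x : H) :
    ∃ q : Polynomial B, ∀ g : WithConv (H →ₐ[R] B),
      algebraMap A B d * g x = q.eval (t.diff s g) := by
  obtain ⟨y, hy⟩ := t.translationEquiv.surjective (1 ⊗ₜ x)
  have key : ∀ y : B ⊗[A] B, ∃ q : Polynomial B, ∀ g : WithConv (H →ₐ[R] B),
      algebraMap A B d * productLeftAlgHom (AlgHom.id B B) (t.act g) y = q.eval (t.diff s g) := by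
    intro y
    induction y with
    | zero => exact ⟨0, by simp⟩
    | add y y' hy hy' =>
      obtain ⟨q, hq⟩ := hy
      obtain ⟨q', hq'⟩ := hy'
      exact ⟨q + q', fun g => by rw [map_add, mul_add, hq, hq', Polynomial.eval_add]⟩
    | tmul b b' =>
      obtain ⟨Q, hQ⟩ := hs b'
      refine ⟨Polynomial.C b * (Q.map (algebraMap A B)).comp (Polynomial.X + Polynomial.C s),
        fun g => ?_⟩
      have h1 : algebraMap A B d * t.act g b' = Polynomial.aeval (t.act g s) Q := by
        rw [← (t.act g).commutes d, ← map_mul, hQ, Polynomial.aeval_algHom_apply]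
      rw [productLeftAlgHom, lift_tmul, AlgHom.id_apply, mul_left_comm, h1, diff]
      simp [Polynomial.eval_comp, Polynomial.eval_map_algebraMap]
  obtain ⟨q, hq⟩ := key y
  refine ⟨q, fun g => ?_⟩
  rw [← hq, ← evalHom_translationEquiv, hy, evalHom_tmul, one_mul]

/-- The displacement is the value of `coact s - s ⊗ 1`, so the expansion of coordinates at a product
of sections applies. -/
theorem exists_coeff_diff_prod [Nontrivial B] [Fintype (WithConv (H →ₐ[R] B))]
    (hs : ∀ b, ∃ Q : Polynomial A, algebraMap A B d * b = Polynomial.aeval s Q) (n : ℕ) :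
    ∃ β : (Fin n → Fin (Fintype.card (WithConv (H →ₐ[R] B)))) → B,
      ∀ g : Fin n → WithConv (H →ₐ[R] B), algebraMap A B d ^ n * t.diff s (List.ofFn g).prod =
        ∑ k, β k * ∏ i, t.diff s (g i) ^ (k i : ℕ) := by
  have hq : ∀ x : H, ∃ q : Fin (Fintype.card (WithConv (H →ₐ[R] B))) → B,
      ∀ g : WithConv (H →ₐ[R] B), algebraMap A B d * g x = ∑ k, q k * t.diff s g ^ (k : ℕ) := by
    intro x
    obtain ⟨q, hq⟩ := t.exists_polynomial_eval_diff hs x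
    obtain ⟨c, hc⟩ := exists_fin_sum_eq_eval (t.diff s) q
    exact ⟨c, fun g => by rw [hq, hc]⟩
  have key : ∀ y : B ⊗[R] H, ∃ β : (Fin n → Fin (Fintype.card (WithConv (H →ₐ[R] B)))) → B,
      ∀ g : Fin n → WithConv (H →ₐ[R] B), algebraMap A B d ^ n * evalHom B (List.ofFn g).prod y =
        ∑ k, β k * ∏ i, t.diff s (g i) ^ (k i : ℕ) := by
    intro y
    induction y with
    | zero => exact ⟨0, by simp⟩
    | add y y' hy hy' =>
      obtain ⟨β, hβ⟩ := hy
      obtain ⟨β', hβ'⟩ := hy'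
      exact ⟨β + β', fun g => by
        simp only [map_add, mul_add, hβ, hβ', Pi.add_apply, add_mul, Finset.sum_add_distrib]⟩
    | tmul b x =>
      obtain ⟨β, hβ⟩ := exists_coeff_convProd hq n x
      exact ⟨fun k => b * β k, fun g => by
        rw [evalHom_tmul, mul_left_comm, hβ, Finset.mul_sum]
        exact Finset.sum_congr rfl fun k _ => (mul_assoc _ _ _).symm⟩
  obtain ⟨β, hβ⟩ := key (t.coact s - s ⊗ₜ 1)
  refine ⟨β, fun g => ?_⟩
  rw [← hβ, map_sub, evalHom_tmul, map_one, mul_one, diff, act_apply]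

/-- Iterating the crossed relation, the norm `g · Tg ⋯ T^(n-1) g` acts as `σ^n`, where `T` is the
action of `σ` on sections. -/
theorem act_prod_iterate (g : WithConv (H →ₐ[R] B)) (σ : B ≃ₐ[A] B) (hg : t.act g = σ) (n : ℕ) :
    t.act ((List.range n).map fun i => ((postcomp (σ : B →ₐ[A] B)) ^ i : Monoid.End _) g).prod =
      (σ ^ n : B ≃ₐ[A] B) := by
  have hpost : ∀ n : ℕ, (postcomp (R := R) (H := H) (σ : B →ₐ[A] B)) ^ n =
      postcomp ((σ ^ n : B ≃ₐ[A] B) : B →ₐ[A] B) := by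
    intro n
    induction n with
    | zero => rfl
    | succ n ih => rw [pow_succ, ih, pow_succ]; rfl
  induction n with
  | zero => exact t.act_one
  | succ n ih =>
    rw [List.range_succ, List.map_append, List.prod_append, List.map_singleton,
      List.prod_singleton, hpost, ← ih, act_mul_postcomp, ih, hg, pow_succ]
    rfl

end TorsorStructure

/-- The group of points of an affine group scheme. -/
abbrev AlgHom.convolutionGroup (R : Type u) [CommRing R] (H : Type w) [CommRing H]
    [HopfAlgebra R H] (B : Type v) [CommRing B] [Algebra R B] :
    Group (WithConv (H →ₐ[R] B)) :=
  { (inferInstance : Monoid (WithConv (H →ₐ[R] B))) with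
    inv f := WithConv.toConv (f.ofConv.comp (HopfAlgebra.antipodeAlgHom R H))
    inv_mul_cancel f := by
      apply WithConv.ext
      ext x
      have key : ∀ y : H ⊗[R] H, Algebra.TensorProduct.lift
          (f.ofConv.comp (HopfAlgebra.antipodeAlgHom R H)) f.ofConv (fun _ _ => .all ..) y =
          f (LinearMap.mul' R H ((HopfAlgebra.antipode R).rTensor H y)) := by
        intro y
        induction y with
        | zero => simp
        | add y y' hy hy' => simp only [map_add, hy, hy']
        | tmul a b => simp
      refine (AlgHom.convMul_apply _ _ x).trans ((key _).trans ?_)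
      rw [HopfAlgebra.mul_antipode_rTensor_comul_apply, AlgHom.commutes]
      rfl }

/-! ### The obstruction from conductors -/

namespace TorsorStructure

open WithConv

variable {p : ℕ} [Fact p.Prime] {R : Type u} [CommRing R] {H : Type w} [CommRing H]
  [HopfAlgebra R H] {A : Type v} [CommRing A] [Algebra R A]
  {B : Type v} [CommRing B] [Algebra R B] [Algebra A B] [IsScalarTower R A B] [IsDomain B]

/-- A cyclic cover of degree `p ^ 2` whose conductors jump too much is not a torsor. -/
theorem isEmpty_of_conductors [CharP B p] (hp : 2 < p) {ϖ s : B} (hϖ : Prime ϖ) {d : A}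
    (hd : ¬ ϖ ∣ algebraMap A B d)
    (hs : ∀ b, ∃ Q : Polynomial A, algebraMap A B d * b = Polynomial.aeval s Q)
    (σ : B ≃ₐ[A] B) (hσ : ∀ φ : B →ₐ[A] B, ∃ i : ℕ, φ = (σ ^ i : B ≃ₐ[A] B))
    (hord : orderOf σ = p ^ 2) {m n : ℕ} (hm : ∀ i : ℕ, ϖ ^ m ∣ (σ ^ i : B ≃ₐ[A] B) s - s)
    (hn : ∀ i : ℕ, ϖ ^ n ∣ (σ ^ (p * i) : B ≃ₐ[A] B) s - s)
    (hlt : ∀ i : ℕ, ϖ ^ (n + 1) ∣ (σ ^ i : B ≃ₐ[A] B) s - s → σ ^ i = 1)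
    (hn1 : n + 1 ≤ n * p) (hnm : n + 1 ≤ m * p * p) :
    IsEmpty (TorsorStructure R H A B) := by
  classical
  refine ⟨fun t => ?_⟩
  have hpp : p.Prime := Fact.out
  have hd0 : algebraMap A B d ≠ 0 := fun h => hd (h ▸ dvd_zero _)
  have hu := t.diff_injective hd0 hs
  have hcard : Nat.card (WithConv (H →ₐ[R] B)) = p ^ 2 := by
    have e : (B ≃ₐ[A] B) ≃ (B →ₐ[A] B) := Equiv.ofBijective (fun τ => (τ : B →ₐ[A] B))
      ⟨AlgEquiv.coe_toAlgHom_injective, fun φ => by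
        obtain ⟨i, rfl⟩ := hσ φ
        exact ⟨σ ^ i, rfl⟩⟩
    rw [Nat.card_congr (Equiv.ofBijective _ t.act_bijective), ← Nat.card_congr e, ← hord]
    refine (orderOf_eq_card_of_forall_mem_zpowers fun τ => ?_).symm
    obtain ⟨i, hi⟩ := hσ τ
    exact ⟨i, (zpow_natCast σ i).trans (AlgEquiv.coe_toAlgHom_injective hi).symm⟩
  have : Finite (WithConv (H →ₐ[R] B)) := Nat.finite_of_card_ne_zero (by
    rw [hcard]; exact pow_ne_zero _ hpp.ne_zero)
  have := Fintype.ofFinite (WithConv (H →ₐ[R] B))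
  -- A group of order `p²` is commutative, whatever the group scheme.
  let inst : CommGroup (WithConv (H →ₐ[R] B)) :=
    { (AlgHom.convolutionGroup R H B) with
      mul_comm :=
        letI := AlgHom.convolutionGroup R H B
        (IsPGroup.isMulCommutative_of_card_eq_prime_sq hcard).is_comm.comm }
  have hact : ∀ g, ∃ i : ℕ, t.act g = (σ ^ i : B ≃ₐ[A] B) := fun g => hσ _
  have hdiff : ∀ (g) (i : ℕ), t.act g = (σ ^ i : B ≃ₐ[A] B) →
      t.diff s g = (σ ^ i : B ≃ₐ[A] B) s - s := fun g i h => by rw [diff, h]; rfl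
  have hone : ∀ g, ϖ ^ (n + 1) ∣ t.diff s g → g = 1 := by
    intro g hg
    obtain ⟨i, hi⟩ := hact g
    rw [hdiff g i hi] at hg
    refine t.act_bijective.1 ?_
    rw [hi, hlt i hg, t.act_one]
    rfl
  have hdiv : ∀ g, ϖ ^ m ∣ t.diff s g := by
    intro g
    obtain ⟨i, hi⟩ := hact g
    rw [hdiff g i hi]
    exact hm i
  have hdone : t.diff s 1 = 0 := by rw [diff, t.act_one, AlgHom.id_apply, sub_self]
  obtain ⟨β, hβ⟩ := t.exists_coeff_diff_prod hs p
  obtain ⟨φ, hφ⟩ := exists_polynomial_eval_pow hu le_rfl β fun g => by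
    rw [← List.prod_ofFn]; exact hβ g
  have hφ0 : φ.eval 0 = 0 := by
    have := hφ 1
    rwa [one_pow, hdone, mul_zero, zero_pow hpp.ne_zero, eq_comm] at this
  have hcancel : ∀ g, ϖ ^ (n + 1) ∣ φ.eval (t.diff s g ^ p) → g ^ p = 1 := by
    intro g hg
    rw [← hφ] at hg
    exact hone _ (hϖ.pow_dvd_of_dvd_mul_left _ (fun h => hd (hϖ.dvd_of_dvd_pow h)) hg)
  -- Since `φ(0) = 0`, `u(g)^p` divides `φ(u(g)^p)`, so `ϖ^(n p)` divides it too, and `n p` exceeds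
  -- `n`.
  have hsmall : ∀ g, ϖ ^ n ∣ t.diff s g → g ^ p = 1 := by
    intro g hg
    refine hcancel g ((pow_dvd_pow ϖ hn1).trans ?_)
    have h1 := Polynomial.sub_dvd_eval_sub (t.diff s g ^ p) 0 φ
    rw [hφ0, sub_zero, sub_zero] at h1
    refine dvd_trans ?_ h1
    rw [pow_mul]
    exact pow_dvd_pow_of_dvd hg p
  -- The sections that correspond to `σ^(p i)`, `i < p`, give `p` zeros of `φ`. Each contributes
  -- `ϖ^(m p)` at any other section, `ϖ^(m p p)` in all.
  have hexp : ∀ g : WithConv (H →ₐ[R] B), g ^ p = 1 := by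
    choose c hc using fun i : ℕ => t.act_bijective.2 (σ ^ (p * i) : B ≃ₐ[A] B)
    have hcinj : Set.InjOn c (Finset.range p : Set ℕ) := by
      intro i hi j hj hij
      have h1 : σ ^ (p * i) = σ ^ (p * j) :=
        AlgEquiv.coe_toAlgHom_injective ((hc i).symm.trans ((congrArg t.act hij).trans (hc j)))
      have hb : ∀ k ∈ (Finset.range p : Set ℕ), p * k < orderOf σ := by
        intro k hk
        rw [hord, sq]
        exact Nat.mul_lt_mul_of_pos_left (Finset.mem_range.mp hk) hpp.pos
      exact Nat.eq_of_mul_eq_mul_left hpp.pos (pow_injOn_Iio_orderOf (hb i hi) (hb j hj) h1)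
    intro g
    refine hcancel g ((pow_dvd_pow ϖ hnm).trans ?_)
    have h1 := pow_dvd_eval_of_eval_eq_zero (p := p) hu (φ := φ) ((Finset.range p).image c)
      (ϖ := ϖ) (m := m) (g := g) (fun h hh => by
        obtain ⟨i, -, rfl⟩ := Finset.mem_image.mp hh
        rw [← hφ, hsmall (c i) (by rw [hdiff _ _ (hc i)]; exact hn i), hdone, mul_zero])
      (fun h _ => dvd_sub (hdiv g) (hdiv h))
    rwa [Finset.card_image_of_injOn hcinj, Finset.card_range] at h1
  obtain ⟨g, hg⟩ := t.act_bijective.2 (σ : B →ₐ[A] B)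
  have h1 := t.act_prod_iterate g σ hg
  have hT : (postcomp (R := R) (H := H) (σ : B →ₐ[A] B)) ^ p ^ 2 = 1 := by
    have hpost : ∀ n : ℕ, (postcomp (R := R) (H := H) (σ : B →ₐ[A] B)) ^ n =
        postcomp ((σ ^ n : B ≃ₐ[A] B) : B →ₐ[A] B) := by
      intro n
      induction n with
      | zero => rfl
      | succ n ih => rw [pow_succ, ih, pow_succ]; rfl
    rw [hpost, ← hord, pow_orderOf_eq_one]
    rfl
  have h2 : ((List.range p).map fun i =>
      ((postcomp (σ : B →ₐ[A] B)) ^ i : Monoid.End _) g).prod = 1 := by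
    exact prod_iterate_eq_one hp hcard hexp hT g
  -- The norm of the section for `σ` is trivial by unipotence, yet it acts as `σ^p`.
  have h3 : σ ^ p = 1 := by
    refine AlgEquiv.coe_toAlgHom_injective ((h1 p).symm.trans ?_)
    rw [h2, t.act_one]
    rfl
  have h4 := orderOf_dvd_of_pow_eq_one h3
  rw [hord] at h4
  have := Nat.le_of_dvd hpp.pos h4
  nlinarith

end TorsorStructure

/-! ### The Galois group of the generic cover -/

namespace YGen

variable {R : Type u} [CommRing R] (p : ℕ) [Fact p.Prime] (π : R) (m : ℕ)
  {A : Type v} [CommRing A] [Algebra R A] (a₁ a₂ : A)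

section

variable [CharP R p]

theorem natCast_eq_zero : (p : YGen p π m a₁ a₂) = 0 := by
  rw [← map_natCast (algebraMap (GenericFibre π A) (YGen p π m a₁ a₂)),
    natCast_eq_zero_of_algebra R p, map_zero]

/-- Addition of the Witt vector `(1, 0)`. -/
def shiftHom : YGen p π m a₁ a₂ →ₐ[GenericFibre π A] YGen p π m a₁ a₂ :=
  YGen.lift p π m a₁ a₂ (T₁ p π m a₁ a₂ + 1)
    (T₂ p π m a₁ a₂ - wittQ p (T₁ p π m a₁ a₂) 1)
    (by
      have h := T₁_eq p π m a₁ a₂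
      rw [add_pow_of_natCast_eq_zero Fact.out (natCast_eq_zero ..), one_pow]
      linear_combination h)
    (by
      have h0 := natCast_eq_zero p π m a₁ a₂
      have h1 := T₂_pow_sub p π m a₁ a₂
      have h2 := T₁_eq p π m a₁ a₂
      have h3 := wittQ_cocycle (p := p) (T₁ p π m a₁ a₂ ^ p - T₁ p π m a₁ a₂) (T₁ p π m a₁ a₂) 1
      rw [sub_add_cancel] at h3
      rw [sub_eq_zero] at h2
      rw [← h2] at h1
      rw [IsScalarTower.algebraMap_apply A (GenericFibre π A)] at h1
      rw [add_pow_of_natCast_eq_zero Fact.out h0, sub_pow_of_natCast_eq_zero Fact.out h0, one_pow,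
        wittQ_pow h0, one_pow, add_sub_add_right_eq_sub]
      linear_combination h1 - h3)

theorem shiftHom_T₁ : shiftHom p π m a₁ a₂ (T₁ p π m a₁ a₂) = T₁ p π m a₁ a₂ + 1 :=
  lift_T₁ ..

theorem shiftHom_T₂ : shiftHom p π m a₁ a₂ (T₂ p π m a₁ a₂) =
    T₂ p π m a₁ a₂ - wittQ p (T₁ p π m a₁ a₂) 1 :=
  lift_T₂ ..

theorem shiftHom_pow_T₁ (k : ℕ) :
    (shiftHom p π m a₁ a₂ ^ k) (T₁ p π m a₁ a₂) = T₁ p π m a₁ a₂ + k := by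
  induction k with
  | zero => simp
  | succ k ih =>
    rw [pow_succ', AlgHom.mul_apply, ih, map_add, map_natCast, shiftHom_T₁]
    push_cast
    ring

theorem shiftHom_pow_T₂ (k : ℕ) : (shiftHom p π m a₁ a₂ ^ k) (T₂ p π m a₁ a₂) =
    T₂ p π m a₁ a₂ - ∑ j ∈ Finset.range k, wittQ p (T₁ p π m a₁ a₂ + j) 1 := by
  induction k with
  | zero => simp
  | succ k ih =>
    rw [pow_succ, AlgHom.mul_apply, shiftHom_T₂, map_sub, ih, map_wittQ, map_one, shiftHom_pow_T₁,
      Finset.sum_range_succ]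
    ring

theorem shiftHom_pow_mul_T₁ (j : ℕ) :
    (shiftHom p π m a₁ a₂ ^ (p * j)) (T₁ p π m a₁ a₂) = T₁ p π m a₁ a₂ := by
  rw [shiftHom_pow_T₁, Nat.cast_mul, natCast_eq_zero, zero_mul, add_zero]

/-- Adding `(1, 0)` to a Witt vector `p` times adds `(0, 1)`; the carries sum to `-1`. -/
theorem shiftHom_pow_mul_T₂ (j : ℕ) :
    (shiftHom p π m a₁ a₂ ^ (p * j)) (T₂ p π m a₁ a₂) = T₂ p π m a₁ a₂ + j := by
  induction j with
  | zero => simp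
  | succ j ih =>
    rw [mul_add_one, pow_add, AlgHom.mul_apply, shiftHom_pow_T₂,
      sum_wittQ_add_one (natCast_eq_zero ..), sub_neg_eq_add, map_add, map_one, ih]
    push_cast
    ring

theorem shiftHom_pow_sq : shiftHom p π m a₁ a₂ ^ p ^ 2 = 1 := by
  rw [sq]
  refine YGen.algHom_ext ?_ ?_
  · rw [shiftHom_pow_mul_T₁, AlgHom.one_apply]
  · rw [shiftHom_pow_mul_T₂, natCast_eq_zero, add_zero, AlgHom.one_apply]

/-- Addition of the Witt vector `(1, 0)`, as an automorphism. -/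
def shift : YGen p π m a₁ a₂ ≃ₐ[GenericFibre π A] YGen p π m a₁ a₂ :=
  have h : 0 < p ^ 2 := pow_pos (Fact.out : p.Prime).pos 2
  AlgEquiv.ofAlgHom (shiftHom p π m a₁ a₂) (shiftHom p π m a₁ a₂ ^ (p ^ 2 - 1))
    (by
      change shiftHom p π m a₁ a₂ * shiftHom p π m a₁ a₂ ^ (p ^ 2 - 1) = 1
      rw [← pow_succ', Nat.sub_add_cancel h, shiftHom_pow_sq])
    (by
      change shiftHom p π m a₁ a₂ ^ (p ^ 2 - 1) * shiftHom p π m a₁ a₂ = 1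
      rw [← pow_succ, Nat.sub_add_cancel h, shiftHom_pow_sq])

theorem shift_pow_apply (k : ℕ) (y : YGen p π m a₁ a₂) :
    (shift p π m a₁ a₂ ^ k) y = (shiftHom p π m a₁ a₂ ^ k) y := by
  induction k with
  | zero => rfl
  | succ k ih => rw [pow_succ', pow_succ', AlgEquiv.mul_apply, ih]; rfl

theorem exists_isUnit_shift_pow_sub {k : ℕ} (hk : 0 < k) (hk' : k < p ^ 2) :
    ∃ y, IsUnit ((shift p π m a₁ a₂ ^ k) y - y) := by
  have h0 := natCast_eq_zero p π m a₁ a₂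
  have hp : p.Prime := Fact.out
  by_cases h : p ∣ k
  · obtain ⟨j, rfl⟩ := h
    refine ⟨T₂ p π m a₁ a₂, ?_⟩
    rw [shift_pow_apply, shiftHom_pow_mul_T₂, add_sub_cancel_left]
    rw [sq] at hk'
    exact isUnit_natCast_of_natCast_eq_zero h0 (Nat.pos_of_mul_pos_left hk)
      (Nat.lt_of_mul_lt_mul_left hk')
  · refine ⟨T₁ p π m a₁ a₂, ?_⟩
    rw [shift_pow_apply, shiftHom_pow_T₁, add_sub_cancel_left, ← Nat.mod_add_div k p, Nat.cast_add,
      Nat.cast_mul, h0, zero_mul, add_zero]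
    exact isUnit_natCast_of_natCast_eq_zero h0
      (Nat.pos_of_ne_zero fun h' => h (Nat.dvd_of_mod_eq_zero h')) (Nat.mod_lt _ hp.pos)

end

theorem isGenericallyCyclic [CharP R p] [Nontrivial (GenericFibre π A)]
    [Nontrivial (Y₁Gen p π m a₁)]
    [IsLocalization.Away (algebraMap A (YRing p π m a₁ a₂) (algebraMap R A π))
      (YGen p π m a₁ a₂)] : IsGenericallyCyclic π (p ^ 2) A (YRing p π m a₁ a₂) := by
  have hp : p.Prime := Fact.out
  have : NeZero (p ^ 2) := ⟨pow_ne_zero 2 hp.ne_zero⟩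
  have h0 : (p : GenericFibre π A) = 0 := natCast_eq_zero_of_algebra R p
  have h0' : (p : Y₁Gen p π m a₁) = 0 := by
    rw [← map_natCast (algebraMap (GenericFibre π A) (Y₁Gen p π m a₁)), h0, map_zero]
  have h₁ := adjoinsRoot_rootY₁ p π m a₁
  have h₂ := adjoinsRoot_T₂ p π m a₁ a₂
  have := h₁.etale h0
  have := h₂.etale h0'
  have : Algebra.Etale (GenericFibre π A) (YGen p π m a₁ a₂) :=
    Algebra.Etale.comp _ (Y₁Gen p π m a₁) _
  have : IsLocalization (Algebra.algebraMapSubmonoid (YRing p π m a₁ a₂)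
      (Submonoid.powers (algebraMap R A π))) (YGen p π m a₁ a₂) := by
    rw [Algebra.algebraMapSubmonoid_powers]
    infer_instance
  have := (Algebra.isPushout_of_isLocalization (Submonoid.powers (algebraMap R A π))
    (GenericFibre π A) (YRing p π m a₁ a₂) (YGen p π m a₁ a₂)).symm
  have e : GenericFibre π A ⊗[A] YRing p π m a₁ a₂ ≃ₐ[GenericFibre π A] YGen p π m a₁ a₂ :=
    Algebra.IsPushout.equiv A (GenericFibre π A) (YRing p π m a₁ a₂) (YGen p π m a₁ a₂)
  refine isCyclicTorsor_of_isUnit_sub e.symm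
    ((h₁.basis (asPoly_monic hp.one_lt _ _)).smulTower (h₂.basis (asPoly_monic hp.one_lt _ _)))
    ?_ (shift p π m a₁ a₂) ?_ fun k hk hk' => exists_isUnit_shift_pow_sub p π m a₁ a₂ hk hk'
  · rw [Nat.card_prod, Nat.card_fin, Nat.card_fin, natDegree_asPoly hp.one_lt,
      natDegree_asPoly hp.one_lt, sq]
  · ext y
    rw [shift_pow_apply, shiftHom_pow_sq]
    rfl

end YGen

/-! ### Artin–Schreier roots and domains -/

/-- If `c ≠ 0`, then `x / c` is fixed by Frobenius, so it lies in the prime field. -/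
theorem exists_natCast_mul_eq {p : ℕ} [Fact p.Prime] {B : Type*} [CommRing B] [IsDomain B]
    [CharP B p] {x c : B} (h : x ^ p = c ^ (p - 1) * x) : ∃ i : ℕ, x = i * c := by
  have hp : p.Prime := Fact.out
  let K := FractionRing B
  have hinj := FaithfulSMul.algebraMap_injective B K
  have : CharP K p := charP_of_injective_algebraMap hinj p
  rcases eq_or_ne c 0 with rfl | hc
  · rw [zero_pow (Nat.sub_pos_of_lt hp.one_lt).ne', zero_mul] at h
    exact ⟨0, by rw [eq_zero_of_pow_eq_zero h, mul_zero]⟩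
  have hc' : algebraMap B K c ≠ 0 := (map_ne_zero_iff _ hinj).mpr hc
  have h1 : (algebraMap B K x / algebraMap B K c) ^ p = algebraMap B K x / algebraMap B K c := by
    rw [div_pow, ← map_pow, h, map_mul, map_pow, div_eq_div_iff (pow_ne_zero _ hc') hc',
      mul_assoc, mul_comm, mul_assoc, ← pow_succ', Nat.sub_add_cancel hp.one_le]
  rw [← Subfield.mem_bot_iff_pow_eq_self, ← ZMod.fieldRange_castHom_eq_bot p] at h1
  obtain ⟨n, hn⟩ := h1
  refine ⟨n.val, hinj ?_⟩
  rw [ZMod.castHom_apply, ZMod.cast_eq_val, eq_div_iff hc'] at hn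
  rw [← hn, map_mul, map_natCast]

/-- By separatedness a nonzero element is `ϖ^n c` with `ϖ ∤ c`. Such elements `c` are closed under
products, and `ϖ` is regular. -/
theorem isDomain_of_prime {B : Type*} [CommRing B] {ϖ : B} (hϖ : Prime ϖ)
    (hreg : ∀ b, ϖ * b = 0 → b = 0) (hsep : ∀ b, (∀ n : ℕ, ϖ ^ n ∣ b) → b = 0) : IsDomain B := by
  have hfac : ∀ b : B, b ≠ 0 → ∃ (n : ℕ) (c : B), ¬ ϖ ∣ c ∧ b = ϖ ^ n * c := by
    intro b hb
    have hfin : FiniteMultiplicity ϖ b := by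
      by_contra h
      exact hb (hsep b (FiniteMultiplicity.not_iff_forall.mp h))
    obtain ⟨c, hc, hc'⟩ := hfin.exists_eq_pow_mul_and_not_dvd
    exact ⟨_, c, hc', hc⟩
  have hreg' : ∀ (n : ℕ) (b : B), ϖ ^ n * b = 0 → b = 0 := by
    intro n
    induction n with
    | zero => intro b hb; simpa using hb
    | succ n ih =>
      intro b hb
      rw [pow_succ, mul_assoc] at hb
      exact hreg b (ih _ hb)
  have : Nontrivial B := ⟨ϖ, 0, hϖ.ne_zero⟩
  have : NoZeroDivisors B := ⟨fun {a b} hab => by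
    by_contra! h
    obtain ⟨i, a', ha', rfl⟩ := hfac a h.1
    obtain ⟨j, b', hb', rfl⟩ := hfac b h.2
    rw [mul_mul_mul_comm, ← pow_add] at hab
    rcases hϖ.dvd_or_dvd (show ϖ ∣ a' * b' by rw [hreg' _ _ hab]; exact dvd_zero _) with h | h
    · exact ha' h
    · exact hb' h⟩
  exact NoZeroDivisors.to_isDomain B

/-! ### Nakayama's lemma along the special fibre -/

section Nakayama

variable {A M : Type*} [CommRing A] [AddCommGroup M] [Module A M] [Module.Finite A M]

theorem exists_forall_pow_smul_mem (W : Submodule A M) (a : A)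
    (h : ∀ b, ∃ n : ℕ, a ^ n • b ∈ W) : ∃ n : ℕ, ∀ b, a ^ n • b ∈ W := by
  choose N hN using h
  obtain ⟨G, hG⟩ := Module.Finite.fg_top (R := A) (M := M)
  refine ⟨∑ g ∈ G, N g, fun b => ?_⟩
  have : Submodule.span A (G : Set M) ≤
      W.comap (LinearMap.lsmul A M (a ^ ∑ g ∈ G, N g)) := by
    refine Submodule.span_le.mpr fun g hg => ?_
    obtain ⟨k, hk⟩ := Nat.exists_eq_add_of_le
      (Finset.single_le_sum (f := N) (fun _ _ => Nat.zero_le _) hg)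
    change a ^ (∑ g ∈ G, N g) • g ∈ W
    rw [hk, add_comm, pow_add, mul_smul]
    exact W.smul_mem _ (hN g)
  exact this (hG ▸ Submodule.mem_top)

/-- A form of Nakayama's lemma over `A[1/a]`. -/
theorem exists_forall_smul_mem (W : Submodule A M) (a ϖ : A)
    (h : ∀ b, ∃ n : ℕ, ∃ w ∈ W, ∃ b', a ^ n • b = w + ϖ • b') :
    ∃ (n : ℕ) (e : A), ∀ b, (a ^ n + ϖ * e) • b ∈ W := by
  obtain ⟨n, hn⟩ := exists_forall_pow_smul_mem (W ⊔ LinearMap.range (LinearMap.lsmul A M ϖ)) a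
    fun b => by
      obtain ⟨n, w, hw, b', hb'⟩ := h b
      exact ⟨n, hb' ▸ Submodule.add_mem_sup hw ⟨b', rfl⟩⟩
  -- Cayley–Hamilton for multiplication by `a^n` on `M / W`, whose image lies in `ϖ (M / W)`. The
  -- lower coefficients of `P` are divisible by `ϖ`, so `P(a^n)` kills `M / W` and is a power of `a`
  -- modulo `ϖ`.
  obtain ⟨P, hP, -, hcoeff, hP0⟩ :=
    LinearMap.exists_monic_and_natDegree_eq_and_coeff_mem_pow_and_aeval_eq_zero A
      (algebraMap A (Module.End A (M ⧸ W)) (a ^ n)) (Ideal.span {ϖ}) (by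
        rintro _ ⟨b, rfl⟩
        obtain ⟨b, rfl⟩ := W.mkQ_surjective b
        obtain ⟨w, hw, _, ⟨b', rfl⟩, hb⟩ := Submodule.mem_sup.mp (hn b)
        have : algebraMap A (Module.End A (M ⧸ W)) (a ^ n) (W.mkQ b) = ϖ • W.mkQ b' := by
          rw [Module.algebraMap_end_apply, ← map_smul, ← hb, map_add, ← map_smul]
          rw [(W.mkQ_apply w).trans ((Submodule.Quotient.mk_eq_zero W).mpr hw), zero_add]
          rfl
        rw [this]
        exact Submodule.smul_mem_smul (Ideal.mem_span_singleton_self ϖ) Submodule.mem_top)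
  rw [Polynomial.aeval_algebraMap_apply] at hP0
  have h1 : ϖ ∣ P.eval (a ^ n) - a ^ (n * P.natDegree) := by
    rw [Polynomial.eval_eq_sum_range, Finset.sum_range_succ, hP.coeff_natDegree, one_mul, pow_mul,
      add_sub_cancel_right]
    refine Finset.dvd_sum fun i hi => Dvd.dvd.mul_right ?_ _
    rw [← Ideal.mem_span_singleton]
    have hi' : P.natDegree - i ≠ 0 := by have := Finset.mem_range.mp hi; omega
    exact Ideal.pow_le_self hi' (hcoeff i)
  obtain ⟨e, he⟩ := h1
  refine ⟨n * P.natDegree, e, fun b => ?_⟩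
  rw [← he, add_sub_cancel, ← Submodule.Quotient.mk_eq_zero, Submodule.Quotient.mk_smul]
  exact LinearMap.congr_fun hP0 (Submodule.Quotient.mk b)

end Nakayama

/-! ### Leading term of the displacement of `z₂` -/

section ScaledDiff

variable (p : ℕ) {S : Type*} [CommRing S]

/-- The polynomial `wittQ` at `(t, 1)` after the substitution `z = ϖ ^ (p * m) * t`, with
denominators cleared. -/
def scaledWittQOne (ϖ : S) (m : ℕ) (z : S) : S :=
  ∑ k ∈ Finset.Ioo 0 p, ((p.choose k / p : ℕ) : S) * ϖ ^ (m * (p * (p - 1 - k) + 1)) * z ^ k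

theorem map_scaledWittQOne {S' F : Type*} [CommRing S'] [FunLike F S S']
    [RingHomClass F S S'] (φ : F) (ϖ : S) (m : ℕ) (z : S) :
    φ (scaledWittQOne p ϖ m z) = scaledWittQOne p (φ ϖ) m (φ z) := by
  simp [scaledWittQOne]

theorem scaledWittQOne_mul (ϖ : S) (m : ℕ) (t : S) :
    scaledWittQOne p ϖ m (ϖ ^ (p * m) * t) = ϖ ^ (m * (p * (p - 1) + 1)) * wittQ p t 1 := by
  rw [scaledWittQOne, wittQ, Finset.mul_sum]
  refine Finset.sum_congr rfl fun k hk => ?_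
  obtain ⟨hk0, hkp⟩ := Finset.mem_Ioo.mp hk
  have he : m * (p * (p - 1) + 1) = m * (p * (p - 1 - k) + 1) + p * m * k := by
    obtain ⟨j, rfl⟩ : ∃ j, p = k + 1 + j := ⟨p - k - 1, by omega⟩
    have h1 : k + 1 + j - 1 = k + j := by omega
    have h2 : k + j - k = j := by omega
    rw [h1, h2]
    ring
  rw [he, pow_add, mul_pow, ← pow_mul, one_pow]
  ring

/-- The term `k = p - 1` has coefficient `ϖ^m`, while the other exponents are at least `m (p + 1)`.
-/
theorem pow_succ_dvd_scaledWittQOne_sub [Fact p.Prime] (ϖ : S) {m : ℕ} (hm : 0 < m) (z : S) :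
    ϖ ^ (m + 1) ∣ scaledWittQOne p ϖ m z - ϖ ^ m * z ^ (p - 1) := by
  have hp : p.Prime := Fact.out
  have hp1 : 0 < p - 1 := Nat.sub_pos_of_lt hp.one_lt
  rw [scaledWittQOne,
    ← Finset.add_sum_erase _ _ (Finset.mem_Ioo.mpr ⟨hp1, Nat.sub_lt hp.pos one_pos⟩)]
  have h1 : p.choose (p - 1) / p = 1 := by
    rw [Nat.choose_symm hp.one_le, Nat.choose_one_right, Nat.div_self hp.pos]
  rw [h1, Nat.sub_self, mul_zero, zero_add, mul_one, Nat.cast_one, one_mul, add_sub_cancel_left]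
  refine Finset.dvd_sum fun k hk => ?_
  rw [Finset.mem_erase, Finset.mem_Ioo] at hk
  refine Dvd.dvd.mul_right (Dvd.dvd.mul_left (pow_dvd_pow ϖ ?_) _) _
  have h2 : 0 < p * (p - 1 - k) := Nat.mul_pos hp.pos (by omega)
  nlinarith

end ScaledDiff

/-! ### The generator `σ` on the normalised cover -/

section Shift

variable {R : Type u} [CommRing R] (p : ℕ) [Fact p.Prime] [CharP R p] (π : R) (m : ℕ)
  {A : Type v} [CommRing A] [Algebra R A] (a₁ a₂ : A)

/-- The automorphism of `Y` that extends `YGen.shift`. -/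
def YRing.shift : YRing p π m a₁ a₂ ≃ₐ[A] YRing p π m a₁ a₂ :=
  AlgEquiv.mapIntegralClosure ((YGen.shift p π m a₁ a₂).restrictScalars A)

theorem YRing.algebraMap_shift_pow (k : ℕ) (y : YRing p π m a₁ a₂) :
    algebraMap _ (YGen p π m a₁ a₂) ((YRing.shift p π m a₁ a₂ ^ k) y) =
      (YGen.shiftHom p π m a₁ a₂ ^ k) (algebraMap _ _ y) := by
  induction k with
  | zero => rfl
  | succ k ih =>
    rw [pow_succ', AlgEquiv.mul_apply, pow_succ', AlgHom.mul_apply, ← ih]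
    rfl

theorem YGen.shiftHom_pow_algebraMap (k : ℕ) (a : A) :
    (YGen.shiftHom p π m a₁ a₂ ^ k) (algebraMap A _ a) = algebraMap A _ a := by
  rw [IsScalarTower.algebraMap_apply A (GenericFibre π A) (YGen p π m a₁ a₂), AlgHom.commutes]

namespace CoverEquations

variable {p π m a₁ a₂} {mt m' : ℕ} {z₁ : Y₁Ring p π m a₁} {z₂ : YRing p π m a₁ a₂}
  (E : CoverEquations p π m a₁ a₂ mt z₁ z₂)

include E

omit [CharP R p] in
theorem algebraMap_algebraMap_z₁ :
    algebraMap _ (YGen p π m a₁ a₂) (algebraMap _ (YRing p π m a₁ a₂) z₁) =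
      algebraMap A _ (algebraMap R A π) ^ m * T₁ p π m a₁ a₂ := by
  rw [← IsScalarTower.algebraMap_apply,
    IsScalarTower.algebraMap_apply (Y₁Ring p π m a₁) (Y₁Gen p π m a₁), E.algebraMap_z₁, map_mul,
    map_pow, ← IsScalarTower.algebraMap_apply, algebraMap_rootY₁]

theorem shift_pow_z₁ (k : ℕ) :
    (YRing.shift p π m a₁ a₂ ^ k) (algebraMap _ _ z₁) =
      algebraMap _ _ z₁ + k * algebraMap A _ (algebraMap R A π) ^ m := by
  apply IsIntegralClosure.algebraMap_injective (YRing p π m a₁ a₂) A (YGen p π m a₁ a₂)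
  rw [YRing.algebraMap_shift_pow, map_add, E.algebraMap_algebraMap_z₁, map_mul, map_mul, map_pow,
    map_pow, YGen.shiftHom_pow_T₁, map_natCast, YGen.shiftHom_pow_algebraMap,
    ← IsScalarTower.algebraMap_apply A (YRing p π m a₁ a₂)]
  ring

theorem shift_pow_mul_z₂ (j : ℕ) :
    (YRing.shift p π m a₁ a₂ ^ (p * j)) z₂ =
      z₂ + j * algebraMap A _ (algebraMap R A π) ^ mt := by
  apply IsIntegralClosure.algebraMap_injective (YRing p π m a₁ a₂) A (YGen p π m a₁ a₂)
  rw [YRing.algebraMap_shift_pow, map_add, E.algebraMap_z₂, map_mul, map_mul, map_pow,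
    map_pow, YGen.shiftHom_pow_mul_T₂, map_natCast, YGen.shiftHom_pow_algebraMap,
    ← IsScalarTower.algebraMap_apply A (YRing p π m a₁ a₂)]
  ring

theorem shift_pow_z₂ (hm : m = p * m') (hmt : mt = m' * (p * (p - 1) + 1)) (k : ℕ) :
    (YRing.shift p π m a₁ a₂ ^ k) z₂ = z₂ - ∑ j ∈ Finset.range k,
      scaledWittQOne p (algebraMap A (YRing p π m a₁ a₂) (algebraMap R A π)) m'
        (algebraMap _ (YRing p π m a₁ a₂) z₁ +
          (j : YRing p π m a₁ a₂) * algebraMap A _ (algebraMap R A π) ^ m) := by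
  apply IsIntegralClosure.algebraMap_injective (YRing p π m a₁ a₂) A (YGen p π m a₁ a₂)
  rw [YRing.algebraMap_shift_pow, map_sub, E.algebraMap_z₂, map_mul, map_pow, YGen.shiftHom_pow_T₂,
    map_sum, YGen.shiftHom_pow_algebraMap, mul_sub, Finset.mul_sum]
  congr 1
  refine Finset.sum_congr rfl fun j _ => ?_
  rw [map_scaledWittQOne, map_add, map_mul, map_pow, map_natCast, E.algebraMap_algebraMap_z₁,
    ← IsScalarTower.algebraMap_apply A (YRing p π m a₁ a₂), mul_comm (j : YGen p π m a₁ a₂),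
    ← mul_add, hmt, ← scaledWittQOne_mul, hm]

end CoverEquations

end Shift

theorem AdjoinsRoot.map_eq_zero_of_dvd_aeval {C D : Type*} [CommRing C] [CommRing D] [Algebra C D]
    {f : Polynomial C} {z : D} (h : AdjoinsRoot f z) (hf : f.Monic) {ϖ : C} {q : Polynomial C}
    (hq : q.natDegree < f.natDegree) (hdvd : algebraMap C D ϖ ∣ Polynomial.aeval z q) :
    q.map (Ideal.Quotient.mk (Ideal.span {ϖ})) = 0 := by
  by_contra h0
  have : Nontrivial (C ⧸ Ideal.span {ϖ}) := by
    by_contra hn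
    rw [not_nontrivial_iff_subsingleton] at hn
    exact h0 (Subsingleton.elim _ _)
  refine (hf.map (Ideal.Quotient.mk (Ideal.span {ϖ}))).not_dvd_of_natDegree_lt h0 ?_
    ((h.dvd_aeval_iff ϖ q).mp hdvd)
  rw [hf.natDegree_map]
  exact Polynomial.natDegree_map_le.trans_lt hq

theorem isDomain_of_prime_of_basis {A B ι : Type*} [CommRing A] [CommRing B] [Algebra A B]
    (b : Module.Basis ι A B) {ϖ : A} (hϖ : Prime (algebraMap A B ϖ))
    (hreg : ϖ ∈ nonZeroDivisors A) (hsep : ∀ a, (∀ n : ℕ, ϖ ^ n ∣ a) → a = 0) : IsDomain B := by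
  refine isDomain_of_prime hϖ (fun x hx => ?_) fun x hx => ?_
  · refine b.ext_elem fun i => ?_
    have h1 := congrArg (fun y => b.repr y i) hx
    simp only [← Algebra.smul_def, map_smul, Finsupp.smul_apply, smul_eq_mul, map_zero,
      Finsupp.zero_apply] at h1 ⊢
    exact (mem_nonZeroDivisors_iff.mp hreg).1 _ h1
  · refine b.ext_elem fun i => ?_
    rw [map_zero, Finsupp.zero_apply]
    refine hsep _ fun n => ?_
    obtain ⟨y, rfl⟩ := hx n
    rw [← map_pow, ← Algebra.smul_def, map_smul, Finsupp.smul_apply, smul_eq_mul]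
    exact dvd_mul_right _ _

/-! ### Automorphisms of `Y` and the displacement of `z₁ z₂` -/

namespace CoverEquations

variable {R : Type u} [CommRing R] {p : ℕ} [Fact p.Prime] [CharP R p] {π : R} {m : ℕ}
  {A : Type v} [CommRing A] [Algebra R A] {a₁ a₂ : A} {mt m' : ℕ}
  {z₁ : Y₁Ring p π m a₁} {z₂ : YRing p π m a₁ a₂} (E : CoverEquations p π m a₁ a₂ mt z₁ z₂)

include E

omit [CharP R p] in
theorem finite : Module.Finite A (YRing p π m a₁ a₂) := by
  have hp : p.Prime := Fact.out
  have := E.adjoinsRoot_z₁.finite (asPoly_monic hp.one_lt _ _)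
  have := E.adjoinsRoot_z₂.finite (asPoly_monic hp.one_lt _ _)
  exact Module.Finite.trans (Y₁Ring p π m a₁) _

omit [CharP R p] in
theorem isDomain (hreg : algebraMap R A π ∈ nonZeroDivisors A)
    (hsep : ∀ a : A, (∀ n : ℕ, algebraMap R A π ^ n ∣ a) → a = 0) :
    IsDomain (YRing p π m a₁ a₂) := by
  have hp : p.Prime := Fact.out
  exact isDomain_of_prime_of_basis ((E.adjoinsRoot_z₁.basis (asPoly_monic hp.one_lt _ _)).smulTower
    (E.adjoinsRoot_z₂.basis (asPoly_monic hp.one_lt _ _))) E.prime₂ hreg hsep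

omit [CharP R p] in
theorem algHom_ext {S : Type*} [CommRing S] [Algebra A S] {φ ψ : YRing p π m a₁ a₂ →ₐ[A] S}
    (h₁ : φ (algebraMap _ _ z₁) = ψ (algebraMap _ _ z₁)) (h₂ : φ z₂ = ψ z₂) : φ = ψ := by
  have h : φ.comp (IsScalarTower.toAlgHom A (Y₁Ring p π m a₁) _) =
      ψ.comp (IsScalarTower.toAlgHom A (Y₁Ring p π m a₁) _) :=
    E.adjoinsRoot_z₁.algHom_ext h₁
  ext y
  obtain ⟨q, rfl⟩ := E.adjoinsRoot_z₂.surjective y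
  have key : ∀ χ : YRing p π m a₁ a₂ →ₐ[A] S, χ (Polynomial.aeval z₂ q) =
      q.eval₂ (χ.comp (IsScalarTower.toAlgHom A (Y₁Ring p π m a₁) _) : _ →+* S) (χ z₂) := by
    intro χ
    rw [Polynomial.aeval_def]
    exact Polynomial.hom_eval₂ q _ (χ : _ →+* S) z₂
  rw [key, key, h, h₂]

omit [CharP R p] in
theorem z₁_pow : algebraMap _ (YRing p π m a₁ a₂) z₁ ^ p =
    (algebraMap A _ (algebraMap R A π) ^ m) ^ (p - 1) * algebraMap _ _ z₁ + algebraMap A _ a₁ := by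
  have h := congrArg (algebraMap _ (YRing p π m a₁ a₂)) E.adjoinsRoot_z₁.root_pow
  rw [map_add, map_mul, map_pow] at h
  simp only [← IsScalarTower.algebraMap_apply A (Y₁Ring p π m a₁) (YRing p π m a₁ a₂)] at h
  rw [h, map_pow, map_pow, ← pow_mul, mul_comm m]

omit [CharP R p] in
theorem z₂_pow : z₂ ^ p =
    (algebraMap A (YRing p π m a₁ a₂) (algebraMap R A π) ^ mt) ^ (p - 1) * z₂ +
      algebraMap _ _ (secondRhs p π m a₁ a₂ z₁) := by
  rw [E.adjoinsRoot_z₂.root_pow, ← IsScalarTower.algebraMap_apply,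
    IsScalarTower.algebraMap_apply R A (YRing p π m a₁ a₂), map_pow, map_pow, ← pow_mul,
    mul_comm mt]

theorem orderOf_shift [IsDomain (YRing p π m a₁ a₂)] :
    orderOf (YRing.shift p π m a₁ a₂) = p ^ 2 := by
  have h0 : (p : YRing p π m a₁ a₂) = 0 := natCast_eq_zero_of_algebra R p
  refine orderOf_eq_prime_pow (n := 1) (fun h => ?_) ?_
  · have h1 := E.shift_pow_mul_z₂ 1
    rw [pow_one] at h
    rw [mul_one, h, AlgEquiv.one_apply, Nat.cast_one, one_mul, left_eq_add] at h1
    exact E.prime₂.ne_zero (eq_zero_of_pow_eq_zero h1)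
  · refine AlgEquiv.coe_toAlgHom_injective (E.algHom_ext ?_ ?_)
    · refine (E.shift_pow_z₁ _).trans ?_
      rw [pow_succ, Nat.cast_mul, h0, mul_zero, zero_mul, add_zero]
      rfl
    · have h1 := E.shift_pow_mul_z₂ p
      rw [h0, zero_mul, add_zero, ← sq] at h1
      exact h1

/-- The difference `φ(z₁) - z₁` solves `x^p = c^(p-1) x` with `c = π^m`, so a power of `σ` matches
`φ` on `z₁`. What remains fixes `Y₁`, and the same argument on `z₂` with `c = π^mt` makes it a power
of `σ^p`. -/
theorem exists_eq_shift_pow [IsDomain (YRing p π m a₁ a₂)]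
    (φ : YRing p π m a₁ a₂ →ₐ[A] YRing p π m a₁ a₂) :
    ∃ i : ℕ, φ = (YRing.shift p π m a₁ a₂ ^ i : _ ≃ₐ[A] _) := by
  have hp : p.Prime := Fact.out
  have h0 : (p : YRing p π m a₁ a₂) = 0 := natCast_eq_zero_of_algebra R p
  have : CharP (YRing p π m a₁ a₂) p := (CharP.charP_iff_prime_eq_zero hp).mpr h0
  set σ := YRing.shift p π m a₁ a₂
  have hz₁ : ∀ χ : YRing p π m a₁ a₂ →ₐ[A] YRing p π m a₁ a₂, ∃ i : ℕ,
      χ (algebraMap _ _ z₁) = (σ ^ i) (algebraMap _ _ z₁) := by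
    intro χ
    have h1 := congrArg χ E.z₁_pow
    simp only [map_add, map_mul, map_pow, AlgHom.commutes] at h1
    obtain ⟨i, hi⟩ := exists_natCast_mul_eq (p := p)
      (x := χ (algebraMap _ _ z₁) - algebraMap _ _ z₁)
      (c := algebraMap A _ (algebraMap R A π) ^ m) (by
        rw [sub_pow_char, h1, E.z₁_pow]; ring)
    exact ⟨i, by rw [E.shift_pow_z₁, ← hi, add_sub_cancel]⟩
  obtain ⟨i, hi⟩ := hz₁ φ
  let ψ : YRing p π m a₁ a₂ →ₐ[A] YRing p π m a₁ a₂ := (((σ ^ i)⁻¹ : _ ≃ₐ[A] _) : _ →ₐ[A] _).comp φ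
  have hψ₁ : ψ (algebraMap _ _ z₁) = algebraMap _ _ z₁ := by
    change (σ ^ i)⁻¹ (φ _) = _
    rw [hi, ← AlgEquiv.mul_apply, inv_mul_cancel, AlgEquiv.one_apply]
  have hψC : ψ.comp (IsScalarTower.toAlgHom A (Y₁Ring p π m a₁) _) =
      IsScalarTower.toAlgHom A (Y₁Ring p π m a₁) _ := E.adjoinsRoot_z₁.algHom_ext hψ₁
  have h1 := congrArg ψ E.z₂_pow
  rw [map_add, map_mul, map_pow, map_pow, map_pow, AlgHom.commutes] at h1
  have h2 : ψ (algebraMap _ _ (secondRhs p π m a₁ a₂ z₁)) = algebraMap _ _ _ :=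
    AlgHom.congr_fun hψC (secondRhs p π m a₁ a₂ z₁)
  rw [h2] at h1
  obtain ⟨j, hj⟩ := exists_natCast_mul_eq (p := p) (x := ψ z₂ - z₂)
    (c := algebraMap A _ (algebraMap R A π) ^ mt) (by
      rw [sub_pow_char, h1]
      linear_combination -E.z₂_pow)
  have h3 : ψ = (σ ^ (p * j) : _ ≃ₐ[A] _) := by
    refine E.algHom_ext ?_ ?_
    · rw [hψ₁]
      refine Eq.trans ?_ (E.shift_pow_z₁ _).symm
      rw [Nat.cast_mul, h0, zero_mul, zero_mul, add_zero]
    · refine Eq.trans ?_ (E.shift_pow_mul_z₂ j).symm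
      rw [← hj, add_sub_cancel]
  refine ⟨i + p * j, ?_⟩
  ext y
  have h4 := congrArg (σ ^ i) (AlgHom.congr_fun h3 y)
  change (σ ^ i) ((σ ^ i)⁻¹ (φ y)) = (σ ^ i) ((σ ^ (p * j)) y) at h4
  rw [← AlgEquiv.mul_apply, mul_inv_cancel, AlgEquiv.one_apply, ← AlgEquiv.mul_apply,
    ← pow_add] at h4
  exact h4

omit [CharP R p] in
theorem not_dvd_z₁ [Nontrivial (SpecialFibre π A)] :
    ¬ algebraMap A (YRing p π m a₁ a₂) (algebraMap R A π) ∣ algebraMap _ _ z₁ := by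
  have hp : p.Prime := Fact.out
  have := isDomain_quotient_span_of_prime E.prime₁
  have : Nontrivial A := (Ideal.Quotient.mk_surjective (I := Ideal.span {algebraMap R A π})).nontrivial
  have : Nontrivial (Y₁Ring p π m a₁) :=
    (Ideal.Quotient.mk_surjective (I := Ideal.span {algebraMap A (Y₁Ring p π m a₁)
      (algebraMap R A π)})).nontrivial
  intro h
  rw [IsScalarTower.algebraMap_apply A (Y₁Ring p π m a₁), ← Polynomial.aeval_C z₂ z₁] at h
  have h1 := E.adjoinsRoot_z₂.map_eq_zero_of_dvd_aeval (asPoly_monic hp.one_lt _ _)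
    (by rw [Polynomial.natDegree_C, natDegree_asPoly hp.one_lt]; exact hp.pos) h
  rw [Polynomial.map_C, Polynomial.C_eq_zero, ← dvd_iff_mk_eq_zero,
    ← Polynomial.aeval_X (R := A) z₁] at h1
  have h2 := E.adjoinsRoot_z₁.map_eq_zero_of_dvd_aeval (asPoly_monic hp.one_lt _ _)
    (by rw [Polynomial.natDegree_X, natDegree_asPoly hp.one_lt]; exact hp.one_lt) h1
  rw [Polynomial.map_X] at h2
  exact Polynomial.X_ne_zero h2

/-- The displacement of `z₁ z₂` by the automorphisms of the cover. -/
theorem dvd_shift_pow_mul_sub (hm' : 0 < m') (hm : m = p * m') (hmt : mt = m' * (p * (p - 1) + 1))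
    (k : ℕ) : algebraMap A _ (algebraMap R A π) ^ (m' + 1) ∣
      (YRing.shift p π m a₁ a₂ ^ k) (algebraMap _ _ z₁ * z₂) - algebraMap _ _ z₁ * z₂ +
        k * algebraMap A _ (algebraMap R A π) ^ m' * algebraMap _ _ z₁ ^ p := by
  have hp : p.Prime := Fact.out
  set ϖ := algebraMap A (YRing p π m a₁ a₂) (algebraMap R A π) with hϖ
  set Z₁ := algebraMap _ (YRing p π m a₁ a₂) z₁ with hZ₁
  -- The displacement of `z₁` is a multiple of `π^m`, negligible modulo `π^(m'+1)`; only `z₂`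
  -- contributes to the leading term.
  have hmm : m' + 1 ≤ m := by rw [hm]; nlinarith [hp.two_le]
  have h1 : ∀ j : ℕ, ϖ ^ (m' + 1) ∣ scaledWittQOne p ϖ m' (Z₁ + j * ϖ ^ m) -
      ϖ ^ m' * Z₁ ^ (p - 1) := by
    intro j
    have h2 := pow_succ_dvd_scaledWittQOne_sub p ϖ hm' (Z₁ + j * ϖ ^ m)
    have h3 : ϖ ∣ (Z₁ + j * ϖ ^ m) ^ (p - 1) - Z₁ ^ (p - 1) := by
      refine dvd_trans ?_ (sub_dvd_pow_sub_pow _ _ _)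
      rw [add_sub_cancel_left]
      exact Dvd.dvd.mul_left (dvd_pow_self _ (by omega)) _
    have h4 : ϖ ^ (m' + 1) ∣ ϖ ^ m' * ((Z₁ + j * ϖ ^ m) ^ (p - 1) - Z₁ ^ (p - 1)) := by
      rw [pow_succ]; exact mul_dvd_mul_left _ h3
    convert dvd_add h2 h4 using 1
    ring
  have h2 : ϖ ^ (m' + 1) ∣ ∑ j ∈ Finset.range k, scaledWittQOne p ϖ m' (Z₁ + j * ϖ ^ m) -
      k * (ϖ ^ m' * Z₁ ^ (p - 1)) := by
    convert Finset.dvd_sum (s := Finset.range k) fun j _ => h1 j using 1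
    rw [Finset.sum_sub_distrib, Finset.sum_const, Finset.card_range, nsmul_eq_mul]
  obtain ⟨y, hy⟩ := h2
  obtain ⟨y', hy'⟩ := pow_dvd_pow ϖ hmm
  have hZp : Z₁ ^ p = Z₁ * Z₁ ^ (p - 1) := by
    rw [← pow_succ', Nat.sub_add_cancel hp.one_le]
  rw [map_mul, E.shift_pow_z₁, E.shift_pow_z₂ hm hmt, ← hϖ, ← hZ₁, sub_eq_iff_eq_add.mp hy, hZp,
    hy']
  refine ⟨-Z₁ * y + k * y' * (z₂ - (ϖ ^ (m' + 1) * y + k * (ϖ ^ m' * Z₁ ^ (p - 1)))), ?_⟩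
  ring

end CoverEquations

/-- The elements that lie in `S` modulo `ϖ` after multiplication by a power of `a`. -/
def Subalgebra.approx {A B : Type*} [CommRing A] [CommRing B] [Algebra A B] (S : Subalgebra A B)
    (a ϖ : A) : Subalgebra A B where
  carrier := {b | ∃ n : ℕ, ∃ w ∈ S, ∃ b', a ^ n • b = w + ϖ • b'}
  mul_mem' := by
    rintro b c ⟨n, w, hw, b', hb⟩ ⟨k, v, hv, c', hc⟩
    refine ⟨n + k, w * v, S.mul_mem hw hv, b' * v + w * c' + ϖ • (b' * c'), ?_⟩
    rw [pow_add, ← smul_mul_smul_comm, hb, hc]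
    simp only [Algebra.smul_def]
    ring
  add_mem' := by
    rintro b c ⟨n, w, hw, b', hb⟩ ⟨k, v, hv, c', hc⟩
    refine ⟨n + k, a ^ k • w + a ^ n • v, S.add_mem (S.smul_mem hw _) (S.smul_mem hv _),
      a ^ k • b' + a ^ n • c', ?_⟩
    have h1 : a ^ (n + k) • (b + c) = a ^ k • a ^ n • b + a ^ n • a ^ k • c := by
      rw [smul_smul, smul_smul, ← pow_add, ← pow_add, add_comm k, smul_add]
    rw [h1, hb, hc]
    simp only [Algebra.smul_def]
    ring
  algebraMap_mem' x := ⟨0, algebraMap A B x, S.algebraMap_mem x, 0, by simp⟩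

theorem Subalgebra.mem_approx_of_smul_eq {A B : Type*} [CommRing A] [CommRing B] [Algebra A B]
    {S : Subalgebra A B} {a ϖ : A} {b c b' : B} {k : ℕ} (hc : c ∈ S.approx a ϖ)
    (h : a ^ k • b = c + ϖ • b') : b ∈ S.approx a ϖ := by
  obtain ⟨n, w, hw, c', hc⟩ := hc
  refine ⟨n + k, w, hw, c' + a ^ n • b', ?_⟩
  rw [pow_add, mul_smul, h, smul_add, hc, smul_comm (a ^ n) ϖ, smul_add, add_assoc]

theorem Subalgebra.le_approx {A B : Type*} [CommRing A] [CommRing B] [Algebra A B]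
    (S : Subalgebra A B) (a ϖ : A) : S ≤ S.approx a ϖ := fun w hw =>
  ⟨0, w, hw, 0, by simp⟩

/-! ### Exact conductors, and generation of `Y` by `z₁ z₂` along the special fibre -/

namespace CoverEquations

variable {R : Type u} [CommRing R] {p : ℕ} [Fact p.Prime] [CharP R p] {π : R} {m : ℕ}
  {A : Type v} [CommRing A] [Algebra R A] {a₁ a₂ : A} {mt m' : ℕ}
  {z₁ : Y₁Ring p π m a₁} {z₂ : YRing p π m a₁ a₂} (E : CoverEquations p π m a₁ a₂ mt z₁ z₂)

include E

theorem pow_dvd_shift_pow_sub (hm' : 0 < m') (hm : m = p * m') (hmt : mt = m' * (p * (p - 1) + 1))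
    (k : ℕ) : algebraMap A _ (algebraMap R A π) ^ m' ∣
      (YRing.shift p π m a₁ a₂ ^ k) (algebraMap _ _ z₁ * z₂) - algebraMap _ _ z₁ * z₂ := by
  have h1 := (pow_dvd_pow _ m'.le_succ).trans (E.dvd_shift_pow_mul_sub hm' hm hmt k)
  refine (dvd_add_left ?_).mp h1
  exact Dvd.dvd.mul_right (dvd_mul_left _ _) _

theorem shift_pow_mul_sub (j : ℕ) :
    (YRing.shift p π m a₁ a₂ ^ (p * j)) (algebraMap _ _ z₁ * z₂) - algebraMap _ _ z₁ * z₂ =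
      algebraMap A _ (algebraMap R A π) ^ mt * (j * algebraMap _ _ z₁) := by
  have h0 : (p : YRing p π m a₁ a₂) = 0 := natCast_eq_zero_of_algebra R p
  rw [map_mul, E.shift_pow_z₁, E.shift_pow_mul_z₂, Nat.cast_mul, h0]
  ring

/-- The leading coefficients are unit multiples of `z₁^p` if `p ∤ k`, at order `m' ≤ mt`, and of
`z₁` if `k = p j` with `p ∤ j`, at order `mt`. The prime `π` divides neither. -/
theorem shift_pow_eq_one [IsDomain (YRing p π m a₁ a₂)] [Nontrivial (SpecialFibre π A)]
    (hm' : 0 < m') (hm : m = p * m') (hmt : mt = m' * (p * (p - 1) + 1)) (k : ℕ)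
    (hk : algebraMap A _ (algebraMap R A π) ^ (mt + 1) ∣
      (YRing.shift p π m a₁ a₂ ^ k) (algebraMap _ _ z₁ * z₂) - algebraMap _ _ z₁ * z₂) :
    YRing.shift p π m a₁ a₂ ^ k = 1 := by
  have hp : p.Prime := Fact.out
  have h0 : (p : YRing p π m a₁ a₂) = 0 := natCast_eq_zero_of_algebra R p
  have hunit : ∀ i : ℕ, ¬ p ∣ i → IsUnit (i : YRing p π m a₁ a₂) := by
    intro i hi
    rw [← Nat.mod_add_div i p, Nat.cast_add, Nat.cast_mul, h0, zero_mul, add_zero]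
    exact isUnit_natCast_of_natCast_eq_zero h0
      (Nat.pos_of_ne_zero fun h' => hi (Nat.dvd_of_mod_eq_zero h')) (Nat.mod_lt _ hp.pos)
  have hcancel : ∀ (n i : ℕ) (y : YRing p π m a₁ a₂),
      algebraMap A _ (algebraMap R A π) ^ (n + 1) ∣
        algebraMap A _ (algebraMap R A π) ^ n * (i * y) →
      ¬ p ∣ i → algebraMap A _ (algebraMap R A π) ∣ y := by
    intro n i y h hi
    rw [pow_succ, mul_dvd_mul_iff_left (pow_ne_zero n E.prime₂.ne_zero)] at h
    exact (hunit i hi).dvd_mul_left.mp h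
  by_cases h : p ∣ k
  · obtain ⟨j, rfl⟩ := h
    by_cases hj : p ∣ j
    · obtain ⟨i, rfl⟩ := hj
      rw [← mul_assoc, ← sq, ← E.orderOf_shift, pow_mul, pow_orderOf_eq_one, one_pow]
    · rw [E.shift_pow_mul_sub] at hk
      exact absurd (hcancel _ _ _ hk hj) E.not_dvd_z₁
  · have h1 := E.dvd_shift_pow_mul_sub hm' hm hmt k
    have hle : m' + 1 ≤ mt + 1 := by rw [hmt]; nlinarith [Nat.zero_le (p * (p - 1))]
    rw [dvd_add_right ((pow_dvd_pow _ hle).trans hk), mul_comm (k : YRing p π m a₁ a₂),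
      mul_assoc] at h1
    exact absurd (E.prime₂.dvd_of_dvd_pow (hcancel _ _ _ h1 h)) E.not_dvd_z₁

omit [CharP R p] in
-- Modulo `π`, `z₁^p = a₁` and `z₂^p = -a₁^(p-1) z₁`, so `s = z₁ z₂` satisfies `s^p = -a₁^p z₁` and
-- `z₁^(p-1) s = a₁ z₂`. Once `a₁` is inverted, `s` generates both.
theorem approx_adjoin_eq_top (hm : 0 < m) (hmt : 0 < mt) :
    (Algebra.adjoin A {algebraMap _ (YRing p π m a₁ a₂) z₁ * z₂}).approx a₁ (algebraMap R A π) =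
      ⊤ := by
  have hp : p.Prime := Fact.out
  have hp1 : 0 < p - 1 := Nat.sub_pos_of_lt hp.one_lt
  set ϖ := algebraMap A (YRing p π m a₁ a₂) (algebraMap R A π) with hϖ
  set Z₁ := algebraMap _ (YRing p π m a₁ a₂) z₁ with hZ₁
  set S := Algebra.adjoin A {Z₁ * z₂}
  have hs : Z₁ * z₂ ∈ S := Algebra.self_mem_adjoin_singleton _ _
  obtain ⟨y, hy⟩ := map_dvd (algebraMap _ (YRing p π m a₁ a₂)) (dvd_secondRhs_add a₂ hm z₁)
  rw [map_add, map_mul, map_pow, ← IsScalarTower.algebraMap_apply,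
    ← IsScalarTower.algebraMap_apply, ← hϖ, ← hZ₁] at hy
  have h1 := E.z₁_pow
  have h2 := E.z₂_pow
  rw [← hϖ, ← hZ₁] at h1
  rw [← hϖ] at h2
  obtain ⟨c₁, hc₁⟩ : ϖ ∣ (ϖ ^ m) ^ (p - 1) := by
    rw [← pow_mul]; exact dvd_pow_self _ (Nat.mul_pos hm hp1).ne'
  obtain ⟨c₂, hc₂⟩ : ϖ ∣ (ϖ ^ mt) ^ (p - 1) := by
    rw [← pow_mul]; exact dvd_pow_self _ (Nat.mul_pos hmt hp1).ne'
  rw [hc₁] at h1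
  rw [hc₂] at h2
  have hmem₁ : Z₁ ∈ S.approx a₁ (algebraMap R A π) := by
    refine Subalgebra.mem_approx_of_smul_eq (k := p)
      (b' := c₁ * Z₁ * z₂ ^ p + algebraMap A _ a₁ * c₂ * z₂ + algebraMap A _ a₁ * y)
      (S.le_approx _ _ (S.neg_mem (S.pow_mem hs p))) ?_
    have h3 : algebraMap A (YRing p π m a₁ a₂) a₁ ^ p =
        algebraMap A _ a₁ * algebraMap A _ a₁ ^ (p - 1) := by
      rw [← pow_succ', Nat.sub_add_cancel hp.one_le]
    rw [Algebra.smul_def, Algebra.smul_def, ← hϖ, map_pow, h3, mul_pow, h1]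
    linear_combination algebraMap A _ a₁ * hy + algebraMap A _ a₁ * h2
  have hmem₂ : z₂ ∈ S.approx a₁ (algebraMap R A π) := by
    refine Subalgebra.mem_approx_of_smul_eq (k := 1) (b' := -(c₁ * Z₁ * z₂))
      ((S.approx _ _).mul_mem ((S.approx _ _).pow_mem hmem₁ (p - 1)) (S.le_approx _ _ hs)) ?_
    have h3 : Z₁ ^ p = Z₁ ^ (p - 1) * Z₁ := by rw [← pow_succ, Nat.sub_add_cancel hp.one_le]
    rw [h3] at h1
    rw [Algebra.smul_def, Algebra.smul_def, ← hϖ, pow_one]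
    linear_combination -z₂ * h1
  refine Algebra.eq_top_iff.mpr fun b => ?_
  obtain ⟨q, rfl⟩ := E.adjoinsRoot_z₂.surjective b
  rw [Polynomial.aeval_eq_sum_range]
  refine (S.approx _ _).sum_mem fun i _ => ?_
  rw [Algebra.smul_def]
  refine (S.approx _ _).mul_mem ?_ ((S.approx _ _).pow_mem hmem₂ i)
  obtain ⟨r, hr⟩ := E.adjoinsRoot_z₁.surjective (q.coeff i)
  rw [← hr, ← Polynomial.aeval_algebraMap_apply]
  exact Algebra.adjoin_le (Set.singleton_subset_iff.mpr hmem₁)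
    (Polynomial.aeval_mem_adjoin_singleton A Z₁)

omit [CharP R p] in
-- Nakayama lifts generation from the special fibre: `d = a₁^n + π e` works, and it is prime to `π`
-- because `a₁` is.
theorem exists_mul_eq_aeval [Nontrivial (SpecialFibre π A)] (hm : 0 < m) (hmt : 0 < mt)
    (ha : ¬ algebraMap A (YRing p π m a₁ a₂) (algebraMap R A π) ∣ algebraMap _ _ a₁) :
    ∃ d : A, ¬ algebraMap A (YRing p π m a₁ a₂) (algebraMap R A π) ∣ algebraMap _ _ d ∧
      ∀ b, ∃ Q : Polynomial A, algebraMap A (YRing p π m a₁ a₂) d * b =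
        Polynomial.aeval (algebraMap _ _ z₁ * z₂) Q := by
  have := E.finite
  obtain ⟨n, e, h⟩ := exists_forall_smul_mem
    (Algebra.adjoin A {algebraMap _ (YRing p π m a₁ a₂) z₁ * z₂}).toSubmodule a₁
      (algebraMap R A π) fun b => by
    have : b ∈ (Algebra.adjoin A {algebraMap _ (YRing p π m a₁ a₂) z₁ * z₂}).approx a₁
        (algebraMap R A π) := by rw [E.approx_adjoin_eq_top hm hmt]; trivial
    exact this
  refine ⟨a₁ ^ n + algebraMap R A π * e, fun hd => ?_, fun b => ?_⟩
  · rw [map_add, map_mul, map_pow, dvd_add_left (dvd_mul_right _ _)] at hd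
    exact ha (E.prime₂.dvd_of_dvd_pow hd)
  · have := h b
    rw [Subalgebra.mem_toSubmodule, Algebra.adjoin_singleton_eq_range_aeval] at this
    obtain ⟨Q, hQ⟩ := this
    exact ⟨Q, by rw [← Algebra.smul_def]; exact hQ.symm⟩

omit [CharP R p] in
theorem not_dvd_algebraMap [Nontrivial (SpecialFibre π A)] (hp2 : 2 ≤ p) (hm : 0 < m) :
    ¬ algebraMap A (YRing p π m a₁ a₂) (algebraMap R A π) ∣ algebraMap _ _ a₁ := by
  intro h
  have h1 : algebraMap A (YRing p π m a₁ a₂) (algebraMap R A π) ∣ algebraMap _ _ z₁ ^ p := by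
    rw [E.z₁_pow, ← pow_mul]
    refine dvd_add (Dvd.dvd.mul_right (dvd_pow_self _ ?_) _) h
    exact (Nat.mul_pos hm (by omega)).ne'
  exact E.not_dvd_z₁ (E.prime₂.dvd_of_dvd_pow h1)

end CoverEquations

end

/-! ### The theorem -/

theorem mainTheorem1 (p : ℕ) [Fact p.Prime] (hp : 2 < p)
    (R : Type u) [CommRing R] [IsDomain R] [IsDiscreteValuationRing R] [CharP R p]
    [IsAdicComplete (IsLocalRing.maximalIdeal R) R]
    (π : R) (hπ : Irreducible π)
    (A : Type u) [CommRing A] [Algebra R A] (hA : IsSmoothFormal R A)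
    (hconn : AlgebraicGeometry.GeometricallyConnected
      (AlgebraicGeometry.Spec.map (CommRingCat.ofHom (algebraMap R A))))
    (m m' : ℕ) (hm' : 0 < m') (hm : m = p * m')
    (a₁ a₂ : A)
    (ha₁ : ¬ ∃ b : SpecialFibre π A, b ^ p = Ideal.Quotient.mk _ a₁) :
    -- the cover is finite, and generically it is an étale torsor under `ℤ/p²`
    Module.Finite A (YRing p π m a₁ a₂) ∧
    IsGenericallyCyclic π (p ^ 2) A (YRing p π m a₁ a₂) ∧
    -- both layers are generically étale torsors under `ℤ/p`
    IsGenericallyCyclic π p A (Y₁Ring p π m a₁) ∧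
    IsGenericallyCyclic π p (Y₁Ring p π m a₁) (YRing p π m a₁ a₂) ∧
    -- the special fibre is reduced
    IsReduced (SpecialFibre π (YRing p π m a₁ a₂)) ∧
    -- both layers are torsors
    Nonempty (TorsorStructure R (MRing R p π m) A (Y₁Ring p π m a₁)) ∧
    Nonempty (TorsorStructure R (MRing R p π (m' * (p * (p - 1) + 1)))
      (Y₁Ring p π m a₁) (YRing p π m a₁ a₂)) ∧
    -- the cover is not a torsor
    ∀ (H : Type w) [CommRing H] [HopfAlgebra R H], Module.Finite R H → Module.Flat R H →
      Module.finrank R H = p ^ 2 →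
      ¬ Nonempty (TorsorStructure R H A (YRing p π m a₁ a₂)) := by
  have hpp : p.Prime := Fact.out
  have hspan := hπ.maximalIdeal_eq
  have hdom := hA.isDomain_specialFibre hspan hconn
  have hreg : algebraMap R A π ∈ nonZeroDivisors A :=
    mem_nonZeroDivisors_iff_right.mpr fun x hx =>
      hA.isSMulRegular hspan hπ.ne_zero (by rwa [mul_comm])
  -- If `ā₁` were `(b / c)^p`, then `c ∣ b` by normality, and `ā₁` would be a `p`-th power in the
  -- ring.
  have ha : ∀ b c : SpecialFibre π A, c ≠ 0 → b ^ p ≠ Ideal.Quotient.mk _ a₁ * c ^ p := by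
    intro b c hc h
    obtain ⟨d, rfl⟩ := hA.dvd_of_pow_eq_mul_pow hspan hc hpp.ne_zero h
    rw [mul_pow, mul_comm] at h
    exact ha₁ ⟨d, mul_right_cancel₀ (pow_ne_zero p hc) h⟩
  have hm0 : 0 < m := by rw [hm]; exact Nat.mul_pos hpp.pos hm'
  obtain ⟨mt, hmt⟩ : ∃ mt, mt = m' * (p * (p - 1) + 1) := ⟨_, rfl⟩
  have hmt' : m * (p * (p - 1) + 1) = p * mt := by rw [hm, hmt, mul_assoc]
  obtain ⟨z₁, z₂, E⟩ := exists_coverEquations (mt := mt) a₂ hreg ha hm0 hmt'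
  rw [← hmt]
  have hmt0 : 0 < mt := by rw [hmt]; positivity
  have := E.isDomain hreg fun a h => hA.eq_zero_of_forall_pow_dvd hspan h
  have := E.isLocalization₁
  have := E.isLocalization₂
  have hCdom := isDomain_quotient_span_of_prime E.prime₁
  have hY : Nontrivial (YGen p π m a₁ a₂) :=
    (IsIntegralClosure.algebraMap_injective (YRing p π m a₁ a₂) A _).nontrivial
  have := (algebraMap (GenericFibre π A) (YGen p π m a₁ a₂)).domain_nontrivial
  have := (algebraMap (Y₁Gen p π m a₁) (YGen p π m a₁ a₂)).domain_nontrivial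
  have : Nontrivial (GenericFibre π (Y₁Ring p π m a₁)) :=
    (IsLocalization.Away.lift (algebraMap R (Y₁Ring p π m a₁) π)
      (IsLocalization.Away.algebraMap_isUnit (S := Y₁Gen p π m a₁)
        (algebraMap A (Y₁Ring p π m a₁) (algebraMap R A π)))).domain_nontrivial
  refine ⟨E.finite, YGen.isGenericallyCyclic p π m a₁ a₂, E.adjoinsRoot_z₁.isGenericallyCyclic,
    E.adjoinsRoot_z₂.isGenericallyCyclic, ?_, ⟨E.adjoinsRoot_z₁.torsorStructure⟩,
    ⟨E.adjoinsRoot_z₂.torsorStructure⟩, ?_⟩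
  · have h := isDomain_quotient_span_of_prime E.prime₂
    rw [← IsScalarTower.algebraMap_apply] at h
    infer_instance
  · intro H _ _ _ _ _
    have : CharP (YRing p π m a₁ a₂) p :=
      (CharP.charP_iff_prime_eq_zero hpp).mpr (natCast_eq_zero_of_algebra R p)
    obtain ⟨d, hd, hs⟩ := E.exists_mul_eq_aeval hm0 hmt0 (E.not_dvd_algebraMap hpp.two_le hm0)
    rw [not_nonempty_iff]
    refine TorsorStructure.isEmpty_of_conductors hp E.prime₂ hd hs (YRing.shift p π m a₁ a₂)
      E.exists_eq_shift_pow E.orderOf_shift (m := m') (n := mt)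
      (E.pow_dvd_shift_pow_sub hm' hm hmt) (fun i => ?_) (E.shift_pow_eq_one hm' hm hmt) ?_ ?_
    · rw [E.shift_pow_mul_sub]
      exact dvd_mul_right _ _
    · nlinarith
    -- As `m̃ = m'(p² - p + 1)`, the inequality `m̃ + 1 ≤ m' p²` amounts to `1 ≤ m'(p - 1)`.
    · obtain ⟨q, rfl⟩ : ∃ q, p = q + 3 := ⟨p - 3, by omega⟩
      rw [hmt, show q + 3 - 1 = q + 2 by omega]
      nlinarith
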